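/- **Proposition (nonemptiness of parametric grammars).** Let $\sigma$ be a vocabulary of function and relation symbols and let $\mathfrak S=(D;I)$ be a $\sigma$-structure with nonempty (finite or infinite) universe $D$. Fix disjoint countably infinite sets $\mathcal C$ of uninterpreted constants (parameters), $\mathcal V$ of local variables, and of nonterminals. A quantifier-free formula of $T=T_{\mathfrak S}$ is a Boolean combination of atomic formulas (equality included) over $\sigma$, $\mathcal C$ and $\mathcal V$; it is satisfiable if it holds in $\mathfrak S$ for some interpretations $X:\mathcal C\to D$ and $Y:\mathcal V\to D$. Formulas are encoded as words over a fixed finite alphabet, where symbols of $\sigma$ are written by means of an arbitrary fixed injective naming by bit strings, and parameters, variables and nonterminals are written as bit strings. A parametric grammar $G$ over $T$ consists of a start nonterminal $S$ and a finite list of productions $(A,\alpha,\varphi)$, where $A$ is a nonterminal, $\alpha$ is a finite sequence of nonterminals, local variables and parameters, and $\varphi$ is a quantifier-free formula of $T$. For an interpretation $X$ of the parameters, $L_X(G)\subseteq D^*$ is the set of nonterminal-free words derivable from $S$, where a step replaces one occurrence of $A$ by $\alpha[X,Y]$ (parameters and local variables replaced by their values) for some production $(A,\alpha,\varphi)$ and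 some interpretation $Y$ of the local variables, chosen afresh in each step, such that $\varphi(X,Y)$ holds in $\mathfrak S$. Let $L(G)=\bigcup_X L_X(G)$. If the satisfiability problem for quantifier-free formulas of $T$ is in NP (respectively PSPACE), then the problem of deciding, given a parametric grammar $G$ over $T$, whether $L(G)\neq\emptyset$ is in NP (respectively PSPACE). -/

import Mathlib

universe u v w

/-! ### Complexity classes, on Mathlib's multi-stack Turing machines -/

namespace Complexity

open Classical in
/-- `P`: the languages over the (finite) alphabet `Γ` whose characteristic function is computed by a
deterministic machine in polynomial time. -/
def PTIME (Γ : Type) : Set (Language Γ) :=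
  {A | Nonempty (Turing.TM2ComputableInPolyTime (id : List Γ → List Γ) Computability.encodeBool
    (fun x => decide (x ∈ A)))}

/-- The pair of an input `x` and a certificate `w` as one word. -/
def withCertificate {Γ : Type} (x : List Γ) (w : List Bool) : List (Γ ⊕ Bool) :=
  x.map Sum.inl ++ w.map Sum.inr

/-- `NP`: the languages with a polynomial-time verifier for certificates of polynomial length. -/
def NP (Γ : Type) : Set (Language Γ) :=
  {A | ∃ R ∈ PTIME (Γ ⊕ Bool), ∃ q : Polynomial ℕ, ∀ x : List Γ,
    x ∈ A ↔ ∃ w : List Bool, w.length ≤ q.eval x.length ∧ withCertificate x w ∈ R}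

/-- The space that a configuration occupies: the total height of all the stacks. -/
def cfgSpace (tm : Turing.FinTM2) (c : tm.Cfg) : ℕ :=
  ∑ k ∈ @Finset.univ tm.K tm.kFin, (c.stk k).length

open Classical in
/-- `PSPACE`: the languages over the (finite) alphabet `Γ` whose characteristic function is computed
by a deterministic machine that halts on every input and occupies polynomial space in every
configuration that it reaches. -/
def PSPACE (Γ : Type) : Set (Language Γ) :=
  {A | ∃ M : Turing.TM2Computable (id : List Γ → List Γ) Computability.encodeBool
      (fun x => decide (x ∈ A)),
    ∃ p : Polynomial ℕ, ∀ (x : List Γ) (c : M.tm.Cfg),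
      StateTransition.Reaches M.tm.step
        (Turing.initList M.tm (x.map M.inputAlphabet.invFun)) c →
      cfgSpace M.tm c ≤ p.eval x.length}

end Complexity

namespace ParametricGrammar

/-- Names of parameters (uninterpreted constants), of local variables and of nonterminals. The three
kinds of names are kept apart by the constructors under which they occur. -/
abbrev Ident : Type := List Bool

/-- Formulas over the vocabulary `L`; a free variable `Sum.inl a` is the parameter (uninterpreted
constant) `a`, and `Sum.inr y` is the local variable `y`. -/
abbrev GuardFormula (L : FirstOrder.Language.{u, v}) : Type (max u v) := L.Formula (Ident ⊕ Ident)

/-- A production `(A, α, φ)`. A terminal `Sum.inl a` of the right-hand side is the parameter `a`,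
and `Sum.inr y` is the local variable `y`. -/
structure Production (L : FirstOrder.Language.{u, v}) where
  lhs : Ident
  rhs : List (Symbol (Ident ⊕ Ident) Ident)
  guard : GuardFormula L
  guard_isQF : guard.IsQF

/-- A parametric grammar over the vocabulary `L`. Its finite sets of parameters and of nonterminals
are those whose names occur in it. -/
structure Grammar (L : FirstOrder.Language.{u, v}) where
  start : Ident
  productions : List (Production L)

section Semantics

variable {L : FirstOrder.Language.{u, v}} {D : Type w} [L.Structure D]

/-- Substitution of the values of the parameters and of the local variables in a symbol. -/
def instSymbol (X Y : Ident → D) : Symbol (Ident ⊕ Ident) Ident → Symbol D Ident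
  | Symbol.terminal t => Symbol.terminal (Sum.elim X Y t)
  | Symbol.nonterminal A => Symbol.nonterminal A

/-- The rewriting rule `A → α[X, Y]` obtained from a production. -/
def Production.inst (r : Production L) (X Y : Ident → D) : ContextFreeRule D Ident :=
  ⟨r.lhs, r.rhs.map (instSymbol X Y)⟩

/-- One derivation step, for the interpretation `X` of the parameters. The local variables are
interpreted afresh in each step. -/
def Grammar.Produces (G : Grammar L) (X : Ident → D) (u v : List (Symbol D Ident)) : Prop :=
  ∃ r ∈ G.productions, ∃ Y : Ident → D,
    r.guard.Realize (Sum.elim X Y) ∧ (r.inst X Y).Rewrites u v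

/-- `L_X(G)`. -/
def Grammar.languageAt (G : Grammar L) (X : Ident → D) : Language D :=
  {word | Relation.ReflTransGen (G.Produces X) [Symbol.nonterminal G.start]
    (word.map Symbol.terminal)}

/-- `L(G)`, the union of all `L_X(G)`. -/
def Grammar.language (G : Grammar L) (D : Type w) [L.Structure D] : Language D :=
  ⋃ X : Ident → D, G.languageAt X

/-- Satisfiability in the structure `D`. -/
def Satisfiable (φ : GuardFormula L) (D : Type w) [L.Structure D] : Prop :=
  ∃ X Y : Ident → D, φ.Realize (Sum.elim X Y)

end Semantics

/-! ### Formulas and grammars as words over a finite alphabet -/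

/-- The alphabet in which formulas and grammars are written. -/
inductive Tok
  | bit (b : Bool)
  | fin
  | param
  | loc
  | bound
  | func
  | rel
  | eq
  | bot
  | imp
  | all
  | lpar
  | rpar
  | nonterm
  | rule
  | guard
  deriving DecidableEq, Fintype

/-- A terminated bit string. -/
def encodeIdent (a : List Bool) : List Tok := a.map Tok.bit ++ [Tok.fin]

/-- An injective naming of the vocabulary symbols by bit strings. The two maps also see the arities,
so that the name of a symbol determines its arity. -/
structure SymbolCoding (L : FirstOrder.Language.{u, v}) where
  funcCode : (Σ n, L.Functions n) → List Bool
  relCode : (Σ n, L.Relations n) → List Bool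
  funcCode_injective : Function.Injective funcCode
  relCode_injective : Function.Injective relCode

section Encoding

variable {L : FirstOrder.Language.{u, v}} (c : SymbolCoding L)

/-- A parameter or a local variable. -/
def encodeAtom : Ident ⊕ Ident → List Tok
  | Sum.inl a => Tok.param :: encodeIdent a
  | Sum.inr y => Tok.loc :: encodeIdent y

/-- Terms in prefix notation. -/
def encodeTerm {n : ℕ} : L.Term ((Ident ⊕ Ident) ⊕ Fin n) → List Tok
  | FirstOrder.Language.Term.var (Sum.inl a) => encodeAtom a
  | FirstOrder.Language.Term.var (Sum.inr i) =>
      Tok.bound :: encodeIdent (List.replicate i.val true)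
  | FirstOrder.Language.Term.func (l := k) f ts =>
      Tok.func :: encodeIdent (c.funcCode ⟨k, f⟩) ++
        (List.ofFn fun i => encodeTerm (ts i)).flatten

/-- Formulas in parenthesized prefix notation. The clause for quantifiers makes the function total;
it is not used on quantifier-free formulas. -/
def encodeFormula : {n : ℕ} → L.BoundedFormula (Ident ⊕ Ident) n → List Tok
  | _, FirstOrder.Language.BoundedFormula.falsum => [Tok.lpar, Tok.bot, Tok.rpar]
  | _, FirstOrder.Language.BoundedFormula.equal t₁ t₂ =>
      [Tok.lpar, Tok.eq] ++ encodeTerm c t₁ ++ encodeTerm c t₂ ++ [Tok.rpar]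
  | _, FirstOrder.Language.BoundedFormula.rel (l := k) R ts =>
      [Tok.lpar, Tok.rel] ++ encodeIdent (c.relCode ⟨k, R⟩) ++
        (List.ofFn fun i => encodeTerm c (ts i)).flatten ++ [Tok.rpar]
  | _, FirstOrder.Language.BoundedFormula.imp φ ψ =>
      [Tok.lpar, Tok.imp] ++ encodeFormula φ ++ encodeFormula ψ ++ [Tok.rpar]
  | _, FirstOrder.Language.BoundedFormula.all φ =>
      [Tok.lpar, Tok.all] ++ encodeFormula φ ++ [Tok.rpar]

/-- A symbol of a right-hand side. -/
def encodeSymbol : Symbol (Ident ⊕ Ident) Ident → List Tok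
  | Symbol.terminal t => encodeAtom t
  | Symbol.nonterminal A => Tok.nonterm :: encodeIdent A

def encodeProduction (r : Production L) : List Tok :=
  Tok.rule :: encodeIdent r.lhs ++ r.rhs.flatMap encodeSymbol ++
    Tok.guard :: encodeFormula c r.guard

def encodeGrammar (G : Grammar L) : List Tok :=
  encodeIdent G.start ++ G.productions.flatMap (encodeProduction c)

/-- The satisfiability problem of the quantifier-free theory of the structure `D`. -/
def satProblem (D : Type w) [L.Structure D] : Language Tok :=
  {x | ∃ φ : GuardFormula L, φ.IsQF ∧ encodeFormula c φ = x ∧ Satisfiable φ D}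

/-- The nonemptiness problem of parametric grammars over the theory of the structure `D`. -/
def nonemptinessProblem (D : Type w) [L.Structure D] : Language Tok :=
  {x | ∃ G : Grammar L, encodeGrammar c G = x ∧ Set.Nonempty (G.language D : Set (List D))}

end Encoding

end ParametricGrammar

/-! Fix the values `X` of the parameters. Since local variables are interpreted afresh in every
step, whether a production can be used depends only on whether its guard is satisfiable under `X`,
and the terminals it produces never block a derivation. So L_X(G) is nonempty iff the start symbol
is productive in the context-free grammar of the productions enabled by `X`
(`Grammar.language_nonempty_iff`). Consequently L(G) is nonempty iff some selection of productions
makes the start symbol productive and has guards that are jointly satisfiable, with shared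
parameters and with local variables renamed apart.

A selection is given by marking the tokens of the input with bits, of which only those at `rule`
count. From a marked text `a` the word `reduction a` is computed by repeated scans. They saturate
the list of productive nonterminals and write the formula ((g₀ → (g₁ → … → ⊥)) → ⊥), that is, the
conjunction of the gᵢ, where the local variables of rule number i receive the prefix 1ⁱ0. If the
text has the wrong shape or the start symbol is not productive, the result is the empty word, which
encodes no formula.

The naming of the symbols of the vocabulary is arbitrary, so a machine cannot be expected to
recognise which texts are formulas. For this reason the guard g of an unselected rule is kept in the
formula, in the harmless form ⊥ → g: if the whole word is the encoding of a quantifier-free formula,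
then so is every guard, and the input does encode a grammar. The pivot is
`mem_nonemptinessProblem_iff`: a word is a positive instance iff some marking of it is reduced to a
satisfiable formula.

For NP, a certificate consists of the marks followed by a certificate for the formula. For PSPACE,
all markings are enumerated by a binary counter, and each formula is tested by the given machine.
What remains is to build the machines. Programs are composed by combinators that carry time and
space bounds (`Program.Runs`, `RegProgram.Does`), a time bound yields a space bound because a step
pushes boundedly many symbols, and the given machine runs on its own stacks beside those of the
program (`runs_call`). -/

/-! ### Structured programs for stack machines -/

namespace StackProgram

open Turing TM2 Function

/-! ### Relabelling of code, height of stacks, and computation paths of bounded height. -/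

section Basic

variable {K : Type} {Γ : K → Type} {σ Λ Λ' : Type}

/-- The total height of a family of stacks. -/
def height [Fintype K] (S : ∀ k, List (Γ k)) : ℕ := ∑ k, (S k).length

/-- Rename the labels of a statement and replace `halt` by a jump to `e` (if `e` is a label). -/
def relabel (f : Λ → Λ') (e : Option Λ') : Stmt Γ Λ σ → Stmt Γ Λ' σ
  | .push k g q => .push k g (relabel f e q)
  | .peek k g q => .peek k g (relabel f e q)
  | .pop k g q => .pop k g (relabel f e q)
  | .load g q => .load g (relabel f e q)
  | .branch g q₁ q₂ => .branch g (relabel f e q₁) (relabel f e q₂)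
  | .goto l => .goto fun v => f (l v)
  | .halt => e.elim .halt fun l => .goto fun _ => l

/-- The effect of `relabel` on configurations. -/
def relabelCfg (f : Λ → Λ') (e : Option Λ') (c : Cfg Γ Λ σ) : Cfg Γ Λ' σ :=
  ⟨c.l.elim e fun l => some (f l), c.var, c.stk⟩

variable [DecidableEq K]

theorem stepAux_relabel (f : Λ → Λ') (e : Option Λ') (q : Stmt Γ Λ σ) (v : σ)
    (S : ∀ k, List (Γ k)) :
    stepAux (relabel f e q) v S = relabelCfg f e (stepAux q v S) := by
  induction q generalizing v S with
  | push k g q ih => exact ih _ _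
  | peek k g q ih => exact ih _ _
  | pop k g q ih => exact ih _ _
  | load g q ih => exact ih _ _
  | branch g q₁ q₂ ih₁ ih₂ =>
    simp only [relabel, stepAux]
    cases g v
    · exact ih₂ _ _
    · exact ih₁ _ _
  | goto l => rfl
  | halt => cases e <;> rfl

theorem step_relabel {M : Λ → Stmt Γ Λ σ}
    {M' : Λ' → Stmt Γ Λ' σ} (f : Λ → Λ') (e : Option Λ') (h : ∀ l, M' (f l) = relabel f e (M l))
    (c d : Cfg Γ Λ σ) (hc : step M c = some d) :
    step M' (relabelCfg f e c) = some (relabelCfg f e d) := by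
  obtain ⟨l, v, S⟩ := c
  cases l with
  | none => simp at hc
  | some l =>
    simp only [step, Option.some.injEq] at hc
    subst hc
    simp only [relabelCfg, Option.elim, step, h, stepAux_relabel]

/-- An upper bound for the number of symbols that a statement pushes. -/
def pushes : Stmt Γ Λ σ → ℕ
  | .push _ _ q => pushes q + 1
  | .peek _ _ q => pushes q
  | .pop _ _ q => pushes q
  | .load _ q => pushes q
  | .branch _ q₁ q₂ => pushes q₁ + pushes q₂
  | .goto _ => 0
  | .halt => 0

variable [Fintype K]

/-- In additive form, because the new stack may be shorter than the old one and subtraction on `ℕ`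
truncates. -/
theorem height_update (S : ∀ k, List (Γ k)) (k : K) (l : List (Γ k)) :
    height (update S k l) + (S k).length = height S + l.length := by
  classical
  have h : ∀ T : ∀ k, List (Γ k),
      height T = (T k).length + ∑ j ∈ Finset.univ.erase k, (T j).length := fun T =>
    (Finset.add_sum_erase _ (fun j => (T j).length) (Finset.mem_univ k)).symm
  rw [h S, h (update S k l), update_self,
    Finset.sum_congr rfl fun j hj => by rw [update_of_ne (Finset.ne_of_mem_erase hj)]]
  omega

theorem height_stepAux (q : Stmt Γ Λ σ) (v : σ) (S : ∀ k, List (Γ k)) :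
    height (stepAux q v S).stk ≤ height S + pushes q := by
  induction q generalizing v S with
  | push k g q ih =>
    have h := height_update S k (g v :: S k)
    have := ih v (update S k (g v :: S k))
    simp only [stepAux, pushes, List.length_cons] at *
    omega
  | peek k g q ih => exact ih _ _
  | pop k g q ih =>
    have h := height_update S k (S k).tail
    have := ih (g v (S k).head?) (update S k (S k).tail)
    simp only [stepAux, pushes, List.length_tail] at *
    omega
  | load g q ih => exact ih _ _
  | branch g q₁ q₂ ih₁ ih₂ =>
    have h₁ := ih₁ v S
    have h₂ := ih₂ v S
    simp only [stepAux, pushes]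
    cases g v <;> simp only [cond] <;> omega
  | goto l => exact le_refl _
  | halt => exact le_refl _

/-- `Path M m n c d`: the machine goes from `c` to `d` in `n` steps, through configurations of
height at most `m`. -/
inductive Path (M : Λ → Stmt Γ Λ σ) (m : ℕ∞) : ℕ → Cfg Γ Λ σ → Cfg Γ Λ σ → Prop
  | refl (c : Cfg Γ Λ σ) (h : (height c.stk : ℕ∞) ≤ m) : Path M m 0 c c
  | head {n : ℕ} {c d e : Cfg Γ Λ σ} (h : (height c.stk : ℕ∞) ≤ m) (hs : step M c = some d)
      (hp : Path M m n d e) : Path M m (n + 1) c e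

namespace Path

variable {M : Λ → Stmt Γ Λ σ} {m : ℕ∞} {n n' : ℕ} {c d e : Cfg Γ Λ σ}

theorem height_le (h : Path M m n c d) : (height c.stk : ℕ∞) ≤ m := by
  cases h <;> assumption

theorem trans (h : Path M m n c d) (h' : Path M m n' d e) : Path M m (n + n') c e := by
  induction h with
  | refl c hc => simpa using h'
  | head hc hs _ ih => rw [Nat.add_right_comm]; exact .head hc hs (ih h')

theorem mono {m' : ℕ∞} (hm : m ≤ m') (h : Path M m n c d) : Path M m' n c d := by
  induction h with
  | refl c hc => exact .refl c (hc.trans hm)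
  | head hc hs _ ih => exact .head (hc.trans hm) hs ih

/-- Transport along a simulation that preserves steps. -/
theorem map {K' : Type} [DecidableEq K'] [Fintype K'] {Γ' : K' → Type} {σ' : Type}
    {M' : Λ' → Stmt Γ' Λ' σ'} {m' : ℕ∞} (φ : Cfg Γ Λ σ → Cfg Γ' Λ' σ')
    (hφ : ∀ c d, step M c = some d → step M' (φ c) = some (φ d))
    (hm : ∀ c, (height c.stk : ℕ∞) ≤ m → (height (φ c).stk : ℕ∞) ≤ m')
    (h : Path M m n c d) : Path M' m' n (φ c) (φ d) := by
  induction h with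
  | refl c hc => exact .refl _ (hm _ hc)
  | head hc hs _ ih => exact .head (hm _ hc) (hφ _ _ hs) ih

theorem relabelled {M' : Λ' → Stmt Γ Λ' σ} (f : Λ → Λ') (e : Option Λ')
    (h : ∀ l, M' (f l) = relabel f e (M l)) (hp : Path M m n c d) :
    Path M' m n (relabelCfg f e c) (relabelCfg f e d) :=
  hp.map (relabelCfg f e) (step_relabel f e h) fun _ hc => hc

/-- Each step raises the height by at most `B`. Hence programs need only be analysed for time; their
space bound follows. -/
theorem height_bound {B : ℕ} (hB : ∀ l, pushes (M l) ≤ B) (h : Path M ⊤ n c d) :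
    Path M ((height c.stk + B * n : ℕ) : ℕ∞) n c d := by
  induction h with
  | refl c hc => exact .refl c (by simp)
  | @head n c d e hc hs _ ih =>
    refine .head (by exact_mod_cast Nat.le_add_right _ _) hs (ih.mono ?_)
    obtain ⟨l, v, S⟩ := c
    cases l with
    | none => simp at hs
    | some l =>
      simp only [step, Option.some.injEq] at hs
      subst hs
      have := height_stepAux (M l) v S
      have := hB l
      rw [Nat.cast_le, Nat.mul_succ]
      dsimp only
      omega

/-- The machine is deterministic and a halted configuration has no successor, so everything
reachable from `c` lies on the given halting path. This supplies the quantifier over reachable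
configurations in `Complexity.PSPACE`. -/
theorem reaches_height_le {v : σ} {S : ∀ k, List (Γ k)} (h : Path M m n c ⟨none, v, S⟩)
    (hr : StateTransition.Reaches (step M) c e) : (height e.stk : ℕ∞) ≤ m := by
  generalize hd : (⟨none, v, S⟩ : Cfg Γ Λ σ) = d at h
  induction h with
  | refl c hc =>
    subst hd
    rcases Relation.ReflTransGen.cases_head hr with rfl | ⟨_, h', _⟩
    · exact hc
    · simp at h'
  | head hc hs _ ih =>
    rcases Relation.ReflTransGen.cases_head hr with rfl | ⟨_, h', hr'⟩
    · exact hc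
    · rw [Option.mem_def, hs, Option.some.injEq] at h'
      subst h'
      exact ih hr' hd

theorem iterate_eq (h : Path M m n c d) : (flip bind (step M))^[n] (some c) = some d := by
  induction h with
  | refl c hc => rfl
  | head hc hs _ ih => rw [iterate_succ_apply]; simpa [flip, hs] using ih

theorem of_iterate_eq (hm : ∀ e, StateTransition.Reaches (step M) c e → (height e.stk : ℕ∞) ≤ m)
    (h : (flip bind (step M))^[n] (some c) = some d) : Path M m n c d := by
  induction n generalizing c with
  | zero =>
    obtain rfl : c = d := by simpa using h
    exact .refl _ (hm _ .refl)
  | succ n ih =>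
    rw [iterate_succ_apply] at h
    cases hs : step M c with
    -- A machine without a next configuration would stay at `none` in all further iterations and
    -- never yield `some d`.
    | none =>
      exfalso
      have : ∀ k, (flip bind (step M))^[k] none = none := fun k => by
        induction k with
        | zero => rfl
        | succ k ih => rw [iterate_succ_apply]; exact ih
      simp only [flip, Option.bind_eq_bind, Option.bind_some, hs] at h
      exact absurd ((this n).symm.trans h) (by simp)
    | some e =>
      refine .head (hm _ .refl) hs (ih (fun e' he => hm e' (.head hs he)) ?_)
      simpa [flip, hs] using h

end Path

end Basic

/-- A program: a piece of code with an entry label. It ends by halting. -/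
structure Program {K : Type} (Γ : K → Type) (σ : Type) where
  Label : Type
  [labelFintype : Fintype Label]
  entry : Label
  code : Label → Stmt Γ Label σ

attribute [instance] Program.labelFintype

/-- The contents of the memory: the internal state and the stacks. -/
abbrev Mem {K : Type} (Γ : K → Type) (σ : Type) : Type := σ × ∀ k, List (Γ k)

namespace Program

/-! ### Sequencing and loops, with bounds for time and space. -/

section Combinators

variable {K : Type} {Γ : K → Type} {σ : Type}

/-- A single statement. -/
def ofStmt (q : Stmt Γ Unit σ) : Program Γ σ := ⟨Unit, (), fun _ => q⟩

/-- Run `P`, then `Q`. -/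
def seq (P Q : Program Γ σ) : Program Γ σ where
  Label := P.Label ⊕ Q.Label
  entry := .inl P.entry
  code
    | .inl l => relabel .inl (some (.inr Q.entry)) (P.code l)
    | .inr l => relabel .inr none (Q.code l)

/-- Repeat `P` while the test holds. -/
def loop (b : σ → Bool) (P : Program Γ σ) : Program Γ σ where
  Label := Unit ⊕ P.Label
  entry := .inl ()
  code
    | .inl _ => .branch b (.goto fun _ => .inr P.entry) .halt
    | .inr l => relabel .inr (some (.inl ())) (P.code l)

/-- Pop the symbols of a stack one by one and run `P` for each of them. The test `b` tells whether
the last pop was successful. -/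
def forEach (k : K) (set : σ → Option (Γ k) → σ) (b : σ → Bool) (P : Program Γ σ) :
    Program Γ σ where
  Label := Unit ⊕ P.Label
  entry := .inl ()
  code
    | .inl _ => .pop k set (.branch b (.goto fun _ => .inr P.entry) .halt)
    | .inr l => relabel .inr (some (.inl ())) (P.code l)

/-- An upper bound for the number of symbols that one step of the program pushes. -/
def pushBound (P : Program Γ σ) : ℕ := Finset.univ.sup fun l => pushes (P.code l)

theorem pushes_le_pushBound (P : Program Γ σ) (l : P.Label) : pushes (P.code l) ≤ P.pushBound :=
  Finset.le_sup (f := fun l => pushes (P.code l)) (Finset.mem_univ l)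

variable [DecidableEq K] [Fintype K]

/-- `P.Runs s t m s'`: started in `s`, the program `P` ends in `s'`, in time `t` and space `m`. -/
def Runs (P : Program Γ σ) (s : Mem Γ σ) (t : ℕ) (m : ℕ∞) (s' : Mem Γ σ) : Prop :=
  ∃ n ≤ t, Path P.code m n ⟨some P.entry, s.1, s.2⟩ ⟨none, s'.1, s'.2⟩

variable {P Q : Program Γ σ} {s s' s'' : Mem Γ σ} {t t' : ℕ} {m m' : ℕ∞}

namespace Runs

theorem mono (h : P.Runs s t m s') (ht : t ≤ t') (hm : m ≤ m') : P.Runs s t' m' s' := by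
  obtain ⟨n, hn, h⟩ := h
  exact ⟨n, hn.trans ht, h.mono hm⟩

theorem mono_time (h : P.Runs s t m s') (ht : t ≤ t') : P.Runs s t' m s' :=
  h.mono ht le_rfl

theorem ofStmt {q : Stmt Γ Unit σ} (h : stepAux q s.1 s.2 = ⟨none, s'.1, s'.2⟩) :
    (ofStmt q).Runs s 1 ⊤ s' :=
  ⟨1, le_rfl, .head le_top (by simp [Program.ofStmt, h]) (.refl _ le_top)⟩

theorem seq (h : P.Runs s t m s') (h' : Q.Runs s' t' m s'') :
    (P.seq Q).Runs s (t + t') m s'' := by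
  obtain ⟨n, hn, h⟩ := h
  obtain ⟨n', hn', h'⟩ := h'
  exact ⟨n + n', by omega,
    (h.relabelled (M' := (P.seq Q).code) .inl (some (.inr Q.entry)) fun _ => rfl).trans
    (h'.relabelled (M' := (P.seq Q).code) .inr none fun _ => rfl)⟩

theorem loop_false {b : σ → Bool} (hb : b s.1 = false) (hm : (height s.2 : ℕ∞) ≤ m) :
    (Program.loop b P).Runs s 1 m s :=
  ⟨1, le_rfl, .head hm (by simp [Program.loop, hb]) (.refl _ hm)⟩

theorem loop_true {b : σ → Bool} (hb : b s.1 = true) (h : P.Runs s t m s')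
    (h' : (Program.loop b P).Runs s' t' m s'') :
    (Program.loop b P).Runs s (t + t' + 1) m s'' := by
  obtain ⟨n, hn, h⟩ := h
  obtain ⟨n', hn', h'⟩ := h'
  refine ⟨n + n' + 1, by omega, .head h.height_le ?_
    ((h.relabelled (M' := (Program.loop b P).code) .inr (some (.inl ())) fun _ => rfl).trans h')⟩
  simp [Program.loop, hb, relabelCfg]

/-- The effect of `forEach` is a left fold. `E x l` is the memory when `x` has been computed so far
and `l` is what remains on the stack. -/
theorem forEach {k : K} {set : σ → Option (Γ k) → σ} {b : σ → Bool} {β : Type*}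
    (E : β → List (Γ k) → Mem Γ σ) (f : β → Γ k → β) (J : β → List (Γ k) → Prop) {T : ℕ}
    (hk : ∀ x l, (E x l).2 k = l) (hu : ∀ x a l, update (E x (a :: l)).2 k l = (E x l).2)
    (hv : ∀ x a l, (E x (a :: l)).1 = (E x l).1)
    (hb : ∀ v a, b (set v a) = a.isSome)
    (hJ : ∀ x a l, J x (a :: l) → J (f x a) l)
    (hP : ∀ x a l, J x (a :: l) →
      P.Runs (set (E x l).1 (some a), (E x l).2) T ⊤ (E (f x a) l))
    (x : β) (l : List (Γ k)) (hx : J x l) :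
    (forEach k set b P).Runs (E x l) (l.length * (T + 1) + 1) ⊤
      (set (E (l.foldl f x) []).1 none, (E (l.foldl f x) []).2) := by
  induction l generalizing x with
  | nil =>
    refine ⟨1, by omega, .head le_top ?_ (.refl _ le_top)⟩
    -- The unsuccessful pop that ends the loop leaves the empty stack as it is.
    have h : update (E x []).2 k [] = (E x []).2 :=
      (congrArg (update _ k) (hk x []).symm).trans (update_eq_self k _)
    simp [Program.forEach, hb, hk, h]
  | cons a l ih =>
    obtain ⟨n, hn, h⟩ := hP x a l hx
    obtain ⟨n', hn', h'⟩ := ih _ (hJ _ _ _ hx)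
    refine ⟨n + n' + 1, ?_, .head le_top ?_
      ((StackProgram.Path.relabelled (M' := (Program.forEach k set b P).code)
        .inr (some (.inl ())) (fun _ => rfl) h).trans
        h')⟩
    · rw [List.length_cons, Nat.succ_mul]; omega
    · simp [Program.forEach, hb, hk, hu, hv, relabelCfg]

end Runs

theorem Runs.bound_space (h : P.Runs s t ⊤ s') :
    P.Runs s t ((height s.2 + P.pushBound * t : ℕ) : ℕ∞) s' := by
  obtain ⟨n, hn, h⟩ := h
  refine ⟨n, hn, (h.height_bound P.pushes_le_pushBound).mono ?_⟩
  exact_mod_cast Nat.add_le_add_left (Nat.mul_le_mul_left _ hn) _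

end Combinators

/-! ### Programs on a part of the stacks -/

section Lift

variable {K K' : Type} {Γ : K → Type} {Γ' : K' → Type} {σ σ' Λ : Type}

/-- Two families of stacks as one. -/
def join (S : ∀ k, List (Γ k)) (S' : ∀ k, List (Γ' k)) :
    ∀ k : K ⊕ K', List (Sum.elim Γ Γ' k)
  | .inl k => S k
  | .inr k => S' k

def liftLeftStmt : Stmt Γ Λ σ → Stmt (Sum.elim Γ Γ') Λ (σ × σ')
  | .push k g q => .push (.inl k) (fun v => g v.1) (liftLeftStmt q)
  | .peek k g q => .peek (.inl k) (fun v a => (g v.1 a, v.2)) (liftLeftStmt q)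
  | .pop k g q => .pop (.inl k) (fun v a => (g v.1 a, v.2)) (liftLeftStmt q)
  | .load g q => .load (fun v => (g v.1, v.2)) (liftLeftStmt q)
  | .branch g q₁ q₂ => .branch (fun v => g v.1) (liftLeftStmt q₁) (liftLeftStmt q₂)
  | .goto l => .goto fun v => l v.1
  | .halt => .halt

def liftRightStmt : Stmt Γ' Λ σ' → Stmt (Sum.elim Γ Γ') Λ (σ × σ')
  | .push k g q => .push (.inr k) (fun v => g v.2) (liftRightStmt q)
  | .peek k g q => .peek (.inr k) (fun v a => (v.1, g v.2 a)) (liftRightStmt q)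
  | .pop k g q => .pop (.inr k) (fun v a => (v.1, g v.2 a)) (liftRightStmt q)
  | .load g q => .load (fun v => (v.1, g v.2)) (liftRightStmt q)
  | .branch g q₁ q₂ => .branch (fun v => g v.2) (liftRightStmt q₁) (liftRightStmt q₂)
  | .goto l => .goto fun v => l v.2
  | .halt => .halt

/-- The program `P` on the left part of the memory. -/
def liftLeft (P : Program Γ σ) (Γ' : K' → Type) (σ' : Type) :
    Program (Sum.elim Γ Γ') (σ × σ') :=
  ⟨P.Label, P.entry, fun l => liftLeftStmt (P.code l)⟩

/-- The program `P` on the right part of the memory. -/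
def liftRight (Γ : K → Type) (σ : Type) (P : Program Γ' σ') :
    Program (Sum.elim Γ Γ') (σ × σ') :=
  ⟨P.Label, P.entry, fun l => liftRightStmt (P.code l)⟩

theorem height_join [Fintype K] [Fintype K'] (S : ∀ k, List (Γ k)) (S' : ∀ k, List (Γ' k)) :
    height (join S S') = height S + height S' := by
  simp only [height, Fintype.sum_sum_type]
  rfl

variable [DecidableEq K] [DecidableEq K']

theorem update_join_inl (S : ∀ k, List (Γ k)) (S' : ∀ k, List (Γ' k)) (k : K) (l : List (Γ k)) :
    update (join S S') (.inl k) l = join (update S k l) S' := by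
  funext j
  cases j with
  | inl j =>
    by_cases h : j = k
    · subst h
      exact (update_self (Sum.inl j) _ (join S S')).trans (update_self j l S).symm
    · have h₁ : update (join S S') (.inl k) l (.inl j) = S j :=
        update_of_ne (fun h' => h (Sum.inl_injective h')) _ _
      have h₂ : update S k l j = S j := update_of_ne h _ _
      exact h₁.trans h₂.symm
  | inr j => exact update_of_ne Sum.inr_ne_inl _ _

theorem update_join_inr (S : ∀ k, List (Γ k)) (S' : ∀ k, List (Γ' k)) (k : K') (l : List (Γ' k)) :
    update (join S S') (.inr k) l = join S (update S' k l) := by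
  funext j
  cases j with
  | inr j =>
    by_cases h : j = k
    · subst h
      exact (update_self (Sum.inr j) _ (join S S')).trans (update_self j l S').symm
    · have h₁ : update (join S S') (.inr k) l (.inr j) = S' j :=
        update_of_ne (fun h' => h (Sum.inr_injective h')) _ _
      have h₂ : update S' k l j = S' j := update_of_ne h _ _
      exact h₁.trans h₂.symm
  | inl j => exact update_of_ne Sum.inl_ne_inr _ _

theorem stepAux_liftLeftStmt (q : Stmt Γ Λ σ) (v : σ) (v' : σ') (S : ∀ k, List (Γ k))
    (S' : ∀ k, List (Γ' k)) :
    stepAux (liftLeftStmt q) (v, v') (join S S') =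
      ⟨(stepAux q v S).l, ((stepAux q v S).var, v'), join (stepAux q v S).stk S'⟩ := by
  induction q generalizing v S with
  | push k g q ih =>
    exact (congrArg (stepAux (liftLeftStmt q) _) (update_join_inl ..)).trans (ih _ _)
  | peek k g q ih => exact ih _ _
  | pop k g q ih =>
    exact (congrArg (stepAux (liftLeftStmt q) _) (update_join_inl ..)).trans (ih _ _)
  | load g q ih => exact ih _ _
  | branch g q₁ q₂ ih₁ ih₂ =>
    simp only [liftLeftStmt, stepAux]
    cases g v
    · exact ih₂ _ _
    · exact ih₁ _ _
  | goto l => rfl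
  | halt => rfl

theorem stepAux_liftRightStmt (q : Stmt Γ' Λ σ') (v : σ) (v' : σ') (S : ∀ k, List (Γ k))
    (S' : ∀ k, List (Γ' k)) :
    stepAux (liftRightStmt q) (v, v') (join S S') =
      ⟨(stepAux q v' S').l, (v, (stepAux q v' S').var), join S (stepAux q v' S').stk⟩ := by
  induction q generalizing v' S' with
  | push k g q ih =>
    exact (congrArg (stepAux (liftRightStmt q) _) (update_join_inr ..)).trans (ih _ _)
  | peek k g q ih => exact ih _ _
  | pop k g q ih =>
    exact (congrArg (stepAux (liftRightStmt q) _) (update_join_inr ..)).trans (ih _ _)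
  | load g q ih => exact ih _ _
  | branch g q₁ q₂ ih₁ ih₂ =>
    simp only [liftRightStmt, stepAux]
    cases g v'
    · exact ih₂ _ _
    · exact ih₁ _ _
  | goto l => rfl
  | halt => rfl

variable [Fintype K] [Fintype K']

theorem Runs.liftLeft {P : Program Γ σ} {s s' : Mem Γ σ} {t : ℕ} (h : P.Runs s t ⊤ s')
    (r : Mem Γ' σ') :
    (P.liftLeft Γ' σ').Runs ((s.1, r.1), join s.2 r.2) t ⊤ ((s'.1, r.1), join s'.2 r.2) := by
  obtain ⟨n, hn, h⟩ := h
  refine ⟨n, hn, h.map (M' := (P.liftLeft Γ' σ').code)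
    (fun c => ⟨c.l, (c.var, r.1), join c.stk r.2⟩) ?_ fun _ _ => le_top⟩
  rintro ⟨_ | l, v, S⟩ d hd
  · cases hd
  · obtain rfl : stepAux (P.code l) v S = d := Option.some.inj hd
    exact congrArg some (stepAux_liftLeftStmt ..)

/-- The right part will hold the given decision machine, which in the case of PSPACE has a space
bound but no useful time bound. Therefore `m` is carried along here, whereas `Runs.liftLeft` can do
without it. -/
theorem Runs.liftRight {P : Program Γ' σ'} {s s' : Mem Γ' σ'} {t : ℕ} {m : ℕ∞}
    (h : P.Runs s t m s') (r : Mem Γ σ) :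
    (liftRight Γ σ P).Runs ((r.1, s.1), join r.2 s.2) t (height r.2 + m)
      ((r.1, s'.1), join r.2 s'.2) := by
  obtain ⟨n, hn, h⟩ := h
  refine ⟨n, hn, h.map (M' := (Program.liftRight Γ σ P).code)
    (fun c => ⟨c.l, (r.1, c.var), join r.2 c.stk⟩) ?_ fun c hc => ?_⟩
  · rintro ⟨_ | l, v, S⟩ d hd
    · cases hd
    · obtain rfl : stepAux (P.code l) v S = d := Option.some.inj hd
      exact congrArg some (stepAux_liftRightStmt ..)
  · simp only [height_join, Nat.cast_add]
    gcongr

end Lift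

end Program

end StackProgram

namespace StackProgram

open Turing TM2 Function

/-! ### Programs with a register for the last popped symbol -/

section Register

variable {K : Type} (Γ : K → Type) (τ : Type)

/-- The internal state: the last popped symbol and the variables of the program. -/
abbrev RegState : Type := Option (Σ k, Γ k) × τ

/-- A program whose internal state has a register for the last popped symbol. -/
abbrev RegProgram : Type 1 := Program Γ (RegState Γ τ)

variable {Γ τ} [DecidableEq K]

/-- The last popped symbol, if it was popped from the stack `k`. -/
def popped (k : K) (v : RegState Γ τ) : Option (Γ k) :=
  v.1.bind fun a => if h : a.1 = k then some (h ▸ a.2) else none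

/-- Store a popped symbol. -/
def setPopped (k : K) (v : RegState Γ τ) (a : Option (Γ k)) : RegState Γ τ :=
  (a.map (Sigma.mk k), v.2)

@[simp]
theorem popped_setPopped (k : K) (v : RegState Γ τ) (a : Option (Γ k)) :
    popped k (setPopped k v a) = a := by
  cases a <;> simp [popped, setPopped]

namespace RegProgram

/-- Push a symbol. -/
def push (k : K) (a : Γ k) : RegProgram Γ τ := .ofStmt (.push k (fun _ => a) .halt)

/-- Change the variables. -/
def assign (f : τ → τ) : RegProgram Γ τ := .ofStmt (.load (fun v => (v.1, f v.2)) .halt)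

/-- Do nothing. -/
def skip : RegProgram Γ τ := .ofStmt .halt

/-- Push the symbols of a list. -/
def pushList (k : K) : List (Γ k) → RegProgram Γ τ
  | [] => skip
  | a :: l => .seq (push k a) (pushList k l)

/-- Choose the program to be run by the values of the variables. -/
def switch [Fintype τ] (P : τ → RegProgram Γ τ) : RegProgram Γ τ where
  Label := Unit ⊕ Σ v, (P v).Label
  entry := .inl ()
  code
    | .inl _ => .goto fun v => .inr ⟨v.2, (P v.2).entry⟩
    | .inr ⟨v, l⟩ => relabel (fun l => .inr ⟨v, l⟩) none ((P v).code l)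

/-- Choose the program to be run by the last popped symbol. -/
def casePopped (k : K) [Fintype (Γ k)] (P : Option (Γ k) → RegProgram Γ τ) : RegProgram Γ τ where
  Label := Unit ⊕ Σ a, (P a).Label
  entry := .inl ()
  code
    | .inl _ => .goto fun v => .inr ⟨popped k v, (P (popped k v)).entry⟩
    | .inr ⟨a, l⟩ => relabel (fun l => .inr ⟨a, l⟩) none ((P a).code l)

/-- Forget the last popped symbol. -/
def forget : RegProgram Γ τ := .ofStmt (.load (fun v => (none, v.2)) .halt)

/-- Pop a symbol and run the program chosen by it. -/
def pop (k : K) [Fintype (Γ k)] (P : Option (Γ k) → RegProgram Γ τ) : RegProgram Γ τ :=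
  .seq (.ofStmt (.pop k (setPopped k) .halt)) (casePopped k fun a => forget.seq (P a))

/-- Pop all the symbols of a stack and run the program `P a` for each symbol `a`. -/
def forAll (k : K) [Fintype (Γ k)] (P : Γ k → RegProgram Γ τ) : RegProgram Γ τ :=
  .forEach k (setPopped k) (fun v => (popped k v).isSome)
    (casePopped k fun a => forget.seq (a.elim skip P))

variable [Fintype K]

/-- `P.Does s t s'`: started in `s`, the program `P` ends in `s'` in time `t`, where the register is
empty at the beginning and at the end. -/
def Does (P : RegProgram Γ τ) (s : Mem Γ τ) (t : ℕ) (s' : Mem Γ τ) : Prop :=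
  P.Runs ((none, s.1), s.2) t ⊤ ((none, s'.1), s'.2)

variable {P Q : RegProgram Γ τ} {s s' s'' : Mem Γ τ} {t t' : ℕ}

namespace Does

theorem mono (h : P.Does s t s') (ht : t ≤ t') : P.Does s t' s' := Program.Runs.mono_time h ht

theorem congr (h : P.Does s t s') (hs : s' = s'') (ht : t ≤ t') : P.Does s t' s'' :=
  hs ▸ h.mono ht

theorem seq (h : P.Does s t s') (h' : Q.Does s' t' s'') : Does (Program.seq P Q) s (t + t') s'' :=
  Program.Runs.seq h h'

theorem push (k : K) (a : Γ k) (s : Mem Γ τ) :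
    (push k a).Does s 1 (s.1, update s.2 k (a :: s.2 k)) := .ofStmt rfl

theorem assign (f : τ → τ) (s : Mem Γ τ) : (assign f : RegProgram Γ τ).Does s 1 (f s.1, s.2) :=
  .ofStmt rfl

theorem skip (s : Mem Γ τ) : (skip : RegProgram Γ τ).Does s 1 s := .ofStmt rfl

theorem pushList (k : K) (l : List (Γ k)) (s : Mem Γ τ) :
    (pushList k l).Does s (l.length + 1) (s.1, update s.2 k (l.reverse ++ s.2 k)) := by
  induction l generalizing s with
  | nil => simpa [RegProgram.pushList] using skip s
  | cons a l ih =>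
    have := ((push k a s).seq (ih _)).mono (t' := (a :: l).length + 1) (by simp; omega)
    simpa [RegProgram.pushList] using this

theorem switch [Fintype τ] {P : τ → RegProgram Γ τ} (h : (P s.1).Does s t s') :
    (switch P).Does s (t + 1) s' := by
  obtain ⟨n, hn, h⟩ := h
  exact ⟨n + 1, by omega, .head le_top rfl
    (h.relabelled (M' := (RegProgram.switch P).code) (fun l => .inr ⟨s.1, l⟩) none fun _ => rfl)⟩

/-- The popped symbol is turned into a choice of code and then erased, so that the register is empty
again when `P a` starts, as `Does` demands. The two extra steps are the jump and the erasure. -/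
theorem casePopped {k : K} [Fintype (Γ k)] {P : Option (Γ k) → RegProgram Γ τ}
    {a : Option (Γ k)} {v : RegState Γ τ} {S : ∀ k, List (Γ k)}
    (ha : popped k v = a) (h : (P a).Does (v.2, S) t s') :
    (casePopped k fun a => forget.seq (P a)).Runs (v, S) (t + 2) ⊤ ((none, s'.1), s'.2) := by
  subst ha
  have hf : (forget : RegProgram Γ τ).Runs (v, S) 1 ⊤ ((none, v.2), S) := .ofStmt rfl
  obtain ⟨n, hn, h⟩ := hf.seq h
  exact ⟨n + 1, by omega, .head le_top rfl
    (h.relabelled (M' := (RegProgram.casePopped k fun a => forget.seq (P a)).code)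
      (fun l => .inr ⟨popped k v, l⟩) none fun _ => rfl)⟩

theorem pop {k : K} [Fintype (Γ k)] {P : Option (Γ k) → RegProgram Γ τ}
    (l : List (Γ k)) (hl : s.2 k = l) (h : (P l.head?).Does (s.1, update s.2 k l.tail) t s') :
    (pop k P).Does s (t + 3) s' := by
  subst hl
  refine (Program.Runs.seq (.ofStmt rfl) (casePopped ?_ h)).mono_time (by omega)
  exact popped_setPopped ..

/-- The effect of `forAll` is a left fold. `E x l` is the memory when `x` has been computed so far
and `l` is what remains on the stack. -/
theorem forAll {k : K} [Fintype (Γ k)] {P : Γ k → RegProgram Γ τ} {β : Type*}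
    (E : β → List (Γ k) → Mem Γ τ) (f : β → Γ k → β) (J : β → List (Γ k) → Prop) {T : ℕ}
    (hk : ∀ x l, (E x l).2 k = l) (hu : ∀ x a l, update (E x (a :: l)).2 k l = (E x l).2)
    (hv : ∀ x a l, (E x (a :: l)).1 = (E x l).1)
    (hJ : ∀ x a l, J x (a :: l) → J (f x a) l)
    (hP : ∀ x a l, J x (a :: l) → (P a).Does (E x l) T (E (f x a) l))
    (x : β) (l : List (Γ k)) (hx : J x l) :
    (forAll k P).Does (E x l) (l.length * (T + 3) + 1) (E (l.foldl f x) []) := by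
  have := Program.Runs.forEach (k := k) (set := setPopped k)
    (b := fun v : RegState Γ τ => (popped k v).isSome)
    (P := RegProgram.casePopped k fun a => RegProgram.forget.seq (a.elim RegProgram.skip P))
    (T := T + 2) (fun x l => ((none, (E x l).1), (E x l).2)) f J hk hu
    (fun x a l => by rw [hv]) (fun v a => by simp) hJ
    (fun x a l h => casePopped (popped_setPopped ..) (hP x a l h)) x l hx
  exact this

/-- Clear a stack. -/
theorem clear (k : K) [Fintype (Γ k)] (s : Mem Γ τ) :
    (RegProgram.forAll k fun _ => RegProgram.skip).Does s ((s.2 k).length * 4 + 1)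
      (s.1, update s.2 k []) := by
  have := forAll (P := fun _ => RegProgram.skip) (T := 1)
    (fun (_ : Unit) l => (s.1, update s.2 k l)) (fun x _ => x) (fun _ _ => True)
    (by simp) (by simp) (by simp) (by simp) (fun x a l _ => skip _) () (s.2 k) trivial
  simpa using this

/-- Move the contents of a stack to another one. -/
theorem move {k k' : K} (hk : k ≠ k') [Fintype (Γ k)] (g : Γ k → Γ k') (s : Mem Γ τ) :
    (RegProgram.forAll k fun a => RegProgram.push k' (g a)).Does s ((s.2 k).length * 4 + 1)
      (s.1, update (update s.2 k []) k' ((s.2 k).reverse.map g ++ s.2 k')) := by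
  have := forAll (P := fun a => RegProgram.push k' (g a)) (T := 1)
    (fun x l => (s.1, update (update s.2 k l) k' x)) (fun x a => g a :: x) (fun _ _ => True)
    (by simp [hk]) (by simp [update_comm hk]) (by simp) (by simp)
    (fun x a l _ => by simpa using push (τ := τ) k' (g a) (s.1, update (update s.2 k l) k' x))
    (s.2 k') (s.2 k) trivial
  have hf : ∀ (l : List (Γ k)) x, l.foldl (fun x a => g a :: x) x = l.reverse.map g ++ x := by
    intro l
    induction l with
    | nil => simp
    | cons a l ih => simp [ih]
  simpa [hf, update_comm hk] using this

end Does

end RegProgram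

end Register

end StackProgram

namespace ParametricGrammar

/-! ### Scanning an annotated grammar -/

/-- The position of a scan within the text of a grammar. -/
inductive Mode
  | start
  | top
  | lhs
  | rhs
  | sym (nt : Bool)
  | gstart
  | guard
  | fail
  deriving DecidableEq, Fintype

/-- What a scan does at a token. -/
inductive Action
  | goto (m : Mode)
  | collect (b : Bool)
  | checkStart
  | beginRule (b : Bool)
  | saveLhs
  | commit
  | checkSym
  | dropSym
  | openGuard
  | emit (t : Tok)
  | nest
  | unnest
  | emitLoc

/-- The action at a token `t`, where `b` tells whether the token is selected. -/
def action (b : Bool) : Mode → Tok → Action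
  | .start, .bit b => .collect b
  | .start, .fin => .checkStart
  | .top, .rule => .beginRule b
  | .lhs, .bit b => .collect b
  | .lhs, .fin => .saveLhs
  | .rhs, .param => .goto (.sym false)
  | .rhs, .loc => .goto (.sym false)
  | .rhs, .nonterm => .goto (.sym true)
  | .rhs, .guard => .commit
  | .sym _, .bit b => .collect b
  | .sym true, .fin => .checkSym
  | .sym false, .fin => .dropSym
  | .gstart, .lpar => .openGuard
  | .guard, .lpar => .nest
  | .guard, .rpar => .unnest
  | .guard, .loc => .emitLoc
  | .guard, t => .emit t
  | _, _ => .goto .fail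

/-- The state of a scan. The words `cur` and `out`, and the elements of `prod`, are reversed. -/
structure Scan where
  mode : Mode := .start
  /-- The present rule is selected, and the nonterminals met so far on its right-hand side are
  productive. -/
  ok : Bool := false
  /-- The present rule is selected. -/
  sel : Bool := false
  /-- The start symbol is productive. -/
  good : Bool := false
  /-- The present identifier. -/
  cur : List Bool := []
  /-- The left-hand side of the present rule. -/
  lhs : List Bool := []
  /-- The nonterminals that are known to be productive. -/
  prod : List (List Bool) := []
  /-- The number of parentheses of the present guard that are open, except the outermost one. -/
  depth : ℕ := 0
  /-- The number of rules that have been read. -/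
  idx : ℕ := 0
  /-- The formula that is being written. -/
  out : List Tok := []

/-- The text that precedes a guard in the formula. -/
def guardPrefix : Bool → List Tok
  | true => [.lpar, .imp]
  | false => [.lpar, .imp, .lpar, .imp, .lpar, .bot, .rpar]

/-- The text that follows a guard in the formula. -/
def guardSuffix : Bool → List Tok
  | true => []
  | false => [.rpar]

/-- The effect of an action. -/
def Scan.apply (s : Scan) : Action → Scan
  | .goto m => { s with mode := m }
  | .collect b => { s with cur := b :: s.cur }
  | .checkStart => { s with mode := .top, good := decide (s.cur ∈ s.prod), cur := [] }
  | .beginRule b =>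
      { s with mode := .lhs, ok := b, sel := b, out := (guardPrefix b).reverse ++ s.out }
  | .saveLhs => { s with mode := .rhs, lhs := s.cur.reverse ++ s.lhs, cur := [] }
  | .commit =>
      { s with mode := .gstart, prod :=
          if s.ok then s.lhs.reverse :: s.prod else s.prod, lhs := [] }
  | .checkSym => { s with mode := .rhs, ok := s.ok && decide (s.cur ∈ s.prod), cur := [] }
  | .dropSym => { s with mode := .rhs, cur := [] }
  | .openGuard => { s with mode := .guard, out := .lpar :: s.out }
  | .emit t => { s with out := t :: s.out }
  | .nest => { s with out := .lpar :: s.out, depth := s.depth + 1 }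
  | .unnest =>
      if s.depth = 0 then
        { s with
          mode := .top
          idx := s.idx + 1
          out := (guardSuffix s.sel).reverse ++ .rpar :: s.out }
      else { s with out := .rpar :: s.out, depth := s.depth - 1 }
  | .emitLoc =>
      { s with out := .bit false :: (List.replicate s.idx (.bit true) ++ .loc :: s.out) }

/-- Read one annotated token. -/
def Scan.next (s : Scan) (t : Tok × Bool) : Scan := s.apply (action t.2 s.mode t.1)

/-- The beginning of a scan in which the nonterminals `prod` are known to be productive. -/
def Scan.init (prod : List (List Bool)) : Scan := { prod := prod, out := [.imp, .lpar] }

/-- One scan. -/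
def Scan.pass (a : List (Tok × Bool)) (s : Scan) : Scan := a.foldl Scan.next (Scan.init s.prod)

/-- The text that follows the guards in the formula. -/
def closing (n : ℕ) : List Tok :=
  [.lpar, .bot, .rpar] ++ List.replicate n .rpar ++ [.lpar, .bot, .rpar, .rpar]

/-- The result of repeated scans. -/
def finalScan (a : List (Tok × Bool)) : Scan := (Scan.pass a)^[a.length] {}

/-- The formula that expresses that the guards of the selected rules are jointly satisfiable, if the
start symbol is productive by means of these rules. -/
def reduction (a : List (Tok × Bool)) : List Tok :=
  let s := finalScan a
  if s.mode = .top ∧ s.good = true then s.out.reverse ++ closing s.idx else []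

/-- The total length of the words in a scan, except the output. -/
def Scan.weight (s : Scan) : ℕ :=
  s.cur.length + s.lhs.length + (s.prod.map fun e => e.length + 1).sum + s.depth + s.idx

/-- A token adds at most one symbol or unit; the other actions move words around or drop them. A
word entering `prod` costs its length plus one, and its length was already counted in `lhs`. -/
theorem Scan.weight_next (s : Scan) (t : Tok × Bool) : (s.next t).weight ≤ s.weight + 1 := by
  unfold Scan.next
  cases action t.2 s.mode t.1 <;> simp only [Scan.apply, Scan.weight, List.length_cons,
    List.length_nil, List.length_append, List.length_reverse]
  case commit => split <;> simp <;> omega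
  case unnest => split <;> simp <;> omega
  all_goals omega

/-- The only unbounded contribution is the prefix of a local variable, of length `idx + 1`, and
`idx` is part of the weight. The constant 7 is the length of `guardPrefix false`. -/
theorem Scan.length_out_next (s : Scan) (t : Tok × Bool) :
    (s.next t).out.length ≤ s.out.length + s.weight + 7 := by
  unfold Scan.next
  have hp : ∀ b, (guardPrefix b).length ≤ 7 := by decide
  have hs : ∀ b, (guardSuffix b).length ≤ 1 := by decide
  cases action t.2 s.mode t.1 <;> simp only [Scan.apply, Scan.weight, List.length_cons,
    List.length_append, List.length_reverse, List.length_replicate]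
  case unnest =>
    have := hs s.sel
    split <;> simp <;> omega
  case beginRule b =>
    have := hp b
    omega
  all_goals omega

theorem Scan.foldl_next_bound (a : List (Tok × Bool)) (s : Scan) :
    (a.foldl Scan.next s).weight ≤ s.weight + a.length ∧
      (a.foldl Scan.next s).out.length ≤
        s.out.length + a.length * (s.weight + a.length + 7) := by
  induction a generalizing s with
  | nil => simp
  | cons t a ih =>
    obtain ⟨h₁, h₂⟩ := ih (s.next t)
    have h₃ := s.weight_next t
    have h₄ := s.length_out_next t
    refine ⟨by simp only [List.foldl_cons, List.length_cons]; omega, ?_⟩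
    simp only [List.foldl_cons, List.length_cons]
    calc _ ≤ _ := h₂
      _ ≤ s.out.length + s.weight + 7 + a.length * (s.weight + 1 + a.length + 7) := by gcongr
      _ ≤ _ := by ring_nf; nlinarith

theorem Scan.weight_init (s : Scan) : (Scan.init s.prod).weight ≤ s.weight := by
  simp only [Scan.init, Scan.weight, List.length_nil]; omega

theorem Scan.weight_pass (a : List (Tok × Bool)) (s : Scan) :
    (s.pass a).weight ≤ s.weight + a.length :=
  (Scan.foldl_next_bound a _).1.trans (Nat.add_le_add_right s.weight_init _)

/-- A new pass retains only `prod`, so the weights add up over the passes instead of multiplying. -/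
theorem Scan.weight_iterate_pass (a : List (Tok × Bool)) (n : ℕ) :
    ((Scan.pass a)^[n] {}).weight ≤ n * a.length := by
  induction n with
  | zero => simp [Scan.weight]
  | succ n ih =>
    rw [Function.iterate_succ_apply', Nat.succ_mul]
    exact (Scan.weight_pass a _).trans (Nat.add_le_add_right ih _)

theorem Scan.length_out_pass (a : List (Tok × Bool)) (s : Scan) :
    (s.pass a).out.length ≤ 2 + a.length * (s.weight + a.length + 7) := by
  refine (Scan.foldl_next_bound a _).2.trans ?_
  have := s.weight_init
  exact Nat.add_le_add (by simp [Scan.init]) (Nat.mul_le_mul_left _ (by omega))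

end ParametricGrammar

namespace ParametricGrammar

/-! ### The machine that computes the reduction -/

/-- The stacks of the machine. -/
inductive Stk
  | inp | word | res | ann | ann' | cert | cert' | out | set | set' | cur | cur' | lhs | depth
  | idx | idx' | cnt
  deriving DecidableEq

instance : Fintype Stk where
  elems := {.inp, .word, .res, .ann, .ann', .cert, .cert', .out, .set, .set', .cur, .cur',
    .lhs, .depth,
    .idx, .idx', .cnt}
  complete k := by cases k <;> decide

/-- The alphabets of the stacks. -/
abbrev StkAlphabet : Stk → Type
  | .inp => Tok ⊕ Bool
  | .word | .out => Tok
  | .res | .cert | .cert' | .cur | .cur' | .lhs => Bool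
  | .ann | .ann' => Tok × Bool
  | .set | .set' => Option Bool
  | .depth | .idx | .idx' | .cnt => Unit

instance (k : Stk) : Fintype (StkAlphabet k) := by
  cases k <;> infer_instance

/-- The variables of the machine. -/
structure Vars where
  mode : Mode := .start
  ok : Bool := false
  sel : Bool := false
  good : Bool := false
  /-- Two words agree so far. -/
  eq : Bool := false
  /-- A word has been found in a list. -/
  found : Bool := false
  /-- The search goes on. -/
  go : Bool := false
  /-- The answer. -/
  ans : Bool := false

noncomputable instance : Fintype Vars :=
  Fintype.ofInjective
    (fun v => (v.mode, v.ok, v.sel, v.good, v.eq, v.found, v.go, v.ans)) <| by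
    rintro ⟨⟩ ⟨⟩ h
    simpa using h

open Turing TM2 Function StackProgram RegProgram

/-- Programs of the machine. -/
abbrev Prog : Type 1 := RegProgram StkAlphabet Vars

/-- The stacks of the machine. -/
abbrev Stacks : Type := ∀ k, List (StkAlphabet k)

/-! #### Membership in a list of words -/

/-- A list of words as one word. -/
def flat (l : List (List Bool)) : List (Option Bool) := l.flatMap fun e => e.map some ++ [none]

theorem length_flat (l : List (List Bool)) :
    (flat l).length = (l.map fun e => e.length + 1).sum := by
  simp [flat, List.length_flatMap]

/-- Move `cur'` back to `cur`. -/
noncomputable def restoreCur : Prog := forAll .cur' fun b => push .cur b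

/-- Compare one symbol of `set` with `cur`. -/
noncomputable def compareSymbol (c : Option Bool) : Prog :=
  (push .set' c).seq <| pop .cur fun d => match c, d with
    | some b, some b' =>
        (push .cur' b').seq (assign fun v => { v with eq := v.eq && b == b' })
    | some _, none => assign fun v => { v with eq := false }
    | none, some b' =>
        (push .cur' b').seq ((assign fun v => { v with eq := true }).seq restoreCur)
    | none, none =>
        (assign fun v => { v with found := v.found || v.eq, eq := true }).seq restoreCur

/-- The data of a comparison. -/
structure Comparison where
  eq : Bool
  found : Bool
  cur : List Bool
  cur' : List Bool
  set' : List (Option Bool)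

/-- The effect of `compareSymbol`. -/
def Comparison.next (x : Comparison) (c : Option Bool) : Comparison :=
  match c, x.cur with
  | some b, b' :: l => ⟨x.eq && b == b', x.found, l, b' :: x.cur', some b :: x.set'⟩
  | some b, [] => ⟨false, x.found, [], x.cur', some b :: x.set'⟩
  | none, l => ⟨true, x.found || (x.eq && l.isEmpty), x.cur'.reverse ++ l, [], none :: x.set'⟩

/-- The memory during a comparison. -/
def Comparison.mem (v : Vars) (S : Stacks) (x : Comparison) (l : List (Option Bool)) :
    Mem StkAlphabet Vars :=
  ({ v with eq := x.eq, found := x.found }, fun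
    | .set => l
    | .set' => x.set'
    | .cur => x.cur
    | .cur' => x.cur'
    | k => S k)

theorem does_restoreCur (s : Mem StkAlphabet Vars) :
    restoreCur.Does s ((s.2 .cur').length * 4 + 1)
      (s.1, update (update s.2 .cur' []) .cur ((s.2 .cur').reverse ++ s.2 .cur)) := by
  refine (Does.move (k := Stk.cur') (k' := Stk.cur) (by decide) id s).congr ?_ le_rfl
  rw [List.map_id]

theorem does_compareSymbol (v : Vars) (S : Stacks) (x : Comparison) (c : Option Bool)
    (l : List (Option Bool)) {N : ℕ} (hN : x.cur.length + x.cur'.length ≤ N) :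
    (compareSymbol c).Does (x.mem v S l) (4 * N + 10) ((x.next c).mem v S l) := by
  obtain ⟨eq, found, cur, cur', set'⟩ := x
  simp only at hN
  -- The linear part pays for moving `cur'` back to `cur`, at four steps per symbol.
  refine ((Does.push _ _ _).seq (Does.pop (t := 4 * N + 6) cur rfl ?_)).mono (by omega)
  rcases c with _ | b <;> rcases cur with _ | ⟨b', cur⟩
  · refine ((Does.assign _ _).seq (does_restoreCur _)).congr ?_ ?_
    · refine Prod.ext (by simp [Comparison.next, Comparison.mem]) (funext fun k => ?_)
      cases k <;> rfl
    · change 1 + (cur'.length * 4 + 1) ≤ _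
      simp at hN; omega
  · refine ((Does.push _ _ _).seq ((Does.assign _ _).seq (does_restoreCur _))).congr ?_ ?_
    · refine Prod.ext (by simp [Comparison.next, Comparison.mem]) (funext fun k => ?_)
      cases k <;> try rfl
      simp [Comparison.next, Comparison.mem]
    · change 1 + (1 + ((b' :: cur').length * 4 + 1)) ≤ _
      simp at hN ⊢; omega
  · refine (Does.assign _ _).congr (Prod.ext rfl (funext fun k => ?_)) (by omega)
    cases k <;> rfl
  · refine ((Does.push _ _ _).seq (Does.assign _ _)).congr
      (Prod.ext rfl (funext fun k => ?_)) (by omega)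
    cases k <;> rfl

/-- Bits only travel between `cur` and `cur'`. This conserved quantity bounds the cost of every
restoration. -/
theorem Comparison.length_next (x : Comparison) (c : Option Bool) :
    (x.next c).cur.length + (x.next c).cur'.length = x.cur.length + x.cur'.length := by
  obtain ⟨eq, found, cur, cur', set'⟩ := x
  rcases c with _ | b <;> rcases cur with _ | ⟨b', cur⟩ <;> simp [Comparison.next] <;> omega

/-- The flag `eq` is lost at the first mismatch, or when `cur` is exhausted too early; the
terminator `none` moreover requires that nothing of `cur` is left over. -/
theorem Comparison.foldl_next_word (e : List Bool) (x : Comparison) :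
    (e.map some ++ [none]).foldl next x =
      ⟨true, x.found || (x.eq && decide (x.cur = e)), x.cur'.reverse ++ x.cur, [],
        (e.map some ++ [none]).reverse ++ x.set'⟩ := by
  induction e generalizing x with
  | nil =>
    obtain ⟨eq, found, cur, cur', set'⟩ := x
    cases cur <;> simp [Comparison.next]
  | cons b e ih =>
    simp only [List.map_cons, List.cons_append, List.foldl_cons, ih]
    obtain ⟨eq, found, cur, cur', set'⟩ := x
    rcases cur with _ | ⟨b', cur⟩
    · simp [Comparison.next]
    · by_cases h : b = b'
      · subst h; simp [Comparison.next]
      · simp [Comparison.next, h, Ne.symm h]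

theorem Comparison.foldl_next_flat (p : List (List Bool)) (x : Comparison) (hx : x.eq = true)
    (hx' : x.cur' = []) :
    (flat p).foldl next x =
      ⟨true, x.found || decide (x.cur ∈ p), x.cur, [], (flat p).reverse ++ x.set'⟩ := by
  induction p generalizing x with
  | nil =>
    obtain ⟨eq, found, cur, cur', set'⟩ := x
    simp_all [flat]
  | cons e p ih =>
    have : flat (e :: p) = (e.map some ++ [none]) ++ flat p := rfl
    rw [this, List.foldl_append, foldl_next_word, ih _ rfl rfl]
    simp [hx, hx', Bool.or_assoc]

/-- Test whether the word `cur` is in the list `set`. -/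
noncomputable def testMember : Prog :=
  (assign fun v => { v with eq := true, found := false }).seq <|
    (forAll .set compareSymbol).seq <|
      (forAll .set' fun c => push .set c).seq <| forAll .cur fun _ => skip

theorem does_testMember (v : Vars) (S : Stacks) (p : List (List Bool)) {w : ℕ}
    (hp : S .set = flat p) (hs : S .set' = []) (hc : S .cur' = [])
    (hw : (S .cur).length + (flat p).length ≤ w) :
    testMember.Does (v, S) (4 * (w + 3) ^ 2)
      ({ v with eq := true, found := decide (S .cur ∈ p) }, update S .cur []) := by
  have h := Does.forAll (Γ := StkAlphabet) (k := Stk.set) (P := compareSymbol)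
    (Comparison.mem v S) Comparison.next
    (fun x _ => x.cur.length + x.cur'.length = (S .cur).length) (fun _ _ => rfl)
    (fun x a l => funext fun k => by cases k <;> rfl) (fun _ _ _ => rfl)
    (fun x a l h => (x.length_next a).trans h)
    (fun x a l h => does_compareSymbol v S x a l h.le) ⟨true, false, S .cur, [], []⟩ (flat p)
    (by simp)
  rw [Comparison.foldl_next_flat p _ rfl rfl] at h
  have h₀ : ({ v with eq := true, found := false }, S) =
      Comparison.mem v S ⟨true, false, S .cur, [], []⟩ (flat p) :=
    Prod.ext rfl (funext fun k => by cases k <;> first | rfl | assumption)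
  have h₁ := Does.assign (fun v => { v with eq := true, found := false }) (v, S)
  rw [h₀] at h₁
  refine (h₁.seq (h.seq ((Does.move (k := Stk.set') (k' := Stk.set) (by decide) id _).seq
    (Does.clear Stk.cur _)))).congr ?_ ?_
  · refine Prod.ext (by simp [Comparison.mem]) (funext fun k => ?_)
    cases k <;> try rfl
    · simp [Comparison.mem, hp]
    · simp [Comparison.mem, hs]
    · simp [Comparison.mem, hc]
  · change 1 + ((flat p).length * (4 * (S .cur).length + 10 + 3) + 1 +
      (((flat p).reverse ++ []).length * 4 + 1 + ((S .cur).length * 4 + 1))) ≤ _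
    -- The product of the two lengths, from one possible restoration of `cur` per symbol of `set`,
    -- is the dominant term.
    simp only [List.append_nil, List.length_reverse]
    nlinarith [Nat.zero_le (S .cur).length, Nat.zero_le (flat p).length,
      Nat.mul_le_mul hw hw]

end ParametricGrammar

namespace ParametricGrammar

open Turing TM2 Function StackProgram RegProgram

/-! #### Scanning -/

/-- The memory during a scan. -/
def Scan.mem (v : Vars) (S : Stacks) (s : Scan) : Mem StkAlphabet Vars :=
  ({ v with mode := s.mode, ok := s.ok, sel := s.sel, good := s.good, eq := false, found := false },
    fun
    | .out => s.out
    | .set => flat s.prod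
    | .set' => []
    | .cur => s.cur
    | .cur' => []
    | .lhs => s.lhs
    | .depth => List.replicate s.depth ()
    | .idx => List.replicate s.idx ()
    | .idx' => []
    | k => S k)

/-- Change the mode of the scan. -/
noncomputable def setMode (m : Mode) : Prog := assign fun v => { v with mode := m }

/-- The program for an action. -/
noncomputable def Action.prog (ok sel : Bool) : Action → Prog
  | .goto m => setMode m
  | .collect b => push .cur b
  | .checkStart => testMember.seq <| assign fun v =>
      { v with mode := .top, good := v.found, eq := false, found := false }
  | .beginRule b => (assign fun v => { v with mode := .lhs, ok := b, sel := b }).seq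
      (pushList .out (guardPrefix b))
  | .saveLhs => (forAll .cur fun b => push .lhs b).seq (setMode .rhs)
  | .commit => match ok with
    | true => ((push .set none).seq (forAll .lhs fun b => push .set (some b))).seq (setMode .gstart)
    | false => (forAll .lhs fun _ => skip).seq (setMode .gstart)
  | .checkSym => testMember.seq <| assign fun v =>
      { v with mode := .rhs, ok := v.ok && v.found, eq := false, found := false }
  | .dropSym => (forAll .cur fun _ => skip).seq (setMode .rhs)
  | .openGuard => (push .out .lpar).seq (setMode .guard)
  | .emit t => push .out t
  | .nest => (push .out .lpar).seq (push .depth ())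
  | .unnest => (push .out .rpar).seq <| pop .depth fun
    | some _ => skip
    | none => (push .idx ()).seq ((pushList .out (guardSuffix sel)).seq (setMode .top))
  | .emitLoc => (push .out .loc).seq <|
      (forAll .idx fun _ => (push .idx' ()).seq (push .out (.bit true))).seq <|
        (forAll .idx' fun a => push .idx a).seq (push .out (.bit false))

/-- Reading a unary counter destroys it, so a copy is kept on `idx'` while the prefix of the local
variable is written. -/
theorem does_copyIdx (v : Vars) (S : Stacks) :
    (forAll .idx fun _ => (push .idx' ()).seq (push .out (.bit true)) : Prog).Does (v, S)
      ((S .idx).length * 5 + 1)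
      (v, update (update (update S .idx []) .idx' ((S .idx) ++ S .idx')) .out
        (List.replicate (S .idx).length (.bit true) ++ S .out)) := by
  have h := Does.forAll (Γ := StkAlphabet) (τ := Vars) (k := Stk.idx) (T := 2)
    (P := fun _ => (push .idx' ()).seq (push .out (.bit true)))
    (fun (x : List Unit × List Tok) l => (v, update (update (update S .idx l) .idx' x.1) .out x.2))
    (fun x _ => (() :: x.1, Tok.bit true :: x.2)) (fun _ _ => True) (fun _ _ => rfl)
    (fun x a l => funext fun k => by cases k <;> rfl) (fun _ _ _ => rfl) (fun _ _ _ _ => trivial)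
    (fun x a l _ => by
      refine ((Does.push _ _ _).seq (Does.push _ _ _)).congr
        (Prod.ext rfl (funext fun k => ?_)) le_rfl
      cases k <;> rfl)
    (S .idx', S .out) (S .idx) trivial
  have hf : ∀ (l : List Unit) (x : List Unit × List Tok),
      l.foldl (fun x _ => (() :: x.1, Tok.bit true :: x.2)) x =
        (l ++ x.1, List.replicate l.length (.bit true) ++ x.2) := by
    intro l
    induction l with
    | nil => simp
    | cons a l ih =>
      intro x
      have h : ∀ m : List Unit, l ++ () :: m = () :: (l ++ m) := fun m =>
        List.ext_getElem (by simp; omega) fun _ _ _ => rfl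
      rw [List.foldl_cons, ih, h, List.length_cons, List.replicate_succ', List.append_assoc]
      rfl
  rw [hf] at h
  simpa using h

theorem does_action (v : Vars) (S : Stacks) (s : Scan) (A : Action) :
    (A.prog s.ok s.sel).Does (s.mem v S) (4 * (s.weight + 4) ^ 2) ((s.apply A).mem v S) := by
  have hflat := length_flat s.prod
  have hp : ∀ b, (guardPrefix b).length ≤ 7 := by decide
  have hs : ∀ b, (guardSuffix b).length ≤ 1 := by decide
  -- The quadratic bound is made opaque, so that only linear facts remain: `hT₁` serves the two
  -- membership tests, `hT₂` all other actions.
  obtain ⟨T, hT⟩ : ∃ T, T = 4 * (s.weight + 4) ^ 2 := ⟨_, rfl⟩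
  have hT₁ : 4 * (s.weight + 3) ^ 2 + 1 ≤ T := by rw [hT]; ring_nf; omega
  have hT₂ : 32 * s.weight + 64 ≤ T := by nlinarith
  rw [← hT]
  cases A with
  | goto m => exact (Does.assign _ _).congr rfl (by omega)
  | collect b =>
    exact (Does.push _ _ _).congr (Prod.ext rfl (funext fun k => by cases k <;> rfl)) (by omega)
  | checkStart =>
    refine ((does_testMember _ (s.mem v S).2 s.prod (w := s.weight) rfl rfl rfl ?_).seq
      (Does.assign _ _)).congr (Prod.ext rfl (funext fun k => by cases k <;> rfl)) hT₁
    change s.cur.length + _ ≤ _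
    unfold Scan.weight
    omega
  | beginRule b =>
    have := hp b
    exact ((Does.assign _ _).seq (Does.pushList _ _ _)).congr
      (Prod.ext rfl (funext fun k => by cases k <;> rfl)) (by omega)
  | saveLhs =>
    refine ((Does.move (Γ := StkAlphabet) (k := Stk.cur) (k' := Stk.lhs) (by decide) id _).seq
      (Does.assign _ _)).congr
      (Prod.ext rfl (funext fun k => ?_)) ?_
    · cases k <;> try rfl
      simp [Scan.mem, Scan.apply]
    · change s.cur.length * 4 + 1 + 1 ≤ _
      have : s.cur.length ≤ s.weight := by unfold Scan.weight; omega
      omega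
  | commit =>
    have : s.lhs.length ≤ s.weight := by unfold Scan.weight; omega
    cases hok : s.ok with
    | true =>
      refine (((Does.push _ _ _).seq
        (Does.move (Γ := StkAlphabet) (k := Stk.lhs) (k' := Stk.set) (by decide) some _)).seq
          (Does.assign _ _)).congr
        (Prod.ext (by simp [Scan.mem, Scan.apply]) (funext fun k => ?_)) ?_
      · cases k <;> try rfl
        simp [Scan.mem, Scan.apply, hok, flat]
      · change 1 + (s.lhs.length * 4 + 1) + 1 ≤ _
        omega
    | false =>
      refine ((Does.clear Stk.lhs _).seq (Does.assign _ _)).congr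
        (Prod.ext (by simp [Scan.mem, Scan.apply]) (funext fun k => ?_)) ?_
      · cases k <;> try rfl
        simp [Scan.mem, Scan.apply, hok]
      · change s.lhs.length * 4 + 1 + 1 ≤ _
        omega
  | checkSym =>
    refine ((does_testMember _ (s.mem v S).2 s.prod (w := s.weight) rfl rfl rfl ?_).seq
      (Does.assign _ _)).congr (Prod.ext rfl (funext fun k => by cases k <;> rfl)) hT₁
    change s.cur.length + _ ≤ _
    unfold Scan.weight
    omega
  | dropSym =>
    refine ((Does.clear Stk.cur _).seq (Does.assign _ _)).congr
      (Prod.ext rfl (funext fun k => by cases k <;> rfl)) ?_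
    change s.cur.length * 4 + 1 + 1 ≤ _
    have : s.cur.length ≤ s.weight := by unfold Scan.weight; omega
    omega
  | openGuard =>
    exact ((Does.push _ _ _).seq (Does.assign _ _)).congr
      (Prod.ext rfl (funext fun k => by cases k <;> rfl)) (by omega)
  | emit t =>
    exact (Does.push _ _ _).congr (Prod.ext rfl (funext fun k => by cases k <;> rfl)) (by omega)
  | nest =>
    exact ((Does.push _ _ _).seq (Does.push _ _ _)).congr
      (Prod.ext rfl (funext fun k => by cases k <;> rfl)) (by omega)
  | unnest =>
    have := hs s.sel
    refine ((Does.push _ _ _).seq (Does.pop (t := 8) (List.replicate s.depth ()) rfl ?_)).mono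
      (by omega)
    rcases hd : s.depth with _ | d
    · refine ((Does.push _ _ _).seq ((Does.pushList _ _ _).seq (Does.assign _ _))).congr
        (Prod.ext (by simp [Scan.mem, Scan.apply, hd]) (funext fun k => ?_)) (by omega)
      cases k <;> simp [Scan.mem, Scan.apply, hd, List.replicate_succ]
    · refine (Does.skip _).congr
        (Prod.ext (by simp [Scan.mem, Scan.apply, hd]) (funext fun k => ?_)) (by omega)
      cases k <;> simp [Scan.mem, Scan.apply, hd, List.replicate_succ]
  | emitLoc =>
    refine ((Does.push _ _ _).seq ((does_copyIdx _ _).seq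
      ((Does.move (Γ := StkAlphabet) (k := Stk.idx') (k' := Stk.idx) (by decide) id _).seq
        (Does.push _ _ _)))).congr
        (Prod.ext rfl (funext fun k => ?_)) ?_
    · cases k <;> try rfl
      all_goals simp [Scan.mem, Scan.apply]
    · change 1 + ((List.replicate s.idx ()).length * 5 + 1 +
        ((List.replicate s.idx () ++ []).length * 4 + 1 + 1)) ≤ _
      have : s.idx ≤ s.weight := by unfold Scan.weight; omega
      simp only [List.append_nil, List.length_replicate]
      omega

end ParametricGrammar

/-! ### Whole passes, their iteration, and the program for the reduction. -/

namespace ParametricGrammar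

open Turing TM2 Function StackProgram RegProgram

/-- Read one annotated token. -/
noncomputable def scanToken (t : Tok × Bool) : Prog :=
  (push .ann' t).seq (switch fun v => (action t.2 v.mode t.1).prog v.ok v.sel)

theorem does_scanToken (v : Vars) (S : Stacks) (s : Scan) (t : Tok × Bool) {W : ℕ}
    (hW : s.weight ≤ W) :
    (scanToken t).Does (s.mem v S) (4 * (W + 4) ^ 2 + 2)
      ((s.next t).mem v (update S .ann' (t :: S .ann'))) := by
  have h : (s.mem v S).2 .ann' = S .ann' := rfl
  have h₁ := Does.push (τ := Vars) Stk.ann' t (s.mem v S)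
  have h₂ : ((s.mem v S).1, update (s.mem v S).2 .ann' (t :: (s.mem v S).2 .ann')) =
      s.mem v (update S .ann' (t :: S .ann')) :=
    Prod.ext rfl (funext fun k => by cases k <;> rfl)
  rw [h₂] at h₁
  refine (h₁.seq (Does.switch (does_action ..))).mono ?_
  have : (s.weight + 4) ^ 2 ≤ (W + 4) ^ 2 := by gcongr
  omega

/-- Clear the data of a rule. -/
noncomputable def resetScan : Prog :=
  (assign fun v => { v with mode := .start, ok := false, sel := false, good := false }).seq <|
    (forAll .cur fun _ => skip).seq <| (forAll .lhs fun _ => skip).seq <|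
      (forAll .depth fun _ => skip).seq <| forAll .idx fun _ => skip

theorem does_resetScan (v : Vars) (S : Stacks) (s : Scan) {W : ℕ} (hW : s.weight ≤ W) :
    resetScan.Does (s.mem v S) (4 * W + 5)
      (({ prod := s.prod, out := s.out } : Scan).mem v S) := by
  refine ((Does.assign _ _).seq ((Does.clear Stk.cur _).seq ((Does.clear Stk.lhs _).seq
    ((Does.clear Stk.depth _).seq (Does.clear Stk.idx _))))).congr
    (Prod.ext rfl (funext fun k => by cases k <;> rfl)) ?_
  change 1 + (s.cur.length * 4 + 1 + (s.lhs.length * 4 + 1 + ((List.replicate s.depth ()).length *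
    4 + 1 + ((List.replicate s.idx ()).length * 4 + 1)))) ≤ _
  unfold Scan.weight at hW
  simp only [List.length_replicate]
  omega

/-- Move `ann'` back to `ann`. -/
noncomputable def restoreAnn : Prog := forAll .ann' fun t => push .ann t

/-- Begin the output. -/
noncomputable def beginOut : Prog := (forAll .out fun _ => skip).seq (pushList .out [.lpar, .imp])

/-- One scan. -/
noncomputable def scanPass : Prog :=
  resetScan.seq <| beginOut.seq <| (forAll .ann scanToken).seq restoreAnn

theorem does_restoreAnn (v : Vars) (S : Stacks) (s : Scan) :
    restoreAnn.Does (s.mem v S) ((S .ann').length * 4 + 1)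
      (s.mem v (update (update S .ann' []) .ann ((S .ann').reverse ++ S .ann))) := by
  refine (Does.move (Γ := StkAlphabet) (k := Stk.ann') (k' := Stk.ann) (by decide) id _).congr
    (Prod.ext rfl (funext fun k => ?_)) le_rfl
  cases k <;> try rfl
  simp [Scan.mem]

/-- The time that a scan takes, for an input of length `n`, when the weight is at most `W` and the
length of the output is at most `O`. -/
def passTime (n W O : ℕ) : ℕ := n * (4 * (W + n + 4) ^ 2 + 9) + 4 * W + 4 * O + 20

theorem does_scanPass (v : Vars) (S : Stacks) (s : Scan) (a : List (Tok × Bool)) {W O : ℕ}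
    (ha : S .ann = a) (ha' : S .ann' = []) (hW : s.weight ≤ W) (hO : s.out.length ≤ O) :
    scanPass.Does (s.mem v S) (passTime a.length W O) ((s.pass a).mem v S) := by
  have h₁ := does_resetScan v S s hW
  have h₂ : beginOut.Does (({ prod := s.prod, out := s.out } : Scan).mem v S) (O * 4 + 1 + 3)
        ((Scan.init s.prod).mem v S) := by
    refine ((Does.clear Stk.out _).seq (Does.pushList _ _ _)).congr
      (Prod.ext rfl (funext fun k => by cases k <;> rfl)) ?_
    change s.out.length * 4 + 1 + 3 ≤ _
    omega
  have h₃ := Does.forAll (Γ := StkAlphabet) (k := Stk.ann) (P := scanToken)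
    (T := 4 * (W + a.length + 4) ^ 2 + 2)
    (fun (x : Scan × List (Tok × Bool)) l => x.1.mem v (update (update S .ann l) .ann' x.2))
    -- Weight plus unread tokens does not increase, so the weight is at most `W + a.length`
    -- throughout the pass.
    (fun x t => (x.1.next t, t :: x.2)) (fun x l => x.1.weight + l.length ≤ W + a.length)
    (fun _ _ => rfl) (fun x t l => funext fun k => by cases k <;> rfl) (fun _ _ _ => rfl)
    (fun x t l h => by
      have := x.1.weight_next t
      simp only [List.length_cons] at h ⊢
      omega)
    (fun x t l h => by
      refine (does_scanToken v _ x.1 t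
        (by simp only [List.length_cons] at h; omega)).congr ?_ le_rfl
      refine Prod.ext rfl (funext fun k => ?_)
      cases k <;> rfl)
    (Scan.init s.prod, []) a (by have := s.weight_init; simp only; omega)
  have hf : ∀ (l : List (Tok × Bool)) (x : Scan × List (Tok × Bool)),
      l.foldl (fun x t => (x.1.next t, t :: x.2)) x =
        (l.foldl Scan.next x.1, l.reverse ++ x.2) := by
    intro l
    induction l with
    | nil => simp
    | cons t l ih => intro x; simp [ih]
  rw [hf] at h₃
  have h₄ : update (update S .ann a) .ann' [] = S := by
    rw [← ha, ← ha', update_eq_self, update_eq_self]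
  simp only [h₄, List.append_nil] at h₃
  refine (h₁.seq (h₂.seq (h₃.seq (does_restoreAnn v _ (s.pass a))))).congr
    (congrArg (fun S => (s.pass a).mem v S) (funext fun k => ?_)) ?_
  · cases k <;> try rfl
    · simp [ha]
    · simp [ha']
  · have : update (update S Stk.ann []) Stk.ann' a.reverse Stk.ann' = a.reverse := rfl
    rw [this, List.length_reverse, passTime]
    nlinarith

/-- Put one symbol on `cnt` for each symbol of `ann`. -/
noncomputable def countAnn : Prog :=
  (forAll .ann fun t => (push .ann' t).seq (push .cnt ())).seq restoreAnn

theorem does_countAnn (v : Vars) (S : Stacks) (s : Scan) (a : List (Tok × Bool))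
    (ha : S .ann = a) (ha' : S .ann' = []) (hc : S .cnt = []) :
    countAnn.Does (s.mem v S) (9 * a.length + 2)
      (s.mem v (update S .cnt (List.replicate a.length ()))) := by
  have h₃ := Does.forAll (Γ := StkAlphabet) (τ := Vars) (k := Stk.ann)
    (P := fun t => (push .ann' t).seq (push .cnt ())) (T := 2)
    (fun (x : List (Tok × Bool) × ℕ) l => s.mem v
      (update (update (update S .ann l) .ann' x.1) .cnt (List.replicate x.2 ())))
    (fun x t => (t :: x.1, x.2 + 1)) (fun _ _ => True)
    (fun _ _ => rfl) (fun x t l => funext fun k => by cases k <;> rfl) (fun _ _ _ => rfl)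
    (fun _ _ _ _ => trivial)
    (fun x t l _ => by
      refine ((Does.push _ _ _).seq (Does.push _ _ _)).congr
        (Prod.ext rfl (funext fun k => ?_)) le_rfl
      cases k <;> rfl)
    ([], 0) a trivial
  have hf : ∀ (l : List (Tok × Bool)) (x : List (Tok × Bool) × ℕ),
      l.foldl (fun x t => (t :: x.1, x.2 + 1)) x = (l.reverse ++ x.1, x.2 + l.length) := by
    intro l
    induction l with
    | nil => simp
    | cons t l ih => intro x; simp [ih]; omega
  have h₄ : update (update (update S .ann a) .ann' []) .cnt (List.replicate 0 ()) = S := by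
    rw [← ha, ← ha', update_eq_self, update_eq_self, List.replicate_zero, ← hc, update_eq_self]
  rw [hf] at h₃
  simp only [h₄, List.append_nil, Nat.zero_add] at h₃
  refine (h₃.seq (does_restoreAnn v _ s)).congr
    (congrArg (fun S => s.mem v S) (funext fun k => ?_)) ?_
  · cases k <;> try rfl
    · simp [ha]
    · simp [ha']
  · have : update (update (update S .ann []) .ann' a.reverse) .cnt (List.replicate a.length ())
        .ann' = a.reverse := rfl
    rw [this, List.length_reverse]
    omega

/-- An upper bound for the length of the output of a scan. -/
def outBound (n : ℕ) : ℕ := 2 + n * (n * n + n + 7)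

theorem does_iteratePass (v : Vars) (S : Stacks) (a : List (Tok × Bool))
    (ha : S .ann = a) (ha' : S .ann' = []) (hc : S .cnt = []) :
    (forAll .cnt fun _ => scanPass : Prog).Does
      (({} : Scan).mem v (update S .cnt (List.replicate a.length ())))
      (a.length * (passTime a.length (a.length * a.length) (outBound a.length) + 3) + 1)
      ((finalScan a).mem v S) := by
  have h := Does.forAll (Γ := StkAlphabet) (τ := Vars) (k := Stk.cnt) (P := fun _ => scanPass)
    (T := passTime a.length (a.length * a.length) (outBound a.length))
    (fun (s : Scan) l => s.mem v (update S .cnt l)) (fun s _ => s.pass a)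
    -- Each remaining pass may add `a.length` to the weight; the output is rewritten in each pass
    -- and does not accumulate.
    (fun s l => s.weight + l.length * a.length ≤ a.length * a.length ∧
      s.out.length ≤ outBound a.length)
    (fun _ _ => rfl) (fun x t l => funext fun k => by cases k <;> rfl) (fun _ _ _ => rfl)
    (fun s t l h => by
      have h₁ := s.weight_pass a
      have h₂ := s.length_out_pass a
      rw [List.length_cons, Nat.succ_mul] at h
      refine ⟨by omega, h₂.trans (Nat.add_le_add_left (Nat.mul_le_mul_left _ (by omega)) _)⟩)
    (fun s t l h => does_scanPass v (update S .cnt l) s a (by simpa using ha) (by simpa using ha')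
      ((Nat.le_add_right _ _).trans h.1) h.2)
    {} (List.replicate a.length ()) (by simp [Scan.weight])
  rw [List.length_replicate, List.foldl_const, List.length_replicate] at h
  exact h.congr (by rw [finalScan, ← hc, update_eq_self]) le_rfl

/-- End the output. -/
noncomputable def endOut : Prog := switch fun v =>
  if v.mode = .top ∧ v.good = true then
    (pushList .out [.lpar, .bot, .rpar]).seq <|
      (forAll .idx fun _ => push .out .rpar).seq (pushList .out [.lpar, .bot, .rpar, .rpar])
  else forAll .out fun _ => skip

theorem does_endOut (v : Vars) (S : Stacks) (s : Scan) :
    endOut.Does (s.mem v S) (4 * s.out.length + 4 * s.weight + 11)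
      (({ s with
          idx := if s.mode = .top ∧ s.good = true then 0 else s.idx
          out := if s.mode = .top ∧ s.good = true then (closing s.idx).reverse ++ s.out else [] } :
        Scan).mem v S) := by
  refine (Does.switch (t := 4 * s.out.length + 4 * s.weight + 10) ?_).mono (by omega)
  have h₁ : (s.mem v S).1.mode = s.mode := rfl
  have h₂ : (s.mem v S).1.good = s.good := rfl
  rw [h₁, h₂]
  split_ifs with h
  · refine ((Does.pushList _ _ _).seq ((Does.move (Γ := StkAlphabet) (k := Stk.idx)
      (k' := Stk.out) (by decide) (fun _ => .rpar) _).seq (Does.pushList _ _ _))).congr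
      (Prod.ext rfl (funext fun k => ?_)) ?_
    · cases k <;> try rfl
      simp [Scan.mem, closing]
    · change 4 + ((List.replicate s.idx ()).length * 4 + 1 + 5) ≤ _
      simp only [List.length_replicate, Scan.weight]
      omega
  · refine (Does.clear Stk.out _).congr (Prod.ext rfl (funext fun k => by cases k <;> rfl)) ?_
    change s.out.length * 4 + 1 ≤ _
    omega

/-- Compute the reduction. -/
noncomputable def reduce : Prog :=
  countAnn.seq <| (forAll .cnt fun _ => scanPass).seq <| endOut.seq <|
    resetScan.seq <| forAll .set fun _ => skip

/-- The time for computing the reduction, for an input of length `n`. -/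
def reduceTime (n : ℕ) : ℕ :=
  n * (passTime n (n * n) (outBound n) + 12) + 4 * outBound n + 12 * (n * n) + 40

theorem length_out_finalScan (a : List (Tok × Bool)) :
    (finalScan a).out.length ≤ outBound a.length := by
  unfold finalScan
  cases h : a.length with
  -- For the empty text no pass is made and the output is still empty.
  | zero => simp
  | succ n =>
    rw [iterate_succ_apply']
    refine (Scan.length_out_pass a _).trans (Nat.add_le_add_left ?_ _)
    rw [h]
    refine Nat.mul_le_mul_left _ ?_
    have := Scan.weight_iterate_pass a n
    rw [h] at this
    nlinarith

/-- All working stacks are cleared at the end and `ann` survives, so the program can be run again in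
the next round of a search. -/
theorem does_reduce (v : Vars) (S : Stacks) (a : List (Tok × Bool))
    (ha : S .ann = a) (ha' : S .ann' = []) (hc : S .cnt = []) :
    reduce.Does (({} : Scan).mem v S) (reduceTime a.length)
      (({ out := (reduction a).reverse } : Scan).mem v S) := by
  have hw : (finalScan a).weight ≤ a.length * a.length := Scan.weight_iterate_pass a _
  have ho := length_out_finalScan a
  have h₁ := does_countAnn v S {} a ha ha' hc
  have h₂ := does_iteratePass v S a ha ha' hc
  have h₃ := does_endOut v S (finalScan a)
  have h₄ := does_resetScan v S { finalScan a with
      idx := if (finalScan a).mode = .top ∧ (finalScan a).good = true then 0 else (finalScan a).idx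
      out := if (finalScan a).mode = .top ∧ (finalScan a).good = true then
        (closing (finalScan a).idx).reverse ++ (finalScan a).out else [] }
    (W := a.length * a.length) (by
      refine le_trans ?_ hw
      unfold Scan.weight
      simp only
      split_ifs <;> omega)
  refine (h₁.seq (h₂.seq (h₃.seq (h₄.seq (Does.clear Stk.set _))))).congr
    (Prod.ext rfl (funext fun k => ?_)) ?_
  · cases k <;> try rfl
    simp only [Scan.mem, reduction]
    split_ifs <;> simp
  · change _ + (_ + (_ + (_ + ((flat (finalScan a).prod).length * 4 + 1)))) ≤ _
    have : (flat (finalScan a).prod).length ≤ a.length * a.length := by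
      refine le_trans ?_ hw
      rw [length_flat]
      unfold Scan.weight
      omega
    unfold reduceTime
    nlinarith

end ParametricGrammar

namespace ParametricGrammar

/-! ### The words that a scan accepts -/

/-- Tokens without a mark. -/
def plain (w : List Tok) : List (Tok × Bool) := w.map fun t => (t, false)

/-- `closes d g`: in the text `g` the parentheses are closed with the last token and not before, if
`d + 1` parentheses are open at the beginning. -/
def closes : ℕ → List Tok → Bool
  | _, [] => false
  | d, .lpar :: g => closes (d + 1) g
  | 0, .rpar :: g => g.isEmpty
  | d + 1, .rpar :: g => closes d g
  | d, _ :: g => closes d g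

/-- A parenthesized text. -/
def Balanced (g : List Tok) : Prop := ∃ g', g = .lpar :: g' ∧ closes 0 g' = true

/-- The argument of `closes` is one less than the number of open parentheses: out of `d + e + 2` the
text `g` closes `d + 1`, and `e + 1` remain. -/
theorem closes_append {g : List Tok} {d : ℕ} (h : closes d g = true) (e : ℕ) (r : List Tok) :
    closes (d + e + 1) (g ++ r) = closes e r := by
  induction g generalizing d with
  | nil => simp [closes] at h
  | cons t g ih =>
    cases t <;> try exact ih h
    case lpar => simpa [closes, Nat.add_right_comm] using ih h
    case rpar =>
      cases d with
      | zero =>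
        obtain rfl : g = [] := by simpa [closes] using h
        simp [closes]
      | succ d => simpa [closes, Nat.add_right_comm] using ih h

/-- Balanced texts form a prefix-free code, since the tokens read so far determine whether the text
ends here. This makes it possible to split the encoding of an implication into its two parts. -/
theorem closes_unique {u v : List Tok} {d : ℕ} (hu : closes d u = true) (hv : closes d v = true)
    {r r' : List Tok} (h : u ++ r = v ++ r') : u = v := by
  induction u generalizing v d with
  | nil => simp [closes] at hu
  | cons t u ih =>
    cases v with
    | nil => simp [closes] at hv
    | cons t' v =>
      simp only [List.cons_append, List.cons.injEq] at h
      obtain ⟨rfl, h⟩ := h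
      congr 1
      cases t <;> try exact ih hu hv h
      case rpar =>
        cases d with
        | zero =>
          obtain rfl : u = [] := by simpa [closes] using hu
          obtain rfl : v = [] := by simpa [closes] using hv
          rfl
        | succ d => exact ih hu hv h

theorem Balanced.unique {u v : List Tok} (hu : Balanced u) (hv : Balanced v) {r r' : List Tok}
    (h : u ++ r = v ++ r') : u = v := by
  obtain ⟨u, rfl, hu⟩ := hu
  obtain ⟨v, rfl, hv⟩ := hv
  simp only [List.cons_append, List.cons.injEq, true_and] at h
  rw [closes_unique hu hv h]

/-- A text that contains matching parentheses only. -/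
def Neutral (g : List Tok) : Prop := ∀ d r, closes d (g ++ r) = closes d r

theorem Balanced.neutral {g : List Tok} (h : Balanced g) : Neutral g := by
  obtain ⟨g, rfl, h⟩ := h
  intro d r
  simpa [closes] using closes_append h d r

theorem Neutral.append {g g' : List Tok} (h : Neutral g) (h' : Neutral g') : Neutral (g ++ g') :=
  fun d r => by rw [List.append_assoc, h, h']

theorem Neutral.balanced {g : List Tok} (h : Neutral g) : Balanced (.lpar :: (g ++ [.rpar])) :=
  ⟨_, rfl, by rw [h]; rfl⟩

theorem neutral_singleton {t : Tok} (h : t ≠ .lpar) (h' : t ≠ .rpar) : Neutral [t] := by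
  intro d r
  cases t <;> simp_all [closes]

theorem neutral_nil : Neutral [] := fun _ _ => rfl

theorem neutral_of_forall {g : List Tok} (h : ∀ t ∈ g, t ≠ .lpar ∧ t ≠ .rpar) : Neutral g := by
  induction g with
  | nil => exact neutral_nil
  | cons t g ih =>
    exact (neutral_singleton (h t (by simp)).1 (h t (by simp)).2).append
      (ih fun t ht => h t (by simp [ht]))

/-- Put the prefix `p` before the names of local variables. -/
def rename (p : List Bool) (g : List Tok) : List Tok :=
  g.flatMap fun t => if t = .loc then .loc :: p.map .bit else [t]

/-- The prefix for the names of local variables in the rule number `i`. -/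
def rulePrefix (i : ℕ) : List Bool := List.replicate i true ++ [false]

theorem rename_append (p : List Bool) (g g' : List Tok) :
    rename p (g ++ g') = rename p g ++ rename p g' := List.flatMap_append

theorem rename_cons (p : List Bool) (t : Tok) (g : List Tok) :
    rename p (t :: g) = (if t = .loc then .loc :: p.map .bit else [t]) ++ rename p g := rfl

/-- Renaming inserts nothing but bits, which are invisible to the count of parentheses. -/
theorem closes_rename (p : List Bool) (d : ℕ) (g : List Tok) :
    closes d (rename p g) = closes d g := by
  induction g generalizing d with
  | nil => rfl
  | cons t g ih =>
    cases t <;> try exact ih _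
    case loc =>
      have h : Neutral (p.map Tok.bit) := neutral_of_forall fun t ht => by
        obtain ⟨b, _, rfl⟩ := List.mem_map.1 ht
        simp
      simpa [rename_cons, closes, h d] using ih d
    case rpar =>
      cases d with
      | zero => cases g with
        | nil => rfl
        | cons t g => simp [rename_cons, closes]; split <;> simp
      | succ d => exact ih d

theorem Balanced.rename {g : List Tok} (h : Balanced g) (p : List Bool) :
    Balanced (rename p g) := by
  obtain ⟨g, rfl, h⟩ := h
  exact ⟨ParametricGrammar.rename p g, rfl, by rwa [closes_rename]⟩

/-- A rule whose guard is given as a text. -/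
structure TextRule where
  sel : Bool
  lhs : Ident
  rhs : List (Symbol (Ident ⊕ Ident) Ident)
  guard : List (Tok × Bool)

namespace TextRule

/-- The text of the guard. -/
def guardText (r : TextRule) : List Tok := r.guard.map Prod.fst

/-- The rule as a text. -/
def text (r : TextRule) : List (Tok × Bool) :=
  (.rule, r.sel) :: (plain (encodeIdent r.lhs) ++ plain (r.rhs.flatMap encodeSymbol) ++
    ((.guard, false) :: r.guard))

end TextRule

/-- A grammar whose guards are given as texts. -/
def grammarText (start : Ident) (rules : List TextRule) : List (Tok × Bool) :=
  plain (encodeIdent start) ++ rules.flatMap TextRule.text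

/-! #### The effect of a scan -/

namespace Scan

theorem foldl_bits (w : List Bool) (s : Scan)
    (h : s.mode = .start ∨ s.mode = .lhs ∨ ∃ b, s.mode = .sym b) :
    (plain (w.map .bit)).foldl next s = { s with cur := w.reverse ++ s.cur } := by
  induction w generalizing s with
  | nil => simp [plain]
  | cons b w ih =>
    have hn : s.next (.bit b, false) = { s with cur := b :: s.cur } := by
      rcases h with h | h | ⟨b', h⟩
      · simp [next, h, action, apply]
      · simp [next, h, action, apply]
      · cases b' <;> simp [next, h, action, apply]
    simp only [plain, List.map_cons, List.foldl_cons, hn]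
    simpa [plain] using ih { s with cur := b :: s.cur } h

/-- A symbol is a terminal or is known to be productive. -/
def symbolOk (p : List (List Bool)) : Symbol (Ident ⊕ Ident) Ident → Bool
  | .terminal _ => true
  | .nonterminal A => decide (A.reverse ∈ p)

theorem foldl_symbol (y : Symbol (Ident ⊕ Ident) Ident) (s : Scan) (hm : s.mode = .rhs)
    (hc : s.cur = []) :
    (plain (encodeSymbol y)).foldl next s = { s with ok := s.ok && symbolOk s.prod y } := by
  have h : ∀ (w : List Bool) (t : Tok), plain (t :: encodeIdent w) =
      (t, false) :: (plain (w.map .bit) ++ [(.fin, false)]) := by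
    simp [plain, encodeIdent]
  obtain ⟨mode, ok, sel, good, cur, lhs, prod, depth, idx, out⟩ := s
  simp only at hm hc
  subst hm hc
  rcases y with (a | a) | a <;>
    simp only [encodeSymbol, encodeAtom, h, List.foldl_cons, List.foldl_append, List.foldl_nil,
      symbolOk, Bool.and_true]
  · rw [foldl_bits a _ (.inr (.inr ⟨false, rfl⟩))]
    simp [next, action, apply]
  · rw [foldl_bits a _ (.inr (.inr ⟨false, rfl⟩))]
    simp [next, action, apply]
  · rw [foldl_bits a _ (.inr (.inr ⟨true, rfl⟩))]
    simp [next, action, apply]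

theorem foldl_symbols (l : List (Symbol (Ident ⊕ Ident) Ident)) (s : Scan) (hm : s.mode = .rhs)
    (hc : s.cur = []) :
    (plain (l.flatMap encodeSymbol)).foldl next s =
      { s with ok := s.ok && l.all (symbolOk s.prod) } := by
  induction l generalizing s with
  | nil => simp [plain]
  | cons y l ih =>
    have : plain ((y :: l).flatMap encodeSymbol) =
        plain (encodeSymbol y) ++ plain (l.flatMap encodeSymbol) := by simp [plain]
    rw [this, List.foldl_append, foldl_symbol y s hm hc,
      ih { s with ok := s.ok && symbolOk s.prod y } hm hc]
    simp [Bool.and_assoc]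

/-- The guard is copied token by token, except that `emitLoc` inserts `idx` times `true` and one
`false` behind `loc`, which is exactly `rulePrefix`. -/
theorem foldl_guard (g : List (Tok × Bool)) (s : Scan) (hm : s.mode = .guard)
    (h : closes s.depth (g.map Prod.fst) = true) :
    g.foldl next s =
      { s with
        mode := .top
        depth := 0
        idx := s.idx + 1
        out := (guardSuffix s.sel).reverse ++
          ((rename (rulePrefix s.idx) (g.map Prod.fst)).reverse ++ s.out) } := by
  induction g generalizing s with
  | nil => simp [closes] at h
  | cons t g ih =>
    obtain ⟨t, b⟩ := t
    obtain ⟨mode, ok, sel, good, cur, lhs, prod, depth, idx, out⟩ := s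
    simp only at hm h
    subst hm
    rw [List.foldl_cons]
    cases t
    case rpar =>
      cases depth with
      | zero =>
        obtain rfl : g = [] := by simpa [closes] using h
        simp [next, action, apply, rename]
      | succ d =>
        refine (ih _ ?_ ?_).trans ?_
        · rfl
        · exact h
        · simp [next, action, apply, rename_cons]
    all_goals
      refine (ih _ ?_ ?_).trans ?_
      · rfl
      · exact h
      · simp [next, action, apply, rename_cons, rulePrefix]

/-- The productive nonterminals that are known after reading a rule. -/
def prodStep (p : List (List Bool)) (r : TextRule) : List (List Bool) :=
  if r.sel && r.rhs.all (symbolOk p) then r.lhs.reverse :: p else p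

/-- The text that is written for a rule. -/
def ruleOut (i : ℕ) (r : TextRule) : List Tok :=
  guardPrefix r.sel ++ (rename (rulePrefix i) r.guardText ++ guardSuffix r.sel)

/-- The text that is written for several rules. -/
def rulesOut : ℕ → List TextRule → List Tok
  | _, [] => []
  | i, r :: rs => ruleOut i r ++ rulesOut (i + 1) rs

/-- The state of a scan between two rules. -/
structure Resting (s : Scan) : Prop where
  mode : s.mode = .top
  cur : s.cur = []
  lhs : s.lhs = []
  depth : s.depth = 0

theorem foldl_rule (r : TextRule) (hr : Balanced r.guardText) (s : Scan) (hs : s.Resting) :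
    r.text.foldl next s =
      { s with
        ok := r.sel && r.rhs.all (symbolOk s.prod)
        sel := r.sel
        prod := prodStep s.prod r
        idx := s.idx + 1
        out := (ruleOut s.idx r).reverse ++ s.out } := by
  obtain ⟨sel', lhs', rhs, guard⟩ := r
  obtain ⟨mode, ok, sel, good, cur, lhs, prod, depth, idx, out⟩ := s
  obtain ⟨hm, hc, hl, hd⟩ := hs
  simp only at hm hc hl hd
  subst hm hc hl hd
  -- The outermost parenthesis is read separately, in the mode `gstart`, and is not counted in
  -- `depth`.
  obtain ⟨g, hg, hcl⟩ := hr
  simp only [TextRule.guardText] at hg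
  obtain ⟨⟨t, b⟩, guard, rfl, rfl, rfl⟩ := List.map_eq_cons_iff.1 hg
  have h : ∀ w : List Bool, plain (encodeIdent w) = plain (w.map .bit) ++ [(.fin, false)] := by
    simp [plain, encodeIdent]
  have h₁ : next ⟨.top, ok, sel, good, [], [], prod, 0, idx, out⟩ (.rule, sel') =
      ⟨.lhs, sel', sel', good, [], [], prod, 0, idx, (guardPrefix sel').reverse ++ out⟩ := rfl
  have h₂ : next ⟨.lhs, sel', sel', good, lhs'.reverse ++ [], [], prod, 0, idx,
      (guardPrefix sel').reverse ++ out⟩ (.fin, false) =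
      ⟨.rhs, sel', sel', good, [], lhs', prod, 0, idx, (guardPrefix sel').reverse ++ out⟩ := by
    simp [next, action, apply]
  have h₃ : next (next ⟨.rhs, sel' && rhs.all (symbolOk prod), sel', good, [], lhs', prod, 0, idx,
      (guardPrefix sel').reverse ++ out⟩ (.guard, false)) (.lpar, b) =
      ⟨.guard, sel' && rhs.all (symbolOk prod), sel', good, [], [],
        prodStep prod ⟨sel', lhs', rhs, (.lpar, b) :: guard⟩, 0, idx,
        .lpar :: ((guardPrefix sel').reverse ++ out)⟩ := rfl
  simp only [TextRule.text, List.foldl_cons, List.foldl_append, List.foldl_nil, h]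
  rw [h₁, foldl_bits lhs' _ (.inr (.inl rfl))]
  simp only
  rw [h₂, foldl_symbols rhs _ rfl rfl]
  simp only
  rw [h₃, foldl_guard guard _ rfl hcl]
  simp [ruleOut, TextRule.guardText, rename_cons]

theorem foldl_rules (rs : List TextRule) (hr : ∀ r ∈ rs, Balanced r.guardText) (s : Scan)
    (hs : s.Resting) :
    ((rs.flatMap TextRule.text).foldl next s).Resting ∧
      ((rs.flatMap TextRule.text).foldl next s).good = s.good ∧
      ((rs.flatMap TextRule.text).foldl next s).prod = rs.foldl prodStep s.prod ∧
      ((rs.flatMap TextRule.text).foldl next s).idx = s.idx + rs.length ∧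
      ((rs.flatMap TextRule.text).foldl next s).out = (rulesOut s.idx rs).reverse ++ s.out := by
  induction rs generalizing s with
  | nil => simp [hs, rulesOut]
  | cons r rs ih =>
    rw [List.flatMap_cons, List.foldl_append, foldl_rule r (hr r (by simp)) s hs]
    obtain ⟨h₁, h₂, h₃, h₄, h₅⟩ := ih (fun r h => hr r (by simp [h])) { s with
        ok := r.sel && r.rhs.all (symbolOk s.prod)
        sel := r.sel
        prod := prodStep s.prod r
        idx := s.idx + 1
        out := (ruleOut s.idx r).reverse ++ s.out } ⟨hs.1, hs.2, hs.3, hs.4⟩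
    refine ⟨h₁, h₂, h₃, h₄.trans ?_, h₅.trans ?_⟩
    · simp only [List.length_cons]; omega
    · simp [rulesOut]

/-- The start symbol is read before the rules, so `good` refers to the list with which the pass
began, not to the one it produces. Names are looked up in reversed form because `cur` is built in
reverse. -/
theorem pass_grammarText (start : Ident) (rs : List TextRule)
    (hr : ∀ r ∈ rs, Balanced r.guardText) (s : Scan) :
    (s.pass (grammarText start rs)).mode = .top ∧
      (s.pass (grammarText start rs)).good = decide (start.reverse ∈ s.prod) ∧
      (s.pass (grammarText start rs)).prod = rs.foldl prodStep s.prod ∧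
      (s.pass (grammarText start rs)).idx = rs.length ∧
      (s.pass (grammarText start rs)).out = (rulesOut 0 rs).reverse ++ [.imp, .lpar] := by
  have h : plain (encodeIdent start) = plain (start.map .bit) ++ [(.fin, false)] := by
    simp [plain, encodeIdent]
  have h₁ : (plain (encodeIdent start)).foldl next (init s.prod) =
      { mode := .top
        good := decide (start.reverse ∈ s.prod)
        prod := s.prod
        out := [.imp, .lpar] } := by
    rw [h, List.foldl_append, foldl_bits start _ (.inl rfl)]
    simp [next, init, action, apply]
  rw [pass, grammarText, List.foldl_append, h₁]
  obtain ⟨h₁, h₂, h₃, h₄, h₅⟩ := foldl_rules rs hr {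
      mode := .top
      good := decide (start.reverse ∈ s.prod)
      prod := s.prod
      out := [.imp, .lpar] }
    ⟨rfl, rfl, rfl, rfl⟩
  exact ⟨h₁.1, h₂, h₃, h₄.trans (Nat.zero_add _), h₅⟩

end Scan

/-- The chain of implications with the premises given by the guards of the rules. -/
def chainText : ℕ → List TextRule → List Tok
  | _, [] => [.lpar, .bot, .rpar]
  | i, r :: rs => Scan.ruleOut i r ++ (chainText (i + 1) rs ++ [.rpar])

/-- The nested implications all end together, so a scan can write the premises from left to right
and leave the closing parentheses to `closing`. -/
theorem chainText_eq (i : ℕ) (rs : List TextRule) :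
    chainText i rs =
      Scan.rulesOut i rs ++ ([.lpar, .bot, .rpar] ++ List.replicate rs.length .rpar) := by
  induction rs generalizing i with
  | nil => simp [chainText, Scan.rulesOut]
  | cons r rs ih =>
    rw [chainText, ih, Scan.rulesOut, List.length_cons, List.replicate_succ']
    simp

/-- The nonterminals that are known to be productive after `n` scans. -/
def productiveList (rs : List TextRule) (n : ℕ) : List (List Bool) :=
  (rs.foldl Scan.prodStep)^[n] []

theorem prod_iterate_pass (start : Ident) (rs : List TextRule)
    (hr : ∀ r ∈ rs, Balanced r.guardText) (n : ℕ) :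
    ((Scan.pass (grammarText start rs))^[n] {}).prod = productiveList rs n := by
  induction n with
  | zero => rfl
  | succ n ih =>
    rw [Function.iterate_succ_apply', (Scan.pass_grammarText start rs hr _).2.2.1, ih,
      productiveList, productiveList, Function.iterate_succ_apply']

/-- Guarantees at least as many passes before the last one as there are rules, which is enough for
saturation. -/
theorem length_le_length_grammarText (start : Ident) (rs : List TextRule) :
    rs.length + 1 ≤ (grammarText start rs).length := by
  have h : rs.length ≤ (rs.flatMap TextRule.text).length := by
    induction rs with
    | nil => simp
    | cons r rs ih => simp [TextRule.text] at ih ⊢; omega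
  simp only [grammarText, List.length_append, plain, List.length_map, encodeIdent,
    List.length_singleton]
  omega

/-- One pass is lost in the exponent because the last pass tests the start symbol against the list
left by its predecessors. -/
theorem reduction_grammarText (start : Ident) (rs : List TextRule)
    (hr : ∀ r ∈ rs, Balanced r.guardText) :
    reduction (grammarText start rs) =
      if start.reverse ∈ productiveList rs ((grammarText start rs).length - 1) then
        [.lpar, .imp] ++ (chainText 0 rs ++ [.lpar, .bot, .rpar, .rpar]) else [] := by
  have hn := length_le_length_grammarText start rs
  obtain ⟨n, hn⟩ : ∃ n, (grammarText start rs).length = n + 1 :=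
    ⟨(grammarText start rs).length - 1, by omega⟩
  obtain ⟨h₁, h₂, -, h₄, h₅⟩ := Scan.pass_grammarText start rs hr
    ((Scan.pass (grammarText start rs))^[n] {})
  rw [prod_iterate_pass start rs hr] at h₂
  simp only [reduction, finalScan, hn, Function.iterate_succ_apply', h₁, h₂, h₄, h₅, true_and,
    decide_eq_true_eq, Nat.add_sub_cancel]
  simp [chainText_eq, closing]

end ParametricGrammar

namespace ParametricGrammar

/-! #### Reconstructing a grammar from its text -/

/-- Remove the marks except on the tokens `rule`. -/
def clean (t : Tok × Bool) : Tok × Bool := (t.1, t.2 && decide (t.1 = .rule))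

/-- Only `beginRule` consults the mark. Hence an arbitrary marking may be cleaned first, and a
cleaned text can have the form `grammarText`, whose tokens outside the guards carry no marks except
at `rule`. -/
theorem Scan.next_clean (s : Scan) (t : Tok × Bool) : s.next (clean t) = s.next t := by
  obtain ⟨t, b⟩ := t
  rw [Scan.next, Scan.next, clean]
  generalize s.mode = m
  rcases m with _ | _ | _ | _ | nt | _ | _ | _
  case sym => cases nt <;> cases t <;> rfl
  all_goals cases t <;> first | rfl | simp [action]

theorem Scan.pass_map_clean (a : List (Tok × Bool)) (s : Scan) :
    s.pass (a.map clean) = s.pass a := by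
  simp only [Scan.pass, List.foldl_map, Scan.next_clean]

theorem finalScan_map_clean (a : List (Tok × Bool)) : finalScan (a.map clean) = finalScan a := by
  rw [finalScan, finalScan, List.length_map]
  exact congrArg (fun f => f^[a.length] _) (funext fun s => Scan.pass_map_clean a s)

theorem reduction_map_clean (a : List (Tok × Bool)) : reduction (a.map clean) = reduction a := by
  rw [reduction, reduction, finalScan_map_clean]

/-- The text of a rule up to its right-hand side. -/
def ruleHead (b : Bool) (A : Ident) (α : List (Symbol (Ident ⊕ Ident) Ident)) :
    List (Tok × Bool) :=
  (.rule, b) :: (plain (encodeIdent A) ++ plain (α.flatMap encodeSymbol))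

/-- `ParsedRules u`: the word `u` is a start symbol followed by rules. -/
def ParsedRules (u : List (Tok × Bool)) : Prop :=
  ∃ st rs, (∀ r ∈ rs, Balanced (TextRule.guardText r)) ∧ u = grammarText st rs

/-- `Parsed m d u`: the word `u` has the form that corresponds to the mode `m` of a scan, where `d`
is the number of open parentheses in a guard. -/
def Parsed (m : Mode) (d : ℕ) (u : List (Tok × Bool)) : Prop :=
  match m with
  | .start => ∃ w : List Bool, u = plain (w.map .bit)
  | .fail => True
  | .top => ParsedRules u
  | .lhs => ∃ x b, ∃ w : List Bool, ParsedRules x ∧ u = x ++ (.rule, b) :: plain (w.map .bit)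
  | .rhs => ∃ x b A α, ParsedRules x ∧ u = x ++ ruleHead b A α
  | .sym nt => ∃ x b A α t, ∃ w : List Bool, ParsedRules x ∧
      (if nt then t = Tok.nonterm else t = .param ∨ t = .loc) ∧
      u = x ++ (ruleHead b A α ++ (t, false) :: plain (w.map .bit))
  | .gstart => ∃ x b A α, ParsedRules x ∧ u = x ++ (ruleHead b A α ++ [(.guard, false)])
  | .guard => ∃ x b A α, ∃ g : List (Tok × Bool), ParsedRules x ∧
      (∀ r, closes 0 (g.map Prod.fst ++ r) = closes d r) ∧
      u = x ++ (ruleHead b A α ++ (.guard, false) :: (.lpar, false) :: g)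

/-- The scan is a parser: its mode tells the shape of what has been read. The hypothesis `hd`
ensures that the count of parentheses starts at zero when a guard is opened. -/
theorem Parsed.next {s : Scan} {u : List (Tok × Bool)} (h : Parsed s.mode s.depth u)
    (hd : s.mode = .gstart → s.depth = 0) (t : Tok × Bool) :
    Parsed (s.next (clean t)).mode (s.next (clean t)).depth (u ++ [clean t]) := by
  obtain ⟨t, b⟩ := t
  obtain ⟨mode, ok, sel, good, cur, lhs, prod, depth, idx, out⟩ := s
  have hfail : ∀ d u, Parsed .fail d u := fun _ _ => trivial
  cases mode with
  | start =>
    obtain ⟨w, rfl⟩ := h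
    cases t <;> try exact hfail _ _
    case bit b' =>
      change Parsed .start _ _
      exact ⟨w ++ [b'], by simp [plain, clean]⟩
    case fin =>
      change Parsed .top _ _
      exact ⟨w, [], by simp, by simp [grammarText, plain, encodeIdent, clean]⟩
  | fail => cases t <;> exact hfail _ _
  | top =>
    cases t <;> try exact hfail _ _
    case rule =>
      change Parsed .lhs _ _
      exact ⟨u, b, [], h, by simp [plain, clean]⟩
  | lhs =>
    obtain ⟨x, b₀, w, hx, rfl⟩ := h
    cases t <;> try exact hfail _ _
    case bit b' =>
      change Parsed .lhs _ _
      exact ⟨x, b₀, w ++ [b'], hx, by simp [plain, clean]⟩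
    case fin =>
      change Parsed .rhs _ _
      exact ⟨x, b₀, w, [], hx, by simp [plain, encodeIdent, clean, ruleHead]⟩
  | rhs =>
    obtain ⟨x, b₀, A, α, hx, rfl⟩ := h
    cases t <;> try exact hfail _ _
    case param =>
      change Parsed (.sym false) _ _
      exact ⟨x, b₀, A, α, .param, [], hx, by simp, by simp [plain, clean]⟩
    case loc =>
      change Parsed (.sym false) _ _
      exact ⟨x, b₀, A, α, .loc, [], hx, by simp, by simp [plain, clean]⟩
    case nonterm =>
      change Parsed (.sym true) _ _
      exact ⟨x, b₀, A, α, .nonterm, [], hx, by simp, by simp [plain, clean]⟩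
    case guard =>
      change Parsed .gstart _ _
      exact ⟨x, b₀, A, α, hx, by simp [clean]⟩
  | sym nt =>
    obtain ⟨x, b₀, A, α, t₀, w, hx, ht, rfl⟩ := h
    cases t <;> try (cases nt <;> exact hfail _ _)
    case bit b' =>
      have : ((⟨.sym nt, ok, sel, good, cur, lhs, prod, depth, idx, out⟩ : Scan).next
          (clean (.bit b', b))).mode = .sym nt := by cases nt <;> rfl
      rw [this]
      exact ⟨x, b₀, A, α, t₀, w ++ [b'], hx, ht, by simp [plain, clean]⟩
    case fin =>
      cases nt <;> change Parsed .rhs _ _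
      · rcases ht with rfl | rfl
        · exact ⟨x, b₀, A, α ++ [.terminal (.inl w)], hx,
            by simp [plain, clean, encodeSymbol, encodeAtom, encodeIdent, ruleHead]⟩
        · exact ⟨x, b₀, A, α ++ [.terminal (.inr w)], hx,
            by simp [plain, clean, encodeSymbol, encodeAtom, encodeIdent, ruleHead]⟩
      · obtain rfl : t₀ = .nonterm := ht
        exact ⟨x, b₀, A, α ++ [.nonterminal w], hx,
          by simp [plain, clean, encodeSymbol, encodeIdent, ruleHead]⟩
  | gstart =>
    obtain ⟨x, b₀, A, α, hx, rfl⟩ := h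
    obtain rfl : depth = 0 := hd rfl
    cases t <;> try exact hfail _ _
    case lpar =>
      change Parsed .guard 0 _
      exact ⟨x, b₀, A, α, [], hx, fun _ => rfl, by simp [clean]⟩
  | guard =>
    obtain ⟨x, b₀, A, α, g, hx, hg, rfl⟩ := h
    -- Reading a token moves it from the continuation to the part already read, so the new invariant
    -- is the old one applied to `t :: r`.
    have hg' : ∀ t r, closes 0 ((g ++ [clean (t, b)]).map Prod.fst ++ r) =
        closes depth (t :: r) := by
      intro t r
      rw [List.map_append, List.append_assoc, hg]
      rfl
    have hu : ∀ t, x ++ (ruleHead b₀ A α ++ (.guard, false) :: (.lpar, false) :: g) ++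
        [clean (t, b)] = x ++ (ruleHead b₀ A α ++ (.guard, false) :: (.lpar, false) ::
          (g ++ [clean (t, b)])) := by simp
    rw [hu]
    cases t
    case rpar =>
      cases depth with
      | zero =>
        -- The parenthesis that closes the guard also completes the rule, which joins the list of
        -- parsed rules.
        change Parsed .top _ _
        obtain ⟨st, rs, hr, rfl⟩ := hx
        refine ⟨st, rs ++ [⟨b₀, A, α, (.lpar, false) :: (g ++ [clean (.rpar, b)])⟩], ?_, ?_⟩
        · intro r hr'
          rcases List.mem_append.1 hr' with h | h
          · exact hr r h
          · obtain rfl := List.mem_singleton.1 h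
            refine ⟨(g ++ [clean (.rpar, b)]).map Prod.fst, rfl, ?_⟩
            rw [← List.append_nil (List.map _ _), hg']
            rfl
        · simp [grammarText, TextRule.text, ruleHead]
      | succ d =>
        change Parsed .guard d _
        exact ⟨x, b₀, A, α, _, hx, fun r => hg' _ r, rfl⟩
    case lpar =>
      change Parsed .guard (depth + 1) _
      exact ⟨x, b₀, A, α, _, hx, fun r => hg' _ r, rfl⟩
    all_goals
      change Parsed .guard depth _
      exact ⟨x, b₀, A, α, _, hx, fun r => (hg' _ r).trans (by simp [closes]), rfl⟩

theorem Scan.depth_next (s : Scan) (t : Tok × Bool) (h : s.mode ≠ .guard → s.depth = 0) :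
    (s.next t).mode ≠ .guard → (s.next t).depth = 0 := by
  obtain ⟨t, b⟩ := t
  obtain ⟨mode, ok, sel, good, cur, lhs, prod, depth, idx, out⟩ := s
  intro h'
  cases mode with
  | guard =>
    cases t <;> first | exact absurd rfl h' | skip
    case rpar =>
      cases depth with
      | zero => rfl
      | succ d => exact absurd rfl h'
  | sym nt => cases nt <;> cases t <;> exact h (by simp)
  | _ => cases t <;> exact h (by simp)

theorem parsed_foldl (a : List (Tok × Bool)) (p : List (List Bool)) :
    Parsed ((a.map clean).foldl Scan.next (Scan.init p)).mode
        ((a.map clean).foldl Scan.next (Scan.init p)).depth (a.map clean) ∧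
      (((a.map clean).foldl Scan.next (Scan.init p)).mode ≠ .guard →
        ((a.map clean).foldl Scan.next (Scan.init p)).depth = 0) := by
  induction a using List.reverseRecOn with
  | nil => exact ⟨⟨[], rfl⟩, fun _ => rfl⟩
  | append_singleton a t ih =>
    rw [List.map_append, List.foldl_append]
    exact ⟨ih.1.next (fun h => ih.2 (by simp [h])) t, Scan.depth_next _ _ ih.2⟩

/-- A nonempty result means that the last pass ended in the mode `top`, for which the invariant
`Parsed` is the claim. -/
theorem exists_grammarText (a : List (Tok × Bool)) (h : reduction a ≠ []) :
    ∃ st rs, (∀ r ∈ rs, Balanced (TextRule.guardText r)) ∧ a.map clean = grammarText st rs := by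
  have hm : (finalScan a).mode = .top := by
    by_contra hm
    exact h (by simp [reduction, hm])
  rw [finalScan] at hm
  cases hn : a.length with
  -- Without a pass the mode is still `start`.
  | zero => simp [hn] at hm
  | succ n =>
    rw [hn, Function.iterate_succ_apply', ← Scan.pass_map_clean] at hm
    have hp := (parsed_foldl a ((Scan.pass a)^[n] {}).prod).1
    rw [show ((a.map clean).foldl Scan.next _).mode = _ from hm] at hp
    exact hp

end ParametricGrammar

namespace ParametricGrammar

open FirstOrder FirstOrder.Language

/-! ### Encodings of formulas -/

section Encoding

variable {L : FirstOrder.Language.{u, v}} (c : SymbolCoding L)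

theorem neutral_encodeIdent (a : List Bool) : Neutral (encodeIdent a) :=
  neutral_of_forall fun t ht => by
    rcases List.mem_append.1 ht with h | h
    · obtain ⟨b, _, rfl⟩ := List.mem_map.1 h
      simp
    · simp_all

theorem neutral_encodeAtom (a : Ident ⊕ Ident) : Neutral (encodeAtom a) := by
  cases a with
  | inl a => exact (neutral_singleton (t := .param) nofun nofun).append (neutral_encodeIdent a)
  | inr a => exact (neutral_singleton (t := .loc) nofun nofun).append (neutral_encodeIdent a)

theorem Neutral.flatten {l : List (List Tok)} (h : ∀ g ∈ l, Neutral g) : Neutral l.flatten := by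
  induction l with
  | nil => exact neutral_nil
  | cons g l ih => exact (h g (by simp)).append (ih fun g hg => h g (by simp [hg]))

theorem neutral_encodeTerm {n : ℕ} (t : L.Term ((Ident ⊕ Ident) ⊕ Fin n)) :
    Neutral (encodeTerm c t) := by
  induction t with
  | var x =>
    cases x with
    | inl a => exact neutral_encodeAtom a
    | inr i => exact (neutral_singleton (t := .bound) nofun nofun).append (neutral_encodeIdent _)
  | func f ts ih =>
    rw [encodeTerm]
    refine ((neutral_singleton (t := .func) nofun nofun).append (neutral_encodeIdent _)).append
      (Neutral.flatten fun g hg => ?_)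
    obtain ⟨i, rfl⟩ := (List.mem_ofFn' _ _).1 hg
    exact ih i

theorem balanced_encodeFormula {n : ℕ} (φ : L.BoundedFormula (Ident ⊕ Ident) n) :
    Balanced (encodeFormula c φ) := by
  induction φ with
  | falsum => exact ⟨_, rfl, rfl⟩
  | equal t₁ t₂ =>
    exact (((neutral_singleton (t := .eq) nofun nofun).append (neutral_encodeTerm c t₁)).append
      (neutral_encodeTerm c t₂)).balanced
  | rel R ts =>
    refine (((neutral_singleton (t := .rel) nofun nofun).append (neutral_encodeIdent _)).append
      (Neutral.flatten fun g hg => ?_)).balanced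
    obtain ⟨i, rfl⟩ := (List.mem_ofFn' _ _).1 hg
    exact neutral_encodeTerm c _
  | imp φ ψ ih₁ ih₂ =>
    exact (((neutral_singleton (t := .imp) nofun nofun).append ih₁.neutral).append
      ih₂.neutral).balanced
  | all φ ih => exact ((neutral_singleton (t := .all) nofun nofun).append ih.neutral).balanced

/-! #### Renaming of local variables -/

/-- Put the prefix `p` before the name of a local variable. -/
def renameAtom (p : List Bool) : Ident ⊕ Ident → Ident ⊕ Ident := Sum.map id (p ++ ·)

/-- Put the prefix `p` before the names of the local variables of a term. -/
def renameTerm (p : List Bool) {n : ℕ} (t : L.Term ((Ident ⊕ Ident) ⊕ Fin n)) :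
    L.Term ((Ident ⊕ Ident) ⊕ Fin n) := t.relabel (Sum.map (renameAtom p) id)

/-- Put the prefix `p` before the names of the local variables of a formula. -/
def renameFormula (p : List Bool) {n : ℕ} (φ : L.BoundedFormula (Ident ⊕ Ident) n) :
    L.BoundedFormula (Ident ⊕ Ident) n :=
  φ.mapTermRel (fun _ => renameTerm p) (fun _ => id) (fun _ => id)

theorem rename_eq_self (p : List Bool) {g : List Tok} (h : .loc ∉ g) : rename p g = g := by
  induction g with
  | nil => rfl
  | cons t g ih =>
    rw [List.mem_cons, not_or] at h
    rw [rename_cons, if_neg (Ne.symm h.1), ih h.2, List.singleton_append]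

theorem rename_encodeIdent (p a : List Bool) : rename p (encodeIdent a) = encodeIdent a :=
  rename_eq_self p (by simp [encodeIdent])

theorem rename_flatten (p : List Bool) (l : List (List Tok)) :
    rename p l.flatten = (l.map (rename p)).flatten := by
  induction l with
  | nil => rfl
  | cons g l ih => rw [List.flatten_cons, rename_append, ih, List.map_cons, List.flatten_cons]

theorem encodeTerm_renameTerm (p : List Bool) {n : ℕ} (t : L.Term ((Ident ⊕ Ident) ⊕ Fin n)) :
    encodeTerm c (renameTerm p t) = rename p (encodeTerm c t) := by
  induction t with
  | var x =>
    rcases x with (a | a) | i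
    · change Tok.param :: encodeIdent a = Tok.param :: rename p (encodeIdent a)
      rw [rename_encodeIdent]
    · change Tok.loc :: encodeIdent (p ++ a) = Tok.loc :: (p.map .bit ++ rename p (encodeIdent a))
      rw [rename_encodeIdent]
      simp [encodeIdent]
    · change Tok.bound :: encodeIdent _ = Tok.bound :: rename p (encodeIdent _)
      rw [rename_encodeIdent]
      rfl
  | func f ts ih =>
    rw [renameTerm, Term.relabel, encodeTerm, encodeTerm, rename_append, rename_cons,
      rename_encodeIdent, rename_flatten, List.map_ofFn]
    simp only [reduceCtorEq, if_false, List.singleton_append]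
    congr 3
    exact funext ih

/-- In an encoding `loc` occurs only immediately before the name of a local variable, so inserting
bits behind `loc` prefixes exactly these names. -/
theorem encodeFormula_renameFormula (p : List Bool) {n : ℕ}
    (φ : L.BoundedFormula (Ident ⊕ Ident) n) :
    encodeFormula c (renameFormula p φ) = rename p (encodeFormula c φ) := by
  induction φ with
  | falsum => rfl
  | equal t₁ t₂ =>
    rw [renameFormula, BoundedFormula.mapTermRel, encodeFormula, encodeFormula,
      encodeTerm_renameTerm, encodeTerm_renameTerm, rename_append, rename_append, rename_append]
    rfl
  | rel R ts =>
    rw [renameFormula, BoundedFormula.mapTermRel, encodeFormula, encodeFormula,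
      rename_append, rename_append, rename_append, rename_flatten, rename_encodeIdent,
      List.map_ofFn]
    simp only [encodeTerm_renameTerm]
    rfl
  | imp φ ψ ih₁ ih₂ =>
    change [Tok.lpar, Tok.imp] ++ encodeFormula c (renameFormula p φ) ++
      encodeFormula c (renameFormula p ψ) ++ [Tok.rpar] = _
    rw [encodeFormula, ih₁, ih₂, rename_append, rename_append, rename_append]
    rfl
  | all φ ih =>
    change [Tok.lpar, Tok.all] ++ encodeFormula c (renameFormula p φ) ++ [Tok.rpar] = _
    rw [encodeFormula, ih, rename_append, rename_append]
    rfl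

theorem isQF_renameFormula (p : List Bool) {n : ℕ} {φ : L.BoundedFormula (Ident ⊕ Ident) n}
    (h : φ.IsQF) : (renameFormula p φ).IsQF := by
  induction h with
  | falsum => exact .falsum
  | of_isAtomic h =>
    cases h with
    | equal t₁ t₂ => exact (BoundedFormula.IsAtomic.equal _ _).isQF
    | rel R ts => exact (BoundedFormula.IsAtomic.rel R _).isQF
  | imp _ _ ih₁ ih₂ => exact ih₁.imp ih₂

theorem realize_renameFormula {D : Type w} [L.Structure D] (p : List Bool)
    (φ : GuardFormula L) (x : Ident ⊕ Ident → D) :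
    Formula.Realize (renameFormula p φ : GuardFormula L) x ↔
      φ.Realize (x ∘ renameAtom p) := by
  refine BoundedFormula.realize_mapTermRel_id (fun n t xs => ?_) (fun _ _ _ => rfl)
  rw [renameTerm, Term.realize_relabel]
  congr 1
  ext (i | i) <;> rfl

/-! #### Reading a renamed text -/

/-- Text is inserted behind `loc` only, so any other token at the head was already at the head
before the renaming. -/
theorem eq_cons_of_rename_eq_cons {p : List Bool} {g r' : List Tok} {t : Tok} (ht : t ≠ .loc)
    (h : rename p g = t :: r') : ∃ r, g = t :: r ∧ rename p r = r' := by
  cases g with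
  | nil => cases h
  | cons t' g =>
    rw [rename_cons] at h
    split at h
    · injection h with h
      exact absurd h.symm ht
    · injection h with h h'
      exact ⟨g, by rw [h], h'⟩

theorem eq_cons_of_rename_eq_loc {p : List Bool} {g r' : List Tok}
    (h : rename p g = .loc :: r') : ∃ r, g = .loc :: r ∧ p.map .bit ++ rename p r = r' := by
  cases g with
  | nil => cases h
  | cons t' g =>
    rw [rename_cons] at h
    split at h
    · next h₀ =>
      injection h with h h'
      exact ⟨g, by rw [h₀], h'⟩
    · injection h with h h'
      contradiction

theorem exists_of_rename_eq_encodeIdent {p : List Bool} {w : List Bool} {g r' : List Tok}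
    (h : rename p g = encodeIdent w ++ r') : ∃ r, g = encodeIdent w ++ r ∧ rename p r = r' := by
  induction w generalizing g with
  | nil => exact eq_cons_of_rename_eq_cons nofun h
  | cons b w ih =>
    obtain ⟨r, rfl, h₁⟩ := eq_cons_of_rename_eq_cons (t := .bit b) nofun h
    obtain ⟨r, rfl, h₂⟩ := ih h₁
    exact ⟨r, rfl, h₂⟩

/-- A name extends up to its terminator `fin`, and `p` consists of bits, so `p` is a prefix of the
name. -/
theorem exists_of_append_eq_encodeIdent {p y : List Bool} {z r : List Tok}
    (h : p.map .bit ++ z = encodeIdent y ++ r) :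
    ∃ y', y = p ++ y' ∧ z = encodeIdent y' ++ r := by
  induction p generalizing y with
  | nil => exact ⟨y, rfl, h⟩
  | cons b p ih =>
    cases y with
    | nil => cases h
    | cons b' y =>
      injection h with h₁ h₂
      injection h₁ with h₁
      obtain ⟨y', rfl, h⟩ := ih h₂
      exact ⟨y', by rw [h₁]; rfl, h⟩

theorem exists_of_rename_eq_encodeTerms {p : List Bool} {n k : ℕ}
    (ts' : Fin k → L.Term ((Ident ⊕ Ident) ⊕ Fin n))
    (ih : ∀ i {g r' : List Tok}, rename p g = encodeTerm c (ts' i) ++ r' →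
      ∃ t r, g = encodeTerm c t ++ r ∧ ts' i = renameTerm p t ∧ rename p r = r')
    {g r' : List Tok}
    (h : rename p g = (List.ofFn fun i => encodeTerm c (ts' i)).flatten ++ r') :
    ∃ ts : Fin k → L.Term ((Ident ⊕ Ident) ⊕ Fin n), ∃ r,
      g = (List.ofFn fun i => encodeTerm c (ts i)).flatten ++ r ∧
        ts' = (fun i => renameTerm p (ts i)) ∧ rename p r = r' := by
  induction k generalizing g with
  | zero => exact ⟨ts', g, by simp, funext fun i => i.elim0, by simpa using h⟩
  | succ k ihk =>
    rw [List.ofFn_succ, List.flatten_cons, List.append_assoc] at h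
    obtain ⟨t, r, rfl, h₁, h₂⟩ := ih 0 h
    obtain ⟨ts, r, rfl, h₃, h₄⟩ := ihk (fun i => ts' i.succ) (fun i => ih i.succ) h₂
    refine ⟨Fin.cons t ts, r, ?_, ?_, h₄⟩
    · simp [List.ofFn_succ]
    · funext i
      refine Fin.cases h₁ (fun i => ?_) i
      simpa using congrFun h₃ i

/-- The encoded term dictates the tokens one after another, and each of them can be traced back
through the renaming. The remainder `r` makes the statement usable for the arguments of a function.
-/
theorem exists_of_rename_eq_encodeTerm {p : List Bool} {n : ℕ}
    (t' : L.Term ((Ident ⊕ Ident) ⊕ Fin n)) {g r' : List Tok}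
    (h : rename p g = encodeTerm c t' ++ r') :
    ∃ t r, g = encodeTerm c t ++ r ∧ t' = renameTerm p t ∧ rename p r = r' := by
  induction t' generalizing g r' with
  | var x =>
    rcases x with (a | a) | i
    · obtain ⟨r, rfl, h₁⟩ := eq_cons_of_rename_eq_cons (t := .param) nofun h
      obtain ⟨r, rfl, h₂⟩ := exists_of_rename_eq_encodeIdent h₁
      exact ⟨.var (.inl (.inl a)), r, rfl, rfl, h₂⟩
    · obtain ⟨r, rfl, h₁⟩ := eq_cons_of_rename_eq_loc h
      obtain ⟨y, rfl, h₂⟩ := exists_of_append_eq_encodeIdent h₁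
      obtain ⟨r, rfl, h₃⟩ := exists_of_rename_eq_encodeIdent h₂
      exact ⟨.var (.inl (.inr y)), r, rfl, rfl, h₃⟩
    · obtain ⟨r, rfl, h₁⟩ := eq_cons_of_rename_eq_cons (t := .bound) nofun h
      obtain ⟨r, rfl, h₂⟩ := exists_of_rename_eq_encodeIdent h₁
      exact ⟨.var (.inr i), r, rfl, rfl, h₂⟩
  | @func l f ts ih =>
    rw [encodeTerm, List.append_assoc] at h
    obtain ⟨r, rfl, h₁⟩ := eq_cons_of_rename_eq_cons (t := .func) nofun h
    obtain ⟨r, rfl, h₂⟩ := exists_of_rename_eq_encodeIdent h₁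
    obtain ⟨ts, r, rfl, rfl, h₃⟩ := exists_of_rename_eq_encodeTerms c ts (fun i => ih i) h₂
    exact ⟨.func f ts, r, by simp [encodeTerm], rfl, h₃⟩

theorem exists_of_rename_eq_encodeFormula_append {p : List Bool} {n : ℕ}
    {φ' : L.BoundedFormula (Ident ⊕ Ident) n} (hφ : φ'.IsQF) {g r' : List Tok}
    (h : rename p g = encodeFormula c φ' ++ r') :
    ∃ (φ : L.BoundedFormula (Ident ⊕ Ident) n) (r : List Tok), φ.IsQF ∧
      g = encodeFormula c φ ++ r ∧ φ' = renameFormula p φ ∧ rename p r = r' := by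
  have hrpar : ∀ {g r'}, rename p g = .rpar :: r' → ∃ r, g = .rpar :: r ∧ rename p r = r' :=
    eq_cons_of_rename_eq_cons nofun
  induction hφ generalizing g r' with
  | falsum =>
    obtain ⟨r, rfl, h₁⟩ := eq_cons_of_rename_eq_cons (t := .lpar) nofun h
    obtain ⟨r, rfl, h₂⟩ := eq_cons_of_rename_eq_cons (t := .bot) nofun h₁
    obtain ⟨r, rfl, h₃⟩ := hrpar h₂
    exact ⟨.falsum, r, .falsum, rfl, rfl, h₃⟩
  | of_isAtomic hφ =>
    cases hφ with
    | equal t₁ t₂ =>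
      rw [Term.bdEqual, encodeFormula] at h
      simp only [List.append_assoc, List.cons_append, List.nil_append] at h
      obtain ⟨r, rfl, h₁⟩ := eq_cons_of_rename_eq_cons (t := .lpar) nofun h
      obtain ⟨r, rfl, h₂⟩ := eq_cons_of_rename_eq_cons (t := .eq) nofun h₁
      obtain ⟨t₁, r, rfl, rfl, h₃⟩ := exists_of_rename_eq_encodeTerm c _ h₂
      obtain ⟨t₂, r, rfl, rfl, h₄⟩ := exists_of_rename_eq_encodeTerm c _ h₃
      obtain ⟨r, rfl, h₅⟩ := hrpar h₄
      exact ⟨.equal t₁ t₂, r, (BoundedFormula.IsAtomic.equal _ _).isQF,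
        by simp [encodeFormula], rfl, h₅⟩
    | rel R ts =>
      rw [Relations.boundedFormula, encodeFormula] at h
      simp only [List.append_assoc, List.cons_append, List.nil_append] at h
      obtain ⟨r, rfl, h₁⟩ := eq_cons_of_rename_eq_cons (t := .lpar) nofun h
      obtain ⟨r, rfl, h₂⟩ := eq_cons_of_rename_eq_cons (t := .rel) nofun h₁
      obtain ⟨r, rfl, h₃⟩ := exists_of_rename_eq_encodeIdent h₂
      obtain ⟨ts, r, rfl, rfl, h₄⟩ := exists_of_rename_eq_encodeTerms c ts
        (fun i => exists_of_rename_eq_encodeTerm c _) h₃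
      obtain ⟨r, rfl, h₅⟩ := hrpar h₄
      exact ⟨.rel R ts, r, (BoundedFormula.IsAtomic.rel _ _).isQF,
        by simp [encodeFormula], rfl, h₅⟩
  | imp _ _ ih₁ ih₂ =>
    rw [encodeFormula] at h
    simp only [List.append_assoc, List.cons_append, List.nil_append] at h
    obtain ⟨r, rfl, h₁⟩ := eq_cons_of_rename_eq_cons (t := .lpar) nofun h
    obtain ⟨r, rfl, h₂⟩ := eq_cons_of_rename_eq_cons (t := .imp) nofun h₁
    obtain ⟨φ₁, r, hq₁, rfl, rfl, h₃⟩ := ih₁ h₂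
    obtain ⟨φ₂, r, hq₂, rfl, rfl, h₄⟩ := ih₂ h₃
    obtain ⟨r, rfl, h₅⟩ := hrpar h₄
    exact ⟨.imp φ₁ φ₂, r, hq₁.imp hq₂, by simp [encodeFormula], rfl, h₅⟩

/-- The well-formedness of a guard is obtained from that of its renamed copy within the formula that
is assumed to be in `satProblem`, not from a test by the machine. -/
theorem exists_of_rename_eq_encodeFormula {p : List Bool} {n : ℕ}
    {φ' : L.BoundedFormula (Ident ⊕ Ident) n} (hφ : φ'.IsQF) {g : List Tok}
    (h : rename p g = encodeFormula c φ') :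
    ∃ φ : L.BoundedFormula (Ident ⊕ Ident) n, φ.IsQF ∧ g = encodeFormula c φ ∧
      φ' = renameFormula p φ := by
  obtain ⟨φ, r, hq, rfl, rfl, h₁⟩ := exists_of_rename_eq_encodeFormula_append c hφ (r' := [])
    (by rw [h, List.append_nil])
  obtain rfl : r = [] := by
    cases r with
    | nil => rfl
    | cons t r =>
      rw [rename_cons] at h₁
      split at h₁ <;> cases h₁
  exact ⟨φ, hq, by simp, rfl⟩

/-- The tag behind the first parenthesis reveals the connective, and the premise is delimited by
`Balanced.unique`. -/
theorem eq_imp_of_encodeFormula_eq {n : ℕ} {ψ : L.BoundedFormula (Ident ⊕ Ident) n}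
    (hψ : ψ.IsQF) {u v : List Tok} (hu : Balanced u)
    (h : encodeFormula c ψ = [.lpar, .imp] ++ (u ++ (v ++ [.rpar]))) :
    ∃ ψ₁ ψ₂ : L.BoundedFormula (Ident ⊕ Ident) n, ψ₁.IsQF ∧ ψ₂.IsQF ∧ ψ = ψ₁.imp ψ₂ ∧
      encodeFormula c ψ₁ = u ∧ encodeFormula c ψ₂ = v := by
  cases hψ with
  | falsum => simp [encodeFormula] at h
  | of_isAtomic hφ =>
    cases hφ with
    | equal t₁ t₂ => simp [Term.bdEqual, encodeFormula] at h
    | rel R ts => simp [Relations.boundedFormula, encodeFormula] at h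
  | @imp ψ₁ ψ₂ h₁ h₂ =>
    refine ⟨ψ₁, ψ₂, h₁, h₂, rfl, ?_⟩
    rw [encodeFormula] at h
    simp only [List.append_assoc, List.append_cancel_left_eq] at h
    obtain rfl := (balanced_encodeFormula c ψ₁).unique hu h
    exact ⟨rfl, by simpa using h⟩

theorem eq_falsum_of_encodeFormula_eq {n : ℕ} {ψ : L.BoundedFormula (Ident ⊕ Ident) n}
    (h : encodeFormula c ψ = [.lpar, .bot, .rpar]) : ψ = .falsum := by
  cases ψ <;> simp [encodeFormula] at h ⊢

/-! #### Chains of implications -/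

/-- The premise of a chain of implications that is written for the rule number `i`. -/
def premise (i : ℕ) (q : Bool × Production L) : GuardFormula L :=
  if q.1 then renameFormula (rulePrefix i) q.2.guard
  else .imp .falsum (renameFormula (rulePrefix i) q.2.guard)

/-- The chain of implications for some rules. -/
def chainFormula : ℕ → List (Bool × Production L) → GuardFormula L
  | _, [] => .falsum
  | i, q :: l => .imp (premise i q) (chainFormula (i + 1) l)

theorem isQF_premise (i : ℕ) (q : Bool × Production L) : (premise i q).IsQF := by
  have := isQF_renameFormula (rulePrefix i) q.2.guard_isQF
  rw [premise]
  split
  · exact this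
  · exact .imp .falsum this

theorem isQF_chainFormula (i : ℕ) (l : List (Bool × Production L)) : (chainFormula i l).IsQF := by
  induction l generalizing i with
  | nil => exact .falsum
  | cons q l ih => exact .imp (isQF_premise i q) (ih _)

/-- A rule whose guard is a text stands for a production. -/
structure Represents (r : TextRule) (q : Bool × Production L) : Prop where
  sel : r.sel = q.1
  lhs : r.lhs = q.2.lhs
  rhs : r.rhs = q.2.rhs
  guard : r.guardText = encodeFormula c q.2.guard

theorem encodeFormula_chainFormula (i : ℕ) {rs : List TextRule} {l : List (Bool × Production L)}
    (h : List.Forall₂ (Represents c) rs l) :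
    encodeFormula c (chainFormula i l) = chainText i rs := by
  induction h generalizing i with
  | nil => rfl
  | @cons r q rs l h _ ih =>
    rw [chainFormula, encodeFormula, ih, chainText, Scan.ruleOut, h.guard, h.sel,
      ← encodeFormula_renameFormula, premise]
    cases q.1 <;> simp [guardPrefix, guardSuffix, encodeFormula]

/-- Peeling off one implication after another exhibits each guard as a formula, including those of
the unselected rules. Thus textual rules become productions. -/
theorem exists_of_encodeFormula_eq_chainText {i : ℕ} {rs : List TextRule}
    (hr : ∀ r ∈ rs, Balanced r.guardText) {ψ : GuardFormula L} (hψ : ψ.IsQF)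
    (h : encodeFormula c ψ = chainText i rs) :
    ∃ l : List (Bool × Production L), List.Forall₂ (Represents c) rs l ∧
      ψ = chainFormula i l := by
  induction rs generalizing i ψ with
  | nil => exact ⟨[], .nil, eq_falsum_of_encodeFormula_eq c h⟩
  | cons r rs ih =>
    have hb := (hr r (by simp)).rename (rulePrefix i)
    have hr' : ∀ r ∈ rs, Balanced r.guardText := fun r h => hr r (by simp [h])
    obtain ⟨sel, lhs, rhs, guard⟩ := r
    cases sel with
    | true =>
      obtain ⟨ψ₁, ψ₂, hq₁, hq₂, rfl, h₁, h₂⟩ := eq_imp_of_encodeFormula_eq c hψ hb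
        (by simpa [chainText, Scan.ruleOut, guardPrefix, guardSuffix] using h)
      obtain ⟨φ, hφ, h₃, rfl⟩ := exists_of_rename_eq_encodeFormula c hq₁ h₁.symm
      obtain ⟨l, hl, rfl⟩ := ih hr' hq₂ h₂
      exact ⟨(true, ⟨lhs, rhs, φ, hφ⟩) :: l, .cons ⟨rfl, rfl, rfl, h₃⟩ hl, rfl⟩
    | false =>
      -- The premise of an unselected rule is ⊥ → g, so two implications have to be taken apart to
      -- reach g.
      have hb' : Balanced ([.lpar, .imp] ++ ([.lpar, .bot, .rpar] ++
          (rename (rulePrefix i) (TextRule.guardText ⟨false, lhs, rhs, guard⟩) ++ [.rpar]))) :=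
        (((neutral_singleton (t := .imp) nofun nofun).append
          (Balanced.neutral ⟨[.bot, .rpar], rfl, rfl⟩)).append hb.neutral).balanced
      obtain ⟨ψ₁, ψ₂, hq₁, hq₂, rfl, h₁, h₂⟩ := eq_imp_of_encodeFormula_eq c hψ hb'
        (by simpa [chainText, Scan.ruleOut, guardPrefix, guardSuffix] using h)
      obtain ⟨ψ₃, ψ₄, hq₃, hq₄, rfl, h₃, h₄⟩ := eq_imp_of_encodeFormula_eq c hq₁
        ⟨[.bot, .rpar], rfl, rfl⟩ h₁
      obtain rfl := eq_falsum_of_encodeFormula_eq c h₃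
      obtain ⟨φ, hφ, h₅, rfl⟩ := exists_of_rename_eq_encodeFormula c hq₄ h₄.symm
      obtain ⟨l, hl, rfl⟩ := ih hr' hq₂ h₂
      exact ⟨(false, ⟨lhs, rhs, φ, hφ⟩) :: l, .cons ⟨rfl, rfl, rfl, h₅⟩ hl, rfl⟩

/-- The chain fails iff all its premises hold. The premises of unselected rules hold trivially, so
only the selected guards impose a condition. -/
theorem not_realize_chainFormula {D : Type w} [L.Structure D] (i : ℕ)
    (l : List (Bool × Production L)) (x : Ident ⊕ Ident → D) :
    ¬ (chainFormula i l).Realize x ↔ ∀ (j : ℕ) (r : Production L), l[j]? = some (true, r) →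
      r.guard.Realize (x ∘ renameAtom (rulePrefix (i + j))) := by
  induction l generalizing i with
  | nil => exact iff_of_true id (by simp)
  | cons q l ih =>
    change ¬ ((premise i q).Realize x → (chainFormula (i + 1) l).Realize x) ↔ _
    rw [Classical.not_imp, ih, ← Nat.and_forall_add_one (p := fun j => ∀ r, (q :: l)[j]? = _ → _)]
    refine and_congr ?_ (forall_congr' fun j => ?_)
    · obtain ⟨b, r⟩ := q
      cases b with
      | true =>
        rw [show premise i (true, r) = renameFormula (rulePrefix i) r.guard from rfl,
          realize_renameFormula]
        simp
      | false => exact iff_of_true (fun h => h.elim) (by simp)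
    · rw [List.getElem?_cons_succ, Nat.add_assoc, Nat.add_comm 1]

end Encoding

end ParametricGrammar

namespace ParametricGrammar

open FirstOrder FirstOrder.Language

/-! ### Productive nonterminals -/

/-- The nonterminals from which words can be derived by means of the rules `R`. -/
inductive Productive (R : Ident → List (Symbol (Ident ⊕ Ident) Ident) → Prop) : Ident → Prop
  | intro (A : Ident) (α : List (Symbol (Ident ⊕ Ident) Ident)) (h : R A α)
      (hα : ∀ B, .nonterminal B ∈ α → Productive R B) : Productive R A

theorem Productive.mono {R R' : Ident → List (Symbol (Ident ⊕ Ident) Ident) → Prop}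
    (h : ∀ A α, R A α → R' A α) {A : Ident} (hA : Productive R A) : Productive R' A := by
  induction hA with
  | intro A α hR _ ih => exact .intro A α (h _ _ hR) ih

section Derivations

variable {L : FirstOrder.Language.{u, v}} {D : Type w} [L.Structure D]

/-- The rules whose guard can be satisfied for the interpretation `X` of the parameters. -/
def Grammar.Enabled (G : Grammar L) (X : Ident → D) (A : Ident)
    (α : List (Symbol (Ident ⊕ Ident) Ident)) : Prop :=
  ∃ r ∈ G.productions, r.lhs = A ∧ r.rhs = α ∧ ∃ Y : Ident → D, r.guard.Realize (Sum.elim X Y)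

/-- By induction from the end of the derivation: a word contains no nonterminal, and the nonterminal
replaced in a step is productive because those of the right-hand side occur in the next sentential
form. -/
theorem Grammar.productive_of_derives (G : Grammar L) (X : Ident → D)
    {s : List (Symbol D Ident)} {word : List D}
    (h : Relation.ReflTransGen (G.Produces X) s (word.map Symbol.terminal)) {B : Ident}
    (hB : .nonterminal B ∈ s) : Productive (G.Enabled X) B := by
  induction h using Relation.ReflTransGen.head_induction_on generalizing B with
  | refl => simp at hB
  | head h _ ih =>
    obtain ⟨r, hr, Y, hY, h⟩ := h
    obtain ⟨p, q, rfl, rfl⟩ := h.exists_parts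
    simp only [List.append_assoc, List.mem_append, List.mem_singleton] at hB ih
    rcases hB with hB | hB | hB
    · exact ih (.inl hB)
    · obtain rfl : B = r.lhs := Symbol.nonterminal.inj hB
      refine .intro _ r.rhs ⟨r, hr, rfl, rfl, Y, hY⟩ fun B hB => ih (.inr (.inl ?_))
      exact List.mem_map.2 ⟨_, hB, rfl⟩
    · exact ih (.inr (.inr hB))

theorem Grammar.derives_append (G : Grammar L) (X : Ident → D) {s t : List (Symbol D Ident)}
    (h : Relation.ReflTransGen (G.Produces X) s t) (p q : List (Symbol D Ident)) :
    Relation.ReflTransGen (G.Produces X) (p ++ (s ++ q)) (p ++ (t ++ q)) := by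
  refine h.lift (fun s => p ++ (s ++ q)) fun s t h => ?_
  obtain ⟨r, hr, Y, hY, h⟩ := h
  exact ⟨r, hr, Y, hY, (h.append_right q).append_left p⟩

/-- The symbols of a right-hand side are expanded independently and the results are concatenated.
The interpretation `Y` affects terminals only, so it need not be compatible with those used in the
subderivations. -/
theorem Grammar.exists_derives_map (G : Grammar L) (X Y : Ident → D)
    (α : List (Symbol (Ident ⊕ Ident) Ident))
    (h : ∀ B, .nonterminal B ∈ α → ∃ word : List D,
      Relation.ReflTransGen (G.Produces X) [.nonterminal B] (word.map Symbol.terminal)) :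
    ∃ word : List D, Relation.ReflTransGen (G.Produces X) (α.map (instSymbol X Y))
      (word.map Symbol.terminal) := by
  induction α with
  | nil => exact ⟨[], .refl⟩
  | cons y α ih =>
    obtain ⟨word, hw⟩ := ih fun B hB => h B (by simp [hB])
    obtain ⟨word', hw'⟩ : ∃ word' : List D, Relation.ReflTransGen (G.Produces X)
        [instSymbol X Y y] (word'.map Symbol.terminal) := by
      cases y with
      | terminal t => exact ⟨[Sum.elim X Y t], .refl⟩
      | nonterminal B => exact h B (by simp)
    refine ⟨word' ++ word, ?_⟩
    have h₁ := G.derives_append X hw' [] (α.map (instSymbol X Y))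
    have h₂ := G.derives_append X hw (word'.map Symbol.terminal) []
    simp only [List.append_nil, List.nil_append] at h₁ h₂
    rw [List.map_append]
    exact h₁.trans h₂

theorem Grammar.exists_derives (G : Grammar L) (X : Ident → D) {A : Ident}
    (h : Productive (G.Enabled X) A) : ∃ word : List D,
      Relation.ReflTransGen (G.Produces X) [.nonterminal A] (word.map Symbol.terminal) := by
  induction h with
  | intro A α hR _ ih =>
    obtain ⟨r, hr, rfl, rfl, Y, hY⟩ := hR
    obtain ⟨word, hw⟩ := G.exists_derives_map X Y r.rhs ih
    refine ⟨word, .head ⟨r, hr, Y, hY, ?_⟩ hw⟩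
    simpa [Production.inst] using ContextFreeRule.Rewrites.head (r := r.inst X Y) []

/-- The reduction to context-free productivity: the guards interact through the common `X` only. -/
theorem Grammar.language_nonempty_iff (G : Grammar L) :
    Set.Nonempty (G.language D : Set (List D)) ↔
      ∃ X : Ident → D, Productive (G.Enabled X) G.start := by
  constructor
  · rintro ⟨word, h⟩
    obtain ⟨X, h⟩ := Set.mem_iUnion.1 h
    exact ⟨X, G.productive_of_derives X h (by simp)⟩
  · rintro ⟨X, h⟩
    obtain ⟨word, h⟩ := G.exists_derives X h
    exact ⟨word, Set.mem_iUnion.2 ⟨X, h⟩⟩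

end Derivations

/-! ### Correctness of the scans -/

/-- The selected rules. -/
def Selected (rs : List TextRule) (A : Ident) (α : List (Symbol (Ident ⊕ Ident) Ident)) : Prop :=
  ∃ r ∈ rs, r.sel = true ∧ r.lhs = A ∧ r.rhs = α

theorem symbolOk_all_iff {p : List (List Bool)} {α : List (Symbol (Ident ⊕ Ident) Ident)} :
    α.all (Scan.symbolOk p) = true ↔ ∀ B, .nonterminal B ∈ α → B.reverse ∈ p := by
  rw [List.all_eq_true]
  refine ⟨fun h B hB => of_decide_eq_true (h _ hB), fun h y hy => ?_⟩
  cases y with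
  | terminal t => rfl
  | nonterminal B => exact decide_eq_true (h B hy)

theorem subset_foldl_prodStep (rs : List TextRule) (p : List (List Bool)) :
    p ⊆ rs.foldl Scan.prodStep p := by
  induction rs generalizing p with
  | nil => simp
  | cons r rs ih =>
    refine List.Subset.trans ?_ (ih _)
    rw [Scan.prodStep]
    split <;> simp

/-- The list never shrinks during a pass, so what was known at its beginning is still known when `r`
is reached and after `r` has been processed. -/
theorem mem_foldl_prodStep {rs : List TextRule} {p : List (List Bool)} {r : TextRule}
    (hr : r ∈ rs) (hs : r.sel = true) (h : ∀ B, .nonterminal B ∈ r.rhs → B.reverse ∈ p) :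
    r.lhs.reverse ∈ rs.foldl Scan.prodStep p := by
  obtain ⟨l, l', rfl⟩ := List.append_of_mem hr
  rw [List.foldl_append, List.foldl_cons]
  refine subset_foldl_prodStep l' _ ?_
  have : r.rhs.all (Scan.symbolOk (l.foldl Scan.prodStep p)) = true :=
    symbolOk_all_iff.2 fun B hB => subset_foldl_prodStep l p (h B hB)
  simp [Scan.prodStep, hs, this]

theorem productive_of_mem_foldl {R : Ident → List (Symbol (Ident ⊕ Ident) Ident) → Prop}
    {rs : List TextRule} (hR : ∀ r ∈ rs, r.sel = true → R r.lhs r.rhs) {p : List (List Bool)}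
    (hp : ∀ e ∈ p, Productive R e.reverse) :
    ∀ e ∈ rs.foldl Scan.prodStep p, Productive R e.reverse := by
  induction rs generalizing p with
  | nil => exact hp
  | cons r rs ih =>
    refine ih (fun r hr => hR r (by simp [hr])) ?_
    rw [Scan.prodStep]
    split
    · next h =>
      rw [Bool.and_eq_true, symbolOk_all_iff] at h
      rintro e (_ | ⟨_, he⟩)
      · rw [List.reverse_reverse]
        exact .intro _ _ (hR r (by simp) h.1) fun B hB => by simpa using hp _ (h.2 B hB)
      · exact hp e he
    · exact hp

theorem productive_of_mem_productiveList {rs : List TextRule} {n : ℕ} {A : Ident}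
    (h : A.reverse ∈ productiveList rs n) : Productive (Selected rs) A := by
  have : ∀ e ∈ productiveList rs n, Productive (Selected rs) e.reverse := by
    clear h
    induction n with
    | zero => simp [productiveList]
    | succ n ih =>
      rw [productiveList, Function.iterate_succ_apply']
      exact productive_of_mem_foldl (fun r hr hs => ⟨r, hr, hs, rfl, rfl⟩) ih
  simpa using this _ h

theorem productiveList_succ (rs : List TextRule) (n : ℕ) :
    productiveList rs (n + 1) = rs.foldl Scan.prodStep (productiveList rs n) := by
  rw [productiveList, Function.iterate_succ_apply', productiveList]

theorem productiveList_subset (rs : List TextRule) {m n : ℕ} (h : m ≤ n) :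
    productiveList rs m ⊆ productiveList rs n := by
  induction h with
  | refl => simp
  | step _ ih =>
    rw [productiveList_succ]
    exact List.Subset.trans ih (subset_foldl_prodStep rs _)

theorem foldl_prodStep_subset (rs : List TextRule) (p : List (List Bool)) :
    rs.foldl Scan.prodStep p ⊆ p ++ rs.map fun r => r.lhs.reverse := by
  induction rs generalizing p with
  | nil => simp
  | cons r rs ih =>
    refine List.Subset.trans (ih _) fun e he => ?_
    rw [Scan.prodStep] at he
    split at he <;> simp at he ⊢ <;> tauto

theorem productiveList_subset_map (rs : List TextRule) (n : ℕ) :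
    productiveList rs n ⊆ rs.map fun r => r.lhs.reverse := by
  induction n with
  | zero => simp [productiveList]
  | succ n ih =>
    rw [productiveList_succ]
    refine List.Subset.trans (foldl_prodStep_subset rs _) ?_
    exact List.append_subset.2 ⟨ih, List.Subset.refl _⟩

/-- Pigeonhole: otherwise each of the first `rs.length + 1` passes would add a new name, while every
name listed is the left-hand side of one of `rs.length` rules. Lists may contain repetitions, hence
the passage to `Finset`. -/
theorem exists_productiveList_succ_subset (rs : List TextRule) :
    ∃ n ≤ rs.length, productiveList rs (n + 1) ⊆ productiveList rs n := by
  by_contra! h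
  have hc : ∀ n ≤ rs.length + 1, n ≤ (productiveList rs n).toFinset.card := by
    intro n hn
    induction n with
    | zero => exact Nat.zero_le _
    | succ n ih =>
      refine (ih (by omega)).trans_lt (Finset.card_lt_card ⟨fun e he => ?_, fun h' => ?_⟩)
      · rw [List.mem_toFinset] at he ⊢
        exact productiveList_subset rs (Nat.le_succ n) he
      · exact h n (by omega) fun e he => by simpa using h' (List.mem_toFinset.2 he)
  have h₁ := hc _ le_rfl
  have h₂ : (productiveList rs (rs.length + 1)).toFinset.card ≤ rs.length := by
    refine (Finset.card_le_card (t := (rs.map fun r => r.lhs.reverse).toFinset)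
      fun e he => ?_).trans ((List.toFinset_card_le _).trans (by simp))
    rw [List.mem_toFinset] at he ⊢
    exact productiveList_subset_map rs _ he
  omega

/-- A stable list is closed under the selected rules: one more pass adds the left-hand side, and
stability puts it back into the list. By induction it contains every productive nonterminal. -/
theorem mem_productiveList_iff {rs : List TextRule} {n : ℕ} (hn : rs.length ≤ n) {A : Ident} :
    A.reverse ∈ productiveList rs n ↔ Productive (Selected rs) A := by
  refine ⟨productive_of_mem_productiveList, fun h => ?_⟩
  obtain ⟨m, hm, hs⟩ := exists_productiveList_succ_subset rs
  refine productiveList_subset rs (hm.trans hn) ?_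
  induction h with
  | intro A α hR _ ih =>
    obtain ⟨r, hr, hsel, rfl, rfl⟩ := hR
    refine hs ?_
    rw [productiveList_succ]
    exact mem_foldl_prodStep hr hsel ih

/-! ### Nonemptiness as satisfiability -/

section Nonemptiness

variable {L : FirstOrder.Language.{u, v}} (c : SymbolCoding L) {D : Type w} [L.Structure D]

theorem balanced_chainText (i : ℕ) {rs : List TextRule} (hr : ∀ r ∈ rs, Balanced r.guardText) :
    Balanced (chainText i rs) := by
  induction rs generalizing i with
  | nil => exact ⟨_, rfl, rfl⟩
  | cons r rs ih =>
    have hb := ((hr r (by simp)).rename (rulePrefix i)).neutral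
    have hi := (ih (i + 1) fun r h => hr r (by simp [h])).neutral
    have himp : Neutral [.imp] := neutral_singleton nofun nofun
    rw [chainText, Scan.ruleOut]
    cases r.sel with
    | true => simpa [guardPrefix, guardSuffix] using ((himp.append hb).append hi).balanced
    | false =>
      have hbot : Neutral [.lpar, .bot, .rpar] := Balanced.neutral ⟨_, rfl, rfl⟩
      simpa [guardPrefix, guardSuffix] using
        ((himp.append ((himp.append hbot).append hb).balanced.neutral).append hi).balanced

/-- The interpretation that agrees with `Y i` on the names with the prefix of the rule `i`. -/
def jointInterpretation (Y : ℕ → Ident → D) (y : Ident) : D :=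
  Y (y.takeWhile id).length (y.drop ((y.takeWhile id).length + 1))

/-- The prefix 1ⁱ0 is self-delimiting: the first `false` determines `i`, whatever `y` is. So the `Y
i` can be merged without conflict. -/
theorem jointInterpretation_rulePrefix (Y : ℕ → Ident → D) (i : ℕ) (y : Ident) :
    jointInterpretation Y (rulePrefix i ++ y) = Y i y := by
  have h : (rulePrefix i ++ y).takeWhile id = List.replicate i true := by
    rw [rulePrefix, List.append_assoc, List.takeWhile_append_of_pos (by simp)]
    simp
  rw [jointInterpretation, h, List.length_replicate]
  congr 1
  rw [List.drop_append_of_le_length (by simp [rulePrefix]), List.drop_of_length_le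
    (by simp [rulePrefix]), List.nil_append]

theorem map_fst_plain (w : List Tok) : (plain w).map Prod.fst = w := by
  rw [plain, List.map_map]
  exact List.map_id w

theorem encodeGrammar_eq (start : Ident) {rs : List TextRule} {l : List (Bool × Production L)}
    (h : List.Forall₂ (Represents c) rs l) :
    (grammarText start rs).map Prod.fst = encodeGrammar c ⟨start, l.map Prod.snd⟩ := by
  rw [grammarText, encodeGrammar, List.map_append, map_fst_plain]
  congr 1
  induction h with
  | nil => rfl
  | cons h _ ih =>
    rw [List.flatMap_cons, List.map_append, ih, List.map_cons, List.flatMap_cons]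
    congr 1
    rw [TextRule.text, encodeProduction, ← h.lhs, ← h.rhs, ← h.guard]
    simp [map_fst_plain, TextRule.guardText]

/-- The text of a production. -/
def textRule (q : Bool × Production L) : TextRule :=
  ⟨q.1, q.2.lhs, q.2.rhs, plain (encodeFormula c q.2.guard)⟩

theorem forall₂_represents_map (l : List (Bool × Production L)) :
    List.Forall₂ (Represents c) (l.map (textRule c)) l := by
  rw [List.forall₂_map_left_iff]
  exact List.forall₂_same.2 fun q _ => ⟨rfl, rfl, rfl, map_fst_plain _⟩

theorem selected_iff {rs : List TextRule} {l : List (Bool × Production L)}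
    (h : List.Forall₂ (Represents c) rs l) {A : Ident}
    {α : List (Symbol (Ident ⊕ Ident) Ident)} :
    Selected rs A α ↔ ∃ r, (true, r) ∈ l ∧ r.lhs = A ∧ r.rhs = α := by
  induction h with
  | nil => simp [Selected]
  | @cons r q rs l h _ ih =>
    obtain ⟨b, r'⟩ := q
    simp only [Selected, List.mem_cons, or_and_right, exists_or, exists_eq_left, Prod.mk.injEq]
      at ih ⊢
    rw [ih, h.sel, h.lhs, h.rhs]
    refine or_congr ⟨fun h => ⟨r', ⟨h.1.symm, rfl⟩, h.2⟩, ?_⟩ Iff.rfl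
    rintro ⟨_, ⟨hb, rfl⟩, h'⟩
    exact ⟨hb.symm, h'⟩

theorem reduction_eq_encodeFormula (start : Ident) {rs : List TextRule}
    {l : List (Bool × Production L)} (h : List.Forall₂ (Represents c) rs l)
    (hr : ∀ r ∈ rs, Balanced r.guardText) (hs : Productive (Selected rs) start) :
    reduction (grammarText start rs) =
      encodeFormula c (.imp (chainFormula 0 l) .falsum : GuardFormula L) := by
  have hn := length_le_length_grammarText start rs
  rw [reduction_grammarText start rs hr, if_pos ((mem_productiveList_iff (by omega)).2 hs),
    encodeFormula, encodeFormula_chainFormula c 0 h]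
  simp [encodeFormula]

/-- For a suitable `X`, exactly the rules whose guards are satisfiable under `X` are selected. Their
witnesses are merged by `jointInterpretation`. -/
theorem exists_reduction_mem {G : Grammar L} (h : Set.Nonempty (G.language D : Set (List D))) :
    ∃ a, a.map Prod.fst = encodeGrammar c G ∧ reduction a ∈ satProblem c D := by
  classical
  obtain ⟨X, hX⟩ := G.language_nonempty_iff.1 h
  let l : List (Bool × Production L) := G.productions.map fun r =>
    (decide (∃ Y : Ident → D, r.guard.Realize (Sum.elim X Y)), r)
  have hf := forall₂_represents_map c l
  have hs : Productive (Selected (l.map (textRule c))) G.start := by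
    refine hX.mono fun A α => ?_
    rintro ⟨r, hr, rfl, rfl, hY⟩
    exact (selected_iff c hf).2 ⟨r, List.mem_map.2 ⟨r, hr, by simp [hY]⟩, rfl, rfl⟩
  have hr : ∀ r ∈ l.map (textRule c), Balanced r.guardText := by
    intro r hr
    obtain ⟨q, _, rfl⟩ := List.mem_map.1 hr
    rw [TextRule.guardText, textRule, map_fst_plain]
    exact balanced_encodeFormula c q.2.guard
  refine ⟨grammarText G.start (l.map (textRule c)), ?_, ?_⟩
  · rw [encodeGrammar_eq c G.start hf]
    simp [l, Function.comp_def]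
  · have hY : ∀ j : ℕ, ∃ Y : Ident → D, ∀ r : Production L, l[j]? = some (true, r) →
        r.guard.Realize (Sum.elim X Y) := by
      intro j
      by_cases hj : ∃ r, l[j]? = some (true, r)
      · obtain ⟨r, hj⟩ := hj
        obtain ⟨r', _, hr'⟩ := List.mem_map.1 (List.mem_of_getElem? hj)
        injection hr' with h₁ h₂
        obtain ⟨Y, hY⟩ := of_decide_eq_true h₁
        refine ⟨Y, fun r'' hr'' => ?_⟩
        obtain rfl : r = r'' := by simpa [hj] using hr''
        rwa [← h₂]
      -- If `j` is not the index of a selected rule, any interpretation will do; `X` is at hand.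
      · exact ⟨X, fun r hr => absurd ⟨r, hr⟩ hj⟩
    choose Y hY using hY
    refine ⟨.imp (chainFormula 0 l) .falsum, .imp (isQF_chainFormula 0 l) .falsum,
      (reduction_eq_encodeFormula c G.start hf hr hs).symm, X, jointInterpretation Y, ?_⟩
    refine (not_realize_chainFormula 0 l _).2 fun j r hj => ?_
    convert hY j r hj using 1
    funext x
    cases x with
    | inl a => rfl
    | inr y => rw [Nat.zero_add]; exact jointInterpretation_rulePrefix Y j y

/-- The shape of the text comes from the scan, the well-formedness of the guards from the formula. A
model of the formula satisfies all selected guards, so the selected rules are enabled and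
productivity carries over to them. -/
theorem mem_nonemptinessProblem_of_reduction_mem {a : List (Tok × Bool)}
    (h : reduction a ∈ satProblem c D) : a.map Prod.fst ∈ nonemptinessProblem c D := by
  obtain ⟨ψ, hψ, hψ', X, Y, hXY⟩ := h
  -- Encodings begin with a parenthesis, so the empty word, which signals failure, is never one.
  have hne : reduction a ≠ [] := by
    obtain ⟨g, hg, -⟩ := balanced_encodeFormula c ψ
    rw [← hψ', hg]
    exact List.cons_ne_nil _ _
  obtain ⟨st, rs, hr, ha⟩ := exists_grammarText a hne
  have hn := length_le_length_grammarText st rs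
  rw [← reduction_map_clean, ha, reduction_grammarText st rs hr] at hψ' hne
  have hm : st.reverse ∈ productiveList rs ((grammarText st rs).length - 1) := by
    by_contra hm
    exact hne (if_neg hm)
  have hs : Productive (Selected rs) st := productive_of_mem_productiveList hm
  rw [if_pos hm] at hψ'
  obtain ⟨ψ₁, ψ₂, hq₁, -, rfl, h₁, h₂⟩ := eq_imp_of_encodeFormula_eq c hψ
    (v := [.lpar, .bot, .rpar]) (balanced_chainText 0 hr) (by simpa using hψ')
  obtain rfl := eq_falsum_of_encodeFormula_eq c h₂
  obtain ⟨l, hl, rfl⟩ := exists_of_encodeFormula_eq_chainText c hr hq₁ h₁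
  have hx : a.map Prod.fst = encodeGrammar c ⟨st, l.map Prod.snd⟩ := by
    rw [← encodeGrammar_eq c st hl, ← ha, List.map_map]
    rfl
  refine ⟨⟨st, l.map Prod.snd⟩, hx.symm, ?_⟩
  refine (Grammar.language_nonempty_iff _).2 ⟨X, hs.mono fun A α hA => ?_⟩
  obtain ⟨r, hr, rfl, rfl⟩ := (selected_iff c hl).1 hA
  refine ⟨r, List.mem_map.2 ⟨_, hr, rfl⟩, rfl, rfl, ?_⟩
  obtain ⟨j, hj⟩ := List.mem_iff_getElem?.1 hr
  -- The local variables of rule `j` take the values that the model gives to their renamed copies.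
  refine ⟨fun y => Y (rulePrefix j ++ y), ?_⟩
  convert (not_realize_chainFormula 0 l _).1 hXY j r hj using 1
  funext x
  cases x with
  | inl a => rfl
  | inr y => rw [Nat.zero_add]; rfl

theorem mem_nonemptinessProblem_iff {x : List Tok} :
    x ∈ nonemptinessProblem c D ↔ ∃ a, a.map Prod.fst = x ∧ reduction a ∈ satProblem c D := by
  constructor
  · rintro ⟨G, rfl, h⟩
    exact exists_reduction_mem c h
  · rintro ⟨a, rfl, h⟩
    exact mem_nonemptinessProblem_of_reduction_mem c h

end Nonemptiness

end ParametricGrammar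

namespace StackProgram

open Turing TM2 Function

/-! ### Machines and programs -/

section Single

variable {K : Type} {Γ : K → Type} [DecidableEq K]

/-- The stacks are empty except one. -/
def single (k : K) (l : List (Γ k)) : ∀ k, List (Γ k) := update (fun _ => []) k l

theorem dite_eq_single (k₀ : K) (s : List (Γ k₀)) (d : ∀ k, Decidable (k = k₀)) :
    (fun k => @dite (List (Γ k)) (k = k₀) (d k) (fun h => by rw [h]; exact s) fun _ => []) =
      single k₀ s := by
  funext k
  by_cases h : k = k₀
  · subst h
    simp [single]
  · simp [single, h]

end Single

/-- The program of a machine. -/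
def machineProgram (tm : FinTM2) : Program tm.Γ tm.σ :=
  @Program.mk _ _ _ tm.Λ tm.ΛFin tm.main tm.m

theorem initList_eq (tm : FinTM2) (s : List (tm.Γ tm.k₀)) :
    initList tm s = ⟨some tm.main, tm.initialState, single tm.k₀ s⟩ :=
  congrArg (Cfg.mk _ _) (dite_eq_single tm.k₀ s fun k => tm.kDecidableEq k tm.k₀)

theorem haltList_eq (tm : FinTM2) (s : List (tm.Γ tm.k₁)) :
    haltList tm s = ⟨none, tm.initialState, single tm.k₁ s⟩ :=
  congrArg (Cfg.mk _ _) (dite_eq_single tm.k₁ s fun k => tm.kDecidableEq k tm.k₁)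

attribute [local instance] FinTM2.kFin

theorem machineProgram_runs_of_outputsInTime {tm : FinTM2} {l : List (tm.Γ tm.k₀)}
    {l' : List (tm.Γ tm.k₁)} {t : ℕ} (h : TM2OutputsInTime tm l (some l') t) :
    (machineProgram tm).Runs (tm.initialState, single tm.k₀ l) t ⊤
      (tm.initialState, single tm.k₁ l') := by
  refine ⟨h.steps, h.steps_le_m, Path.of_iterate_eq (fun _ _ => le_top) ?_⟩
  exact (congrArg (fun c => (flip bind tm.step)^[h.steps] (some c)) (initList_eq tm l)).symm.trans
    (h.evals_in_steps.trans (congrArg some (haltList_eq tm l')))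

theorem machineProgram_runs_of_outputs {tm : FinTM2} {l : List (tm.Γ tm.k₀)}
    {l' : List (tm.Γ tm.k₁)} {m : ℕ} (h : TM2Outputs tm l (some l'))
    (hm : ∀ c, StateTransition.Reaches tm.step (initList tm l) c → Complexity.cfgSpace tm c ≤ m) :
    ∃ t, (machineProgram tm).Runs (tm.initialState, single tm.k₀ l) t m
      (tm.initialState, single tm.k₁ l') := by
  refine ⟨h.steps, h.steps, le_rfl, Path.of_iterate_eq (fun c hc => ?_) ?_⟩
  · rw [initList_eq] at hm
    exact_mod_cast hm c hc
  · exact (congrArg (fun c => (flip bind tm.step)^[h.steps] (some c))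
      (initList_eq tm l)).symm.trans (h.evals_in_steps.trans (congrArg some (haltList_eq tm l')))

section Machine

variable {K : Type} [DecidableEq K] [Fintype K] {Γ : K → Type} {σ : Type} [Fintype σ]

/-- The machine that runs a program. -/
def machine (P : Program Γ σ) (v : σ) (k₀ k₁ : K) [Fintype (Γ k₀)] : FinTM2 where
  k₀ := k₀
  k₁ := k₁
  Γ := Γ
  Λ := P.Label
  main := P.entry
  σ := σ
  initialState := v
  m := P.code

variable {P : Program Γ σ} {v : σ} {k₀ k₁ : K} [Fintype (Γ k₀)] {l : List (Γ k₀)}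
  {l' : List (Γ k₁)} {t : ℕ} {m : ℕ∞}

theorem machine_outputsInTime (h : P.Runs (v, single k₀ l) t m (v, single k₁ l')) :
    Nonempty (TM2OutputsInTime (machine P v k₀ k₁) l (some l') t) := by
  obtain ⟨n, hn, h⟩ := h
  exact ⟨⟨⟨n, (congrArg (fun c => (flip bind (machine P v k₀ k₁).step)^[n] (some c))
    (initList_eq (machine P v k₀ k₁) l)).trans
    (h.iterate_eq.trans (congrArg some (haltList_eq (machine P v k₀ k₁) l')).symm)⟩, hn⟩⟩

theorem machine_cfgSpace_le (h : P.Runs (v, single k₀ l) t m (v, single k₁ l'))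
    {c : (machine P v k₀ k₁).Cfg}
    (hc : StateTransition.Reaches (machine P v k₀ k₁).step (initList (machine P v k₀ k₁) l) c) :
    (Complexity.cfgSpace (machine P v k₀ k₁) c : ℕ∞) ≤ m := by
  obtain ⟨n, hn, h⟩ := h
  exact h.reaches_height_le (Eq.mp (congrArg (fun d => StateTransition.Reaches _ d c)
    (initList_eq (machine P v k₀ k₁) l)) hc)

end Machine

/-! ### Communication between two programs -/

section Transfer

variable {K K' : Type} [DecidableEq K] [DecidableEq K'] {Γ : K → Type} {Γ' : K' → Type}
  {τ σ' : Type}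

/-- Move the contents of a stack of the left part to a stack of the right part. -/
def transfer (k : K) (d : Γ k) (k' : K') (g : Γ k → Γ' k') :
    Program (Sum.elim Γ Γ') (RegState Γ τ × σ') :=
  .forEach (.inl k) (fun v a => (setPopped k v.1 a, v.2)) (fun v => (popped k v.1).isSome) <|
    .ofStmt <| .push (.inr k') (fun v => g ((popped k v.1).getD d)) <|
      .load (fun v => ((none, v.1.2), v.2)) .halt

/-- Pop a symbol from a stack of the right part and process it in the left part. -/
def fetch (k' : K') (f : Option (Γ' k') → τ → τ) :
    Program (Sum.elim Γ Γ') (RegState Γ τ × σ') :=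
  .ofStmt <| .pop (.inr k') (fun v a => ((v.1.1, f a v.1.2), v.2)) .halt

/-- The body of the loop runs only after a successful pop, so the default `d` is never used. -/
theorem stepAux_transfer (k : K) (d : Γ k) (k' : K') (g : Γ k → Γ' k') (v : τ) (r : σ')
    (S : ∀ k, List (Γ k)) (S' : ∀ k, List (Γ' k)) (a : Γ k) :
    stepAux (.push (.inr k') (fun v => g ((popped k v.1).getD d)) <|
        .load (fun v => ((none, v.1.2), v.2)) .halt : Stmt (Sum.elim Γ Γ') Unit _)
      ((setPopped k (none, v) (some a), r) : RegState Γ τ × σ') (Program.join S S') =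
      ⟨none, ((none, v), r), Program.join S (update S' k' (g a :: S' k'))⟩ := by
  have ha : popped k (setPopped k ((none, v) : RegState Γ τ) (some a)) = some a :=
    popped_setPopped ..
  have hg : g ((popped k (setPopped k ((none, v) : RegState Γ τ) (some a))).getD d) = g a := by
    rw [ha, Option.getD_some]
  rw [← Program.update_join_inr, ← hg]
  rfl

variable [Fintype K] [Fintype K']

theorem runs_transfer (k : K) (d : Γ k) (k' : K') (g : Γ k → Γ' k') (v : τ) (r : σ')
    (S : ∀ k, List (Γ k)) (S' : ∀ k, List (Γ' k)) :
    (transfer k d k' g).Runs (((none, v), r), Program.join S S') ((S k).length * 2 + 1) ⊤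
      (((none, v), r), Program.join (update S k [])
        (update S' k' ((S k).reverse.map g ++ S' k'))) := by
  have h := Program.Runs.forEach (k := (Sum.inl k : K ⊕ K')) (Γ := Sum.elim Γ Γ')
    (set := fun (v : RegState Γ τ × σ') a => (setPopped k v.1 a, v.2))
    (b := fun v => (popped k v.1).isSome)
    (P := .ofStmt <| .push (.inr k') (fun v => g ((popped k v.1).getD d)) <|
      .load (fun v => ((none, v.1.2), v.2)) .halt)
    (fun (x : List (Γ' k')) (l : List (Γ k)) =>
      (((none, v), r), Program.join (update S k l) (update S' k' x)))
    (fun x a => g a :: x) (fun _ _ => True) (T := 1)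
    (fun (x : List (Γ' k')) (l : List (Γ k)) =>
      show update S k l k = l from update_self k l S)
    (fun (x : List (Γ' k')) (a : Γ k) (l : List (Γ k)) =>
      (Program.update_join_inl (update S k (a :: l)) (update S' k' x) k l).trans
        (congrArg (fun T => Program.join T (update S' k' x)) (update_idem ..)))
    (fun _ _ _ => rfl)
    (fun v (a : Option (Γ k)) => congrArg Option.isSome (popped_setPopped k v.1 a))
    (fun _ _ _ _ => trivial)
    (fun x a l _ => .ofStmt ?_) (S' k') (S k) trivial
  · have hf : ∀ (l : List (Γ k)) x, l.foldl (fun x a => g a :: x) x = l.reverse.map g ++ x := by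
      intro l
      induction l with
      | nil => simp
      | cons a l ih => simp [ih]
    rw [← hf]
    simp only [update_eq_self] at h
    exact h
  · refine (stepAux_transfer k d k' g v r (update S k l) (update S' k' x) a).trans ?_
    have hx : update (update S' k' x) k' (g a :: update S' k' x k') = update S' k' (g a :: x) :=
      (update_idem ..).trans (congrArg (fun l => update S' k' (g a :: l)) (update_self ..))
    exact congrArg (fun T => (⟨none, ((none, v), r), Program.join (update S k l) T⟩ : Cfg _ _ _)) hx

theorem runs_fetch (k' : K') (f : Option (Γ' k') → τ → τ) (v : τ) (r : σ')
    (S : ∀ k, List (Γ k)) (S' : ∀ k, List (Γ' k)) :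
    (fetch k' f).Runs (((none, v), r), Program.join S S') 1 ⊤
      (((none, f (S' k').head? v), r), Program.join S (update S' k' (S' k').tail)) := by
  refine .ofStmt ?_
  exact congrArg (fun S => (⟨none, ((none, f (S' k').head? v), r), S⟩ : Cfg _ _ _))
    (Program.update_join_inr ..)

end Transfer

end StackProgram

/-! ### Polynomial bounds -/

/-- A function with a polynomial upper bound. -/
def PolyBounded (f : ℕ → ℕ) : Prop := ∃ p : Polynomial ℕ, ∀ n, f n ≤ p.eval n

/-- The coefficients are natural numbers, so each monomial is monotone. -/
theorem Polynomial.eval_mono_nat (p : Polynomial ℕ) : Monotone fun n => p.eval n := by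
  intro m n h
  simp only [Polynomial.eval_eq_sum, Polynomial.sum]
  gcongr

namespace PolyBounded

variable {f g : ℕ → ℕ}

theorem const (c : ℕ) : PolyBounded fun _ => c := ⟨.C c, fun n => by simp⟩

theorem id : PolyBounded fun n => n := ⟨.X, fun n => by simp⟩

theorem add (hf : PolyBounded f) (hg : PolyBounded g) : PolyBounded fun n => f n + g n := by
  obtain ⟨p, hp⟩ := hf
  obtain ⟨q, hq⟩ := hg
  exact ⟨p + q, fun n => by simpa using Nat.add_le_add (hp n) (hq n)⟩

theorem mul (hf : PolyBounded f) (hg : PolyBounded g) : PolyBounded fun n => f n * g n := by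
  obtain ⟨p, hp⟩ := hf
  obtain ⟨q, hq⟩ := hg
  exact ⟨p * q, fun n => by simpa using Nat.mul_le_mul (hp n) (hq n)⟩

theorem eval_comp (p : Polynomial ℕ) (hf : PolyBounded f) : PolyBounded fun n => p.eval (f n) := by
  obtain ⟨q, hq⟩ := hf
  exact ⟨p.comp q, fun n => by simpa using p.eval_mono_nat (hq n)⟩

end PolyBounded

/-! ### Length of the reduction and time for computing it. -/

namespace ParametricGrammar

theorem polyBounded_outBound : PolyBounded outBound :=
  .add (.const 2) (.mul .id (.add (.add (.mul .id .id) .id) (.const 7)))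

theorem polyBounded_reduceTime : PolyBounded reduceTime := by
  unfold reduceTime passTime
  repeat' first
    | exact PolyBounded.const _
    | exact PolyBounded.id
    | exact polyBounded_outBound
    | apply PolyBounded.add
    | apply PolyBounded.mul

/-- An upper bound for the length of the reduction. -/
def reductionBound (n : ℕ) : ℕ := outBound n + n * n + 7

theorem length_reduction_le (a : List (Tok × Bool)) :
    (reduction a).length ≤ reductionBound a.length := by
  have h₁ := length_out_finalScan a
  have h₂ : (finalScan a).weight ≤ a.length * a.length := Scan.weight_iterate_pass a _
  have h₃ : (finalScan a).idx ≤ (finalScan a).weight := Nat.le_add_left _ _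
  unfold reductionBound
  simp only [reduction]
  split_ifs
  -- The closing text has length `idx + 7`, where `idx` is bounded by the weight.
  · simp only [closing, List.length_append, List.length_reverse, List.length_replicate,
      List.length_cons, List.length_nil]
    omega
  · simp

theorem polyBounded_reductionBound : PolyBounded reductionBound :=
  .add (.add polyBounded_outBound (.mul .id .id)) (.const 7)

theorem reductionBound_mono : Monotone reductionBound := by
  intro m n h
  unfold reductionBound outBound
  gcongr

theorem reduceTime_mono : Monotone reduceTime := by
  intro m n h
  unfold reduceTime passTime outBound
  gcongr

end ParametricGrammar

namespace ParametricGrammar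

open Turing TM2 Function StackProgram RegProgram

/-! ### Unary arithmetic -/

/-- The stacks for unary arithmetic. -/
def unaryStacks (S : Stacks) (n d e e' : ℕ) : Stacks
  | .cnt => List.replicate n ()
  | .depth => List.replicate d ()
  | .idx => List.replicate e ()
  | .idx' => List.replicate e' ()
  | k => S k

/-- Add `cnt` to `idx`. -/
noncomputable def addCount : Prog :=
  (forAll .cnt fun _ => (push .idx ()).seq (push .idx' ())).seq <|
    forAll .idx' fun _ => push .cnt ()

theorem replicate_unit (l : List Unit) : List.replicate l.length () = l :=
  (List.eq_replicate_of_mem fun _ _ => rfl).symm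

theorem does_addCount (v : Vars) (S : Stacks) (n d e : ℕ) :
    addCount.Does (v, unaryStacks S n d e 0) (n * 9 + 2) (v, unaryStacks S n d (e + n) 0) := by
  have h := Does.forAll (Γ := StkAlphabet) (τ := Vars) (k := Stk.cnt) (T := 2)
    (P := fun _ => (push .idx ()).seq (push .idx' ()))
    (fun (x : ℕ) (l : List Unit) => (v, unaryStacks S l.length d (e + x) x))
    (fun x _ => x + 1) (fun _ _ => True)
    (fun x l => replicate_unit l) (fun x a l => funext fun k => by
      cases k <;> first | rfl | exact (replicate_unit l).symm)
    (fun _ _ _ => rfl) (fun _ _ _ _ => trivial)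
    (fun x a l _ => ((Does.push _ _ _).seq (Does.push _ _ _)).congr
      (Prod.ext rfl (funext fun k => by cases k <;> rfl)) le_rfl)
    0 (List.replicate n ()) trivial
  have hf : ∀ n x : ℕ, (List.replicate n ()).foldl (fun x _ => x + 1) x = x + n := by
    intro n
    induction n with
    | zero => simp
    | succ n ih => intro x; rw [List.replicate_succ, List.foldl_cons, ih]; omega
  rw [hf, List.length_replicate, Nat.zero_add] at h
  refine (h.seq (Does.move (Γ := StkAlphabet) (k := Stk.idx') (k' := Stk.cnt) (by decide)
    (fun _ => ()) _)).congr (Prod.ext rfl (funext fun k => ?_)) ?_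
  · cases k <;> try rfl
    simp [unaryStacks]
  · change n * 5 + 1 + ((List.replicate n ()).length * 4 + 1) ≤ _
    rw [List.length_replicate]
    omega

/-- Multiply `depth` by `cnt`. -/
noncomputable def mulCount : Prog :=
  (forAll .depth fun _ => addCount).seq <| forAll .idx fun _ => push .depth ()

theorem does_mulCount (v : Vars) (S : Stacks) (n d : ℕ) :
    mulCount.Does (v, unaryStacks S n d 0 0) (d * (n * 13 + 5) + 2)
      (v, unaryStacks S n (d * n) 0 0) := by
  have h := Does.forAll (Γ := StkAlphabet) (τ := Vars) (k := Stk.depth) (T := n * 9 + 2)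
    (P := fun _ => addCount)
    (fun (x : ℕ) (l : List Unit) => (v, unaryStacks S n l.length x 0))
    (fun x _ => x + n) (fun _ _ => True)
    (fun x l => replicate_unit l) (fun x a l => funext fun k => by
      cases k <;> first | rfl | exact (replicate_unit l).symm)
    (fun _ _ _ => rfl) (fun _ _ _ _ => trivial)
    (fun x a l _ => does_addCount v S n l.length x)
    0 (List.replicate d ()) trivial
  have hf : ∀ d x : ℕ, (List.replicate d ()).foldl (fun x _ => x + n) x = x + d * n := by
    intro d
    induction d with
    | zero => simp
    | succ n ih => intro x; rw [List.replicate_succ, List.foldl_cons, ih]; ring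
  rw [hf, List.length_replicate, Nat.zero_add] at h
  refine (h.seq (Does.move (Γ := StkAlphabet) (k := Stk.idx) (k' := Stk.depth) (by decide)
    (fun _ => ()) _)).congr (Prod.ext rfl (funext fun k => ?_)) ?_
  · cases k <;> try rfl
    simp [unaryStacks]
  · change d * (n * 9 + 2 + 3) + 1 + ((List.replicate (d * n) ()).length * 4 + 1) ≤ _
    rw [List.length_replicate]
    apply le_of_eq
    ring

/-- A polynomial can be evaluated in unary. -/
theorem exists_evalPolynomial (q : Polynomial ℕ) :
    ∃ (P : Prog) (p : Polynomial ℕ), ∀ (v : Vars) (S : Stacks) (n : ℕ),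
      P.Does (v, unaryStacks S n 0 0 0) (p.eval n) (v, unaryStacks S n (q.eval n) 0 0) := by
  -- By Horner's scheme only two operations are needed: adding a constant, and multiplying by the
  -- argument, which stays on `cnt`.
  induction q using Polynomial.recOnHorner with
  | M0 => exact ⟨skip, 1, fun v S n => by simpa using Does.skip (v, unaryStacks S n 0 0 0)⟩
  | MC q a _ _ ih =>
    obtain ⟨P, p, h⟩ := ih
    refine ⟨P.seq (pushList .depth (List.replicate a ())), p + .C (a + 1), fun v S n => ?_⟩
    refine ((h v S n).seq (Does.pushList _ _ _)).congr (Prod.ext rfl (funext fun k => ?_)) ?_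
    · cases k <;> try rfl
      simp [unaryStacks, Nat.add_comm]
    · simp
  | MX q _ ih =>
    obtain ⟨P, p, h⟩ := ih
    refine ⟨P.seq mulCount, p + (q * (.X * 13 + 5) + 2), fun v S n => ?_⟩
    refine ((h v S n).seq (does_mulCount v S n _)).congr ?_ ?_
    · simp
    · simp

/-! ### The verifier -/

/-- The stacks of the verifier. -/
def verifierStacks (inp : List (Tok ⊕ Bool)) (word : List Tok) (ann : List (Tok × Bool))
    (cert cert' : List Bool) (out : List Tok) : Stacks
  | .inp => inp
  | .word => word
  | .ann => ann
  | .cert => cert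
  | .cert' => cert'
  | .out => out
  | _ => []

/-- The tokens of an input of the verifier. -/
def tokens (z : List (Tok ⊕ Bool)) : List Tok := z.filterMap Sum.getLeft?

/-- The certificate in an input of the verifier. -/
def bits (z : List (Tok ⊕ Bool)) : List Bool := z.filterMap Sum.getRight?

/-- Sort a symbol of the input. -/
noncomputable def sortSymbol : Tok ⊕ Bool → Prog
  | .inl t => push .word t
  | .inr b => push .cert' b

/-- Separate the input from the certificate. -/
noncomputable def splitInput : Prog :=
  (forAll .inp sortSymbol).seq <| forAll .cert' fun b => push .cert b

theorem length_tokens_le (z : List (Tok ⊕ Bool)) : (tokens z).length ≤ z.length :=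
  List.length_filterMap_le _ _

theorem length_bits_le (z : List (Tok ⊕ Bool)) : (bits z).length ≤ z.length :=
  List.length_filterMap_le _ _

theorem does_splitInput (z : List (Tok ⊕ Bool)) :
    splitInput.Does ({}, verifierStacks z [] [] [] [] []) (z.length * 8 + 2)
      ({}, verifierStacks [] (tokens z).reverse [] (bits z) [] []) := by
  have h := Does.forAll (Γ := StkAlphabet) (τ := Vars) (k := Stk.inp) (T := 1)
    (P := sortSymbol)
    (fun (x : List Tok × List Bool) l => ({}, verifierStacks l x.1 [] [] x.2 []))
    (fun x s => s.elim (fun t => (t :: x.1, x.2)) fun b => (x.1, b :: x.2)) (fun _ _ => True)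
    (fun _ _ => rfl) (fun x a l => funext fun k => by cases k <;> rfl) (fun _ _ _ => rfl)
    (fun _ _ _ _ => trivial)
    (fun x s l _ => by
      cases s with
      | inl t =>
        exact (Does.push (Γ := StkAlphabet) Stk.word t _).congr
          (Prod.ext rfl (funext fun k => by cases k <;> rfl)) le_rfl
      | inr b =>
        exact (Does.push (Γ := StkAlphabet) Stk.cert' b _).congr
          (Prod.ext rfl (funext fun k => by cases k <;> rfl)) le_rfl)
    ([], []) z trivial
  have hf : ∀ (z : List (Tok ⊕ Bool)) (x : List Tok × List Bool),
      z.foldl (fun x s => s.elim (fun t => (t :: x.1, x.2)) fun b => (x.1, b :: x.2)) x =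
        ((tokens z).reverse ++ x.1, (bits z).reverse ++ x.2) := by
    intro z
    induction z with
    | nil => intro x; rfl
    | cons s z ih =>
      intro x
      rw [List.foldl_cons, ih]
      cases s <;> simp [tokens, bits, List.filterMap_cons]
  rw [hf] at h
  refine (h.seq (Does.move (Γ := StkAlphabet) (k := Stk.cert') (k' := Stk.cert) (by decide) id
    _)).congr (Prod.ext rfl (funext fun k => ?_)) ?_
  · cases k <;> try rfl
    all_goals simp [verifierStacks]
  · change _ + (((bits z).reverse ++ []).length * 4 + 1) ≤ _
    have := length_bits_le z
    simp
    omega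

/-- Mark tokens by means of some bits. -/
def attachStep (x : List (Tok × Bool) × List Bool) (t : Tok) : List (Tok × Bool) × List Bool :=
  ((t, x.2.head?.getD false) :: x.1, x.2.tail)

/-- The tokens of an input of the verifier, marked by means of the certificate, and the remaining
certificate. -/
def attachBits (z : List (Tok ⊕ Bool)) : List (Tok × Bool) × List Bool :=
  (tokens z).reverse.foldl attachStep ([], bits z)

theorem foldl_attachStep (l : List Tok) (x : List (Tok × Bool) × List Bool) :
    (l.foldl attachStep x).1.map Prod.fst = l.reverse ++ x.1.map Prod.fst ∧
      (l.foldl attachStep x).2.length ≤ x.2.length := by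
  induction l generalizing x with
  | nil => simp
  | cons t l ih =>
    obtain ⟨h₁, h₂⟩ := ih (attachStep x t)
    rw [List.foldl_cons, h₁]
    refine ⟨by simp [attachStep], h₂.trans ?_⟩
    simp [attachStep]

theorem map_fst_attachBits (z : List (Tok ⊕ Bool)) :
    (attachBits z).1.map Prod.fst = tokens z := by
  rw [attachBits]
  simpa only [List.reverse_reverse, List.map_nil, List.append_nil] using
    (foldl_attachStep (tokens z).reverse ([], bits z)).1

theorem length_attachBits_fst_le (z : List (Tok ⊕ Bool)) :
    (attachBits z).1.length ≤ z.length := by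
  have := congrArg List.length (map_fst_attachBits z)
  rw [List.length_map] at this
  exact this.trans_le (length_tokens_le z)

theorem length_attachBits_snd_le (z : List (Tok ⊕ Bool)) :
    (attachBits z).2.length ≤ z.length :=
  (foldl_attachStep (tokens z).reverse ([], bits z)).2.trans (length_bits_le z)

theorem tokens_withCertificate (x : List Tok) (w : List Bool) :
    tokens (Complexity.withCertificate x w) = x := by
  simp [tokens, Complexity.withCertificate, List.filterMap_append, List.filterMap_map,
    Function.comp_def]

theorem bits_withCertificate (x : List Tok) (w : List Bool) :
    bits (Complexity.withCertificate x w) = w := by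
  simp [bits, Complexity.withCertificate, List.filterMap_append, List.filterMap_map,
    Function.comp_def]

/-- Splitting the input leaves the last token on top of `word`, so the first bit of the certificate
marks the last token. Hence the marks have to be supplied in reverse. -/
theorem attachBits_withCertificate (a : List (Tok × Bool)) (w : List Bool) :
    attachBits (Complexity.withCertificate (a.map Prod.fst) ((a.map Prod.snd).reverse ++ w)) =
      (a, w) := by
  have h : ∀ l acc : List (Tok × Bool), (l.map Prod.fst).foldl attachStep
      (acc, l.map Prod.snd ++ w) = (l.reverse ++ acc, w) := by
    intro l
    induction l with
    | nil => intro acc; rfl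
    | cons t l ih => intro acc; simpa [attachStep] using ih (t :: acc)
  rw [attachBits, tokens_withCertificate, bits_withCertificate, ← List.map_reverse,
    ← List.map_reverse, h]
  simp

/-- Mark the tokens by means of the certificate. -/
noncomputable def attach : Prog :=
  forAll .word fun t => pop .cert fun b => push .ann (t, b.getD false)

theorem does_attach (z : List (Tok ⊕ Bool)) :
    attach.Does ({}, verifierStacks [] (tokens z).reverse [] (bits z) [] []) (z.length * 7 + 1)
      ({}, verifierStacks [] [] (attachBits z).1 (attachBits z).2 [] []) := by
  have h := Does.forAll (Γ := StkAlphabet) (τ := Vars) (k := Stk.word) (T := 4)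
    (P := fun t => pop .cert fun b => push .ann (t, b.getD false))
    (fun (x : List (Tok × Bool) × List Bool) l => ({}, verifierStacks [] l x.1 x.2 [] []))
    attachStep (fun _ _ => True)
    (fun _ _ => rfl) (fun x a l => funext fun k => by cases k <;> rfl) (fun _ _ _ => rfl)
    (fun _ _ _ _ => trivial)
    (fun x t l _ => Does.pop x.2 rfl ((Does.push Stk.ann _ _).congr
      (Prod.ext rfl (funext fun k => by cases k <;> rfl)) le_rfl))
    ([], bits z) (tokens z).reverse trivial
  refine h.mono ?_
  have := length_tokens_le z
  rw [List.length_reverse]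
  omega

/-- Count the tokens of the output. -/
noncomputable def countOut : Prog :=
  (forAll .out fun t => (push .word t).seq (push .cnt ())).seq <| forAll .word fun t => push .out t

theorem does_countOut (a : List (Tok × Bool)) (w : List Bool) (y : List Tok) :
    countOut.Does ({}, verifierStacks [] [] a w [] y) (y.length * 9 + 2)
      ({}, unaryStacks (verifierStacks [] [] a w [] y) y.length 0 0 0) := by
  have h := Does.forAll (Γ := StkAlphabet) (τ := Vars) (k := Stk.out) (T := 2)
    (P := fun t => (push .word t).seq (push .cnt ()))
    (fun (x : List Tok) l => ({}, unaryStacks (verifierStacks [] x a w [] l) x.length 0 0 0))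
    (fun x t => t :: x) (fun _ _ => True)
    (fun _ _ => rfl) (fun x a l => funext fun k => by cases k <;> rfl) (fun _ _ _ => rfl)
    (fun _ _ _ _ => trivial)
    (fun x t l _ => by
      refine ((Does.push (Γ := StkAlphabet) Stk.word t _).seq
        (Does.push (Γ := StkAlphabet) Stk.cnt () _)).congr
        (Prod.ext rfl (funext fun k => ?_)) le_rfl
      cases k <;> rfl)
    [] y trivial
  have hf : ∀ l x : List Tok, l.foldl (fun x t => t :: x) x = l.reverse ++ x := by
    intro l
    induction l with
    | nil => simp
    | cons t l ih => simp [ih]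
  rw [hf] at h
  have h₀ : (({} : Vars), unaryStacks (verifierStacks [] [] a w [] y) 0 0 0 0) =
      ({}, verifierStacks [] [] a w [] y) :=
    Prod.ext rfl (funext fun k => by cases k <;> rfl)
  simp only [List.append_nil, List.length_reverse, List.length_nil, h₀] at h
  refine (h.seq (Does.move (Γ := StkAlphabet) (k := Stk.word) (k' := Stk.out) (by decide) id
    _)).congr (Prod.ext rfl (funext fun k => ?_)) ?_
  · cases k <;> try rfl
    simp [unaryStacks, verifierStacks]
  · change _ + (y.reverse.length * 4 + 1) ≤ _
    rw [List.length_reverse]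
    omega

/-- Put a bit, if there is one, into the certificate. -/
noncomputable def keepBit : Option Bool → Prog
  | some b => push .cert' b
  | none => skip

/-- Take as many bits of the certificate as `depth` tells. -/
noncomputable def takeCert : Prog :=
  (forAll .depth fun _ => pop .cert keepBit).seq <|
    (forAll .cert fun _ => skip).seq <| forAll .cnt fun _ => skip

/-- Move a bit. -/
def takeStep (x : List Bool × List Bool) : List Bool × List Bool :=
  (x.1.tail, x.1.head?.toList ++ x.2)

theorem foldl_takeStep (d : ℕ) (x : List Bool × List Bool) :
    (List.replicate d ()).foldl (fun x _ => takeStep x) x =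
      (x.1.drop d, (x.1.take d).reverse ++ x.2) := by
  induction d generalizing x with
  | zero => simp
  | succ d ih =>
    rw [List.replicate_succ, List.foldl_cons, ih]
    obtain ⟨l, l'⟩ := x
    cases l <;> simp [takeStep]

theorem does_takeCert (a : List (Tok × Bool)) (w : List Bool) (y : List Tok) (n d : ℕ) :
    takeCert.Does ({}, unaryStacks (verifierStacks [] [] a w [] y) n d 0 0)
      (d * 7 + w.length * 4 + n * 4 + 3)
      ({}, verifierStacks [] [] a [] (w.take d).reverse y) := by
  have h := Does.forAll (Γ := StkAlphabet) (τ := Vars) (k := Stk.depth) (T := 4)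
    (P := fun _ => pop .cert keepBit)
    (fun (x : List Bool × List Bool) (l : List Unit) =>
      ({}, unaryStacks (verifierStacks [] [] a x.1 x.2 y) n l.length 0 0))
    (fun x _ => takeStep x) (fun _ _ => True)
    (fun x l => replicate_unit l) (fun x a l => funext fun k => by
      cases k <;> first | rfl | exact (replicate_unit l).symm)
    (fun _ _ _ => rfl) (fun _ _ _ _ => trivial)
    (fun x t l _ => by
      obtain ⟨w, w'⟩ := x
      refine Does.pop (t := 1) w rfl ?_
      cases w with
      | nil => exact (Does.skip _).congr (Prod.ext rfl (funext fun k => by cases k <;> rfl)) le_rfl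
      | cons b w =>
        exact (Does.push (Γ := StkAlphabet) Stk.cert' b _).congr
          (Prod.ext rfl (funext fun k => by cases k <;> rfl)) le_rfl)
    (w, []) (List.replicate d ()) trivial
  rw [foldl_takeStep, List.length_replicate] at h
  refine (h.seq ((Does.clear Stk.cert _).seq (Does.clear Stk.cnt _))).congr
    (Prod.ext rfl (funext fun k => ?_)) ?_
  · cases k <;> try rfl
    simp [unaryStacks, verifierStacks]
  · change _ + ((w.drop d).length * 4 + 1 + ((List.replicate n ()).length * 4 + 1)) ≤ _
    rw [List.length_drop, List.length_replicate]
    omega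

/-- Write the answer and clear the memory. -/
noncomputable def finish : Prog :=
  (forAll .ann fun _ => skip).seq <| (switch fun v => push .res v.ans).seq <| assign fun _ => {}

/-- The final configuration must have the initial state and no content except the answer, as
`haltList` prescribes. -/
theorem does_finish (v : Vars) (a : List (Tok × Bool)) :
    finish.Does (v, verifierStacks [] [] a [] [] []) (a.length * 4 + 4)
      ({}, single .res [v.ans]) := by
  refine ((Does.clear Stk.ann _).seq
    ((Does.switch (Does.push (Γ := StkAlphabet) Stk.res v.ans _)).seq (Does.assign _ _))).congr
    (Prod.ext rfl (funext fun k => by cases k <;> rfl)) ?_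
  change a.length * 4 + 1 + _ ≤ _
  omega

end ParametricGrammar

/-! ### Calling a given machine on stacks of its own. -/

namespace StackProgram

open Turing TM2 Function

section Call

attribute [local instance] FinTM2.kFin

variable {K K' : Type} [DecidableEq K] [DecidableEq K'] {Γ : K → Type} {Γ' : K' → Type}
  {τ : Type}

theorem single_inl (k : K) (l : List (Γ k)) :
    single (Γ := Sum.elim Γ Γ') (.inl k) l = Program.join (single k l) fun _ => [] := by
  have h : (fun _ => [] : ∀ k, List (Sum.elim Γ Γ' k)) =
      Program.join (fun _ => []) fun _ => [] := funext fun k => by cases k <;> rfl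
  exact (congrArg (fun S => update S (.inl k) l) h).trans (Program.update_join_inl ..)

variable [Fintype K]

theorem height_single (k : K) (l : List (Γ k)) : height (single k l) = l.length := by
  have h := height_update (fun _ => [] : ∀ k, List (Γ k)) k l
  simpa [height, single] using h

/-- Run a machine on the right part of the memory and process its answer in the left part. -/
def call (Γ : K → Type) (tm : FinTM2) (f : Option (tm.Γ tm.k₁) → τ → τ) :
    Program (Sum.elim Γ tm.Γ) (RegState Γ τ × tm.σ) :=
  (Program.liftRight Γ (RegState Γ τ) (machineProgram tm)).seq (fetch tm.k₁ f)

/-- During the call the left stacks are idle and contribute `height S`. Fetching the answer pushes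
nothing, so it needs no more than `height S + 1`. -/
theorem runs_call {tm : FinTM2} {l : List (tm.Γ tm.k₀)} {b : tm.Γ tm.k₁} {t : ℕ} {m : ℕ∞}
    (h : (machineProgram tm).Runs (tm.initialState, single tm.k₀ l) t m
      (tm.initialState, single tm.k₁ [b]))
    (f : Option (tm.Γ tm.k₁) → τ → τ) (v : τ) (S : ∀ k, List (Γ k)) :
    (call Γ tm f).Runs (((none, v), tm.initialState), Program.join S (single tm.k₀ l)) (t + 1)
      (height S + m + 1)
      (((none, f (some b) v), tm.initialState), Program.join S fun _ => []) := by
  have h₁ := h.liftRight (((none, v) : RegState Γ τ), S)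
  have h₂ := (runs_fetch tm.k₁ f v tm.initialState S (single tm.k₁ [b])).bound_space
  have hp : (fetch tm.k₁ f : Program (Sum.elim Γ tm.Γ) (RegState Γ τ × tm.σ)).pushBound = 0 := by
    simp [Program.pushBound, fetch, Program.ofStmt, pushes]
  have hs : single tm.k₁ [b] tm.k₁ = [b] := update_self ..
  have hu : update (single tm.k₁ [b]) tm.k₁ [] = fun _ => [] := by
    rw [single, update_idem]
    exact update_eq_self _ _
  simp only [hp, hs, Nat.zero_mul, Nat.add_zero, Program.height_join, height_single,
    List.length_singleton, List.head?_cons, List.tail_cons, hu] at h₂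
  refine (h₁.mono le_rfl le_self_add).seq (h₂.mono le_rfl ?_)
  rw [Nat.cast_add, Nat.cast_one]
  gcongr
  exact le_self_add

end Call

end StackProgram

/-! ### The verifier for nonemptiness and membership in NP. -/

namespace ParametricGrammar

open Turing TM2 Function StackProgram RegProgram

/-- Prepare the call of the verifier for satisfiability; `P` evaluates a polynomial. -/
noncomputable def prepareVerifier (P : Prog) : Prog :=
  splitInput.seq <| attach.seq <| reduce.seq <| countOut.seq <| P.seq takeCert

/-- The time for `prepareVerifier`, if `P` takes time `p` and evaluates `q`. -/
def prepareTime (p q : Polynomial ℕ) (n : ℕ) : ℕ :=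
  (n * 8 + 2) + ((n * 7 + 1) + (reduceTime n + ((reductionBound n * 9 + 2) +
    (p.eval (reductionBound n) + (q.eval (reductionBound n) * 7 + n * 4 +
      reductionBound n * 4 + 3)))))

theorem polyBounded_prepareTime (p q : Polynomial ℕ) : PolyBounded (prepareTime p q) :=
  have hY := polyBounded_reductionBound
  .add (.add (.mul .id (.const 8)) (.const 2)) (.add (.add (.mul .id (.const 7)) (.const 1))
    (.add polyBounded_reduceTime (.add (.add (.mul hY (.const 9)) (.const 2))
      (.add (.eval_comp p hY) (.add (.add (.add (.mul (.eval_comp q hY) (.const 7))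
        (.mul .id (.const 4))) (.mul hY (.const 4))) (.const 3))))))

theorem scan_mem_verifierStacks (go ans : Bool) (a : List (Tok × Bool)) (w : List Bool)
    (y : List Tok) :
    ({ out := y } : Scan).mem { go := go, ans := ans } (verifierStacks [] [] a w [] []) =
      ({ go := go, ans := ans }, verifierStacks [] [] a w [] y) :=
  Prod.ext rfl (funext fun k => by cases k <;> rfl)

theorem does_prepareVerifier {P : Prog} {p q : Polynomial ℕ}
    (hP : ∀ (v : Vars) (S : Stacks) (n : ℕ),
      P.Does (v, unaryStacks S n 0 0 0) (p.eval n) (v, unaryStacks S n (q.eval n) 0 0))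
    (z : List (Tok ⊕ Bool)) :
    (prepareVerifier P).Does ({}, verifierStacks z [] [] [] [] []) (prepareTime p q z.length)
      ({}, verifierStacks [] [] (attachBits z).1 []
        ((attachBits z).2.take (q.eval (reduction (attachBits z).1).length)).reverse
        (reduction (attachBits z).1).reverse) := by
  have ha := length_attachBits_fst_le z
  have hw := length_attachBits_snd_le z
  generalize hz : attachBits z = x at ha hw ⊢
  obtain ⟨a, w⟩ := x
  have h₃ := does_reduce {} (verifierStacks [] [] a w [] []) a rfl rfl rfl
  rw [scan_mem_verifierStacks, scan_mem_verifierStacks] at h₃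
  have h₄ := does_countOut a w (reduction a).reverse
  have h₅ := hP {} (verifierStacks [] [] a w [] (reduction a).reverse) (reduction a).length
  have h₆ := does_takeCert a w (reduction a).reverse (reduction a).length
    (q.eval (reduction a).length)
  rw [List.length_reverse] at h₄
  have h₂ := does_attach z
  rw [hz] at h₂
  refine ((does_splitInput z).seq (h₂.seq (h₃.seq (h₄.seq (h₅.seq h₆))))).mono ?_
  have hy : (reduction a).length ≤ reductionBound z.length :=
    (length_reduction_le a).trans (reductionBound_mono ha)
  have hr : reduceTime a.length ≤ reduceTime z.length := reduceTime_mono ha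
  have hp := p.eval_mono_nat hy
  have hq := q.eval_mono_nat hy
  simp only at hp hq hw
  unfold prepareTime
  gcongr

/-- Verify certificates for nonemptiness, by means of a verifier for satisfiability. -/
noncomputable def verifier (M : TM2ComputableAux (Tok ⊕ Bool) Bool) (P : Prog) :
    Program (Sum.elim StkAlphabet M.tm.Γ) (RegState StkAlphabet Vars × M.tm.σ) :=
  (Program.liftLeft (prepareVerifier P) M.tm.Γ M.tm.σ).seq <|
    (transfer Stk.cert' false M.tm.k₀ fun b => M.inputAlphabet.invFun (.inr b)).seq <|
      (transfer Stk.out .fin M.tm.k₀ fun t => M.inputAlphabet.invFun (.inl t)).seq <|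
        (call StkAlphabet M.tm fun o v =>
          { v with ans := o.elim false M.outputAlphabet }).seq <|
          Program.liftLeft finish M.tm.Γ M.tm.σ

/-- The input of the verifier for satisfiability. -/
noncomputable def verifierInput (q : Polynomial ℕ) (z : List (Tok ⊕ Bool)) : List (Tok ⊕ Bool) :=
  Complexity.withCertificate (reduction (attachBits z).1)
    ((attachBits z).2.take (q.eval (reduction (attachBits z).1).length))

theorem length_verifierInput_le (q : Polynomial ℕ) (z : List (Tok ⊕ Bool)) :
    (verifierInput q z).length ≤ reductionBound z.length + z.length := by
  have h₁ := (length_reduction_le (attachBits z).1).trans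
    (reductionBound_mono (length_attachBits_fst_le z))
  have h₂ := length_attachBits_snd_le z
  simp only [verifierInput, Complexity.withCertificate, List.length_append, List.length_map,
    List.length_take]
  omega

attribute [local instance] FinTM2.kFin

theorem runs_verifier {M : TM2ComputableAux (Tok ⊕ Bool) Bool} {P : Prog} {p q : Polynomial ℕ}
    (hP : ∀ (v : Vars) (S : Stacks) (n : ℕ),
      P.Does (v, unaryStacks S n 0 0 0) (p.eval n) (v, unaryStacks S n (q.eval n) 0 0))
    {z : List (Tok ⊕ Bool)} {b : Bool} {t : ℕ}
    (h : TM2OutputsInTime M.tm ((verifierInput q z).map M.inputAlphabet.invFun)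
      (some [M.outputAlphabet.invFun b]) t) :
    (verifier M P).Runs (((none, {}), M.tm.initialState), Program.join (single .inp z) fun _ => [])
      (prepareTime p q z.length + ((z.length * 2 + 1) + ((reductionBound z.length * 2 + 1) +
        ((t + 1) + (z.length * 4 + 4))))) ⊤
      (((none, {}), M.tm.initialState), Program.join (single .res [b]) fun _ => []) := by
  have hy := (length_reduction_le (attachBits z).1).trans
    (reductionBound_mono (length_attachBits_fst_le z))
  have hw := length_attachBits_snd_le z
  have ha := length_attachBits_fst_le z
  have h₁ := Program.Runs.liftLeft (Γ' := M.tm.Γ) (σ' := M.tm.σ) (does_prepareVerifier hP z)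
    (M.tm.initialState, fun _ => [])
  have hc := machineProgram_runs_of_outputsInTime h
  simp only [verifierInput] at hc
  generalize attachBits z = x at h₁ hc hy hw ha
  obtain ⟨a, w⟩ := x
  simp only at h₁ hc hy hw ha
  generalize hw' : w.take (q.eval (reduction a).length) = w' at h₁ hc
  have hw'' : w'.length ≤ z.length := by rw [← hw', List.length_take]; omega
  -- The certificate is moved first and the formula on top of it, so the input stack of `M` reads
  -- formula, then certificate. Both were stored in reverse, and the transfer restores their order.
  have h₂ := runs_transfer (Γ := StkAlphabet) (Γ' := M.tm.Γ) Stk.cert' false M.tm.k₀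
    (fun b => M.inputAlphabet.invFun (.inr b))
    ({} : Vars) M.tm.initialState (verifierStacks [] [] a [] w'.reverse (reduction a).reverse)
    (fun _ => [])
  have e₂ : update (verifierStacks [] [] a [] w'.reverse (reduction a).reverse) .cert' [] =
      verifierStacks [] [] a [] [] (reduction a).reverse :=
    funext fun k => by cases k <;> rfl
  have h₃ := runs_transfer (Γ := StkAlphabet) (Γ' := M.tm.Γ) Stk.out .fin M.tm.k₀
    (fun t => M.inputAlphabet.invFun (.inl t))
    ({} : Vars) M.tm.initialState (verifierStacks [] [] a [] [] (reduction a).reverse)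
    (single M.tm.k₀ (w'.map fun b => M.inputAlphabet.invFun (.inr b)))
  have e₃ : update (verifierStacks [] [] a [] [] (reduction a).reverse) .out [] =
      verifierStacks [] [] a [] [] [] :=
    funext fun k => by cases k <;> rfl
  have s₂ : verifierStacks [] [] a [] w'.reverse (reduction a).reverse .cert' = w'.reverse := rfl
  have s₃ : verifierStacks [] [] a [] [] (reduction a).reverse .out = (reduction a).reverse := rfl
  rw [e₂, s₂, List.reverse_reverse, List.append_nil] at h₂
  rw [e₃, s₃, List.reverse_reverse, single, update_self, update_idem] at h₃
  have h₄ := runs_call hc (fun o v => { v with ans := o.elim false M.outputAlphabet }) ({} : Vars)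
    (verifierStacks [] [] a [] [] [])
  have h₅ := Program.Runs.liftLeft (Γ' := M.tm.Γ) (σ' := M.tm.σ) (does_finish { ans := b } a)
    (M.tm.initialState, fun _ => [])
  have hi : single Stk.inp z = verifierStacks z [] [] [] [] [] :=
    funext fun k => by cases k <;> rfl
  rw [hi]
  have hb : (some (M.outputAlphabet.invFun b)).elim false M.outputAlphabet = b :=
    M.outputAlphabet.apply_symm_apply b
  have hm : (reduction a).map (fun t => M.inputAlphabet.invFun (.inl t)) ++
      w'.map (fun b => M.inputAlphabet.invFun (.inr b)) =
      (Complexity.withCertificate (reduction a) w').map M.inputAlphabet.invFun := by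
    simp [Complexity.withCertificate, Function.comp_def]
  simp only [hb] at h₄
  rw [hm] at h₃
  refine (h₁.seq (h₂.seq (h₃.seq ((h₄.mono le_rfl le_top).seq h₅)))).mono_time ?_
  simp only [List.length_reverse]
  gcongr

/-- The machine that consists of a program and a machine. -/
noncomputable def jointMachine (tm : FinTM2)
    (P : Program (Sum.elim StkAlphabet tm.Γ) (RegState StkAlphabet Vars × tm.σ)) (k₀ k₁ : Stk) :
    FinTM2 :=
  letI : Fintype tm.σ := tm.σFin
  letI : Fintype (Sum.elim StkAlphabet tm.Γ (.inl k₀)) := inferInstanceAs (Fintype (StkAlphabet k₀))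
  machine P ((none, {}), tm.initialState) (.inl k₀) (.inl k₁)

section JointMachine

variable {tm : FinTM2}
  {P : Program (Sum.elim StkAlphabet tm.Γ) (RegState StkAlphabet Vars × tm.σ)} {k₀ k₁ : Stk}
  {l : List (StkAlphabet k₀)} {l' : List (StkAlphabet k₁)} {t : ℕ} {m : ℕ∞}

theorem runs_single
    (h : P.Runs (((none, {}), tm.initialState), Program.join (single k₀ l) fun _ => []) t m
      (((none, {}), tm.initialState), Program.join (single k₁ l') fun _ => [])) :
    P.Runs (((none, {}), tm.initialState), single (Γ := Sum.elim StkAlphabet tm.Γ) (.inl k₀) l) t m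
      (((none, {}), tm.initialState), single (Γ := Sum.elim StkAlphabet tm.Γ) (.inl k₁) l') := by
  have h₀ := single_inl (Γ' := tm.Γ) k₀ l
  have h₁ := single_inl (Γ' := tm.Γ) k₁ l'
  rwa [← h₀, ← h₁] at h

theorem jointMachine_outputsInTime
    (h : P.Runs (((none, {}), tm.initialState), Program.join (single k₀ l) fun _ => []) t m
      (((none, {}), tm.initialState), Program.join (single k₁ l') fun _ => [])) :
    Nonempty (TM2OutputsInTime (jointMachine tm P k₀ k₁) l (some l') t) :=
  letI : Fintype tm.σ := tm.σFin
  letI : Fintype (Sum.elim StkAlphabet tm.Γ (.inl k₀)) := inferInstanceAs (Fintype (StkAlphabet k₀))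
  machine_outputsInTime (k₁ := Sum.inl k₁) (runs_single h)

theorem jointMachine_cfgSpace_le
    (h : P.Runs (((none, {}), tm.initialState), Program.join (single k₀ l) fun _ => []) t m
      (((none, {}), tm.initialState), Program.join (single k₁ l') fun _ => []))
    {c : (jointMachine tm P k₀ k₁).Cfg}
    (hc : StateTransition.Reaches (jointMachine tm P k₀ k₁).step
      (initList (jointMachine tm P k₀ k₁) l) c) :
    (Complexity.cfgSpace (jointMachine tm P k₀ k₁) c : ℕ∞) ≤ m :=
  letI : Fintype tm.σ := tm.σFin
  letI : Fintype (Sum.elim StkAlphabet tm.Γ (.inl k₀)) := inferInstanceAs (Fintype (StkAlphabet k₀))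
  machine_cfgSpace_le (k₁ := Sum.inl k₁) (runs_single h) hc

end JointMachine

open Classical in
-- The preimage of `R` under `verifierInput`, which is computed in polynomial time and has
-- polynomial length, so that the running time of the machine for `R` stays polynomial.
theorem mem_PTIME_of_verifier {R : Language (Tok ⊕ Bool)} (hR : R ∈ Complexity.PTIME (Tok ⊕ Bool))
    (q : Polynomial ℕ) :
    ({z | verifierInput q z ∈ R} : Language (Tok ⊕ Bool)) ∈ Complexity.PTIME (Tok ⊕ Bool) := by
  obtain ⟨M⟩ := hR
  obtain ⟨P, p, hP⟩ := exists_evalPolynomial q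
  have hT : PolyBounded fun n => prepareTime p q n + ((n * 2 + 1) + ((reductionBound n * 2 + 1) +
      ((M.time.eval (reductionBound n + n) + 1) + (n * 4 + 4)))) := by
    have hY := polyBounded_reductionBound
    exact .add (polyBounded_prepareTime p q) (.add (.add (.mul .id (.const 2)) (.const 1))
      (.add (.add (.mul hY (.const 2)) (.const 1))
        (.add (.add (.eval_comp M.time (.add hY .id)) (.const 1))
          (.add (.mul .id (.const 4)) (.const 4)))))
  obtain ⟨T, hT⟩ := hT
  have h : ∀ z, Nonempty (TM2OutputsInTime (jointMachine M.tm
      (verifier M.toTM2ComputableAux P) .inp .res) z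
      (some [decide (verifierInput q z ∈ R)]) (T.eval z.length)) := by
    intro z
    have h₁ := M.time.eval_mono_nat (length_verifierInput_le q z)
    have h₂ := hT z.length
    simp only at h₁ h₂
    refine jointMachine_outputsInTime ((runs_verifier hP
      (M.outputsFun (verifierInput q z))).mono_time (le_trans ?_ h₂))
    exact Nat.add_le_add_left (Nat.add_le_add_left (Nat.add_le_add_left
      (Nat.add_le_add_right (Nat.add_le_add_right h₁ _) _) _) _) _
  refine ⟨⟨⟨jointMachine M.tm (verifier M.toTM2ComputableAux P) .inp .res,
    Equiv.refl (Tok ⊕ Bool), Equiv.refl Bool⟩, T, fun z => Nonempty.some ?_⟩⟩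
  have hz : z.map (Equiv.refl (Tok ⊕ Bool)).invFun = z := List.map_id z
  exact (congrArg (fun l => Nonempty (TM2OutputsInTime (jointMachine M.tm
    (verifier M.toTM2ComputableAux P) .inp .res) l
      (some [decide (verifierInput q z ∈ R)]) (T.eval z.length))) hz).mpr (h z)

theorem nonemptinessProblem_mem_NP {L : FirstOrder.Language.{u, v}} {D : Type w} [L.Structure D]
    (c : SymbolCoding L) (h : satProblem c D ∈ Complexity.NP Tok) :
    nonemptinessProblem c D ∈ Complexity.NP Tok := by
  obtain ⟨R, hR, q, hq⟩ := h
  obtain ⟨r, hr⟩ := PolyBounded.eval_comp q polyBounded_reductionBound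
  -- One mark for each token, and at most `q` of the length of the formula for its own certificate.
  refine ⟨_, mem_PTIME_of_verifier hR q, .X + r, fun x => ?_⟩
  rw [mem_nonemptinessProblem_iff]
  constructor
  · rintro ⟨a, rfl, ha⟩
    obtain ⟨w, hw, hw'⟩ := (hq _).1 ha
    refine ⟨(a.map Prod.snd).reverse ++ w, ?_, ?_⟩
    · have h₁ := q.eval_mono_nat (length_reduction_le a)
      have h₂ := hr a.length
      simp only at h₁ h₂
      simp only [List.length_append, List.length_reverse, List.length_map, Polynomial.eval_add,
        Polynomial.eval_X]
      omega
    · change verifierInput q _ ∈ R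
      rwa [verifierInput, attachBits_withCertificate, List.take_of_length_le hw]
  · rintro ⟨w, -, hw⟩
    change verifierInput q _ ∈ R at hw
    -- Here the truncation is needed: the certificate handed to `R` must obey the bound `q` for the
    -- formula, which may be much shorter than the bound for the input.
    refine ⟨_, (map_fst_attachBits _).trans (tokens_withCertificate x w), (hq _).2 ⟨_, ?_, hw⟩⟩
    rw [List.length_take]
    exact min_le_left _ _

end ParametricGrammar

namespace ParametricGrammar

open Turing TM2 Function StackProgram RegProgram

/-! ### Search through all selections of rules -/

/-- The marks of some tokens as a binary number. -/
def value : List (Tok × Bool) → ℕ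
  | [] => 0
  | t :: a => t.2.toNat + 2 * value a

/-- Add a carry to the number that is given by the marks; the second component is the resulting
carry. -/
def increment : Bool → List (Tok × Bool) → List (Tok × Bool) × Bool
  | c, [] => ([], c)
  | c, t :: a => ((t.1, xor t.2 c) :: (increment (c && t.2) a).1, (increment (c && t.2) a).2)

theorem map_fst_increment (c : Bool) (a : List (Tok × Bool)) :
    (increment c a).1.map Prod.fst = a.map Prod.fst := by
  induction a generalizing c with
  | nil => rfl
  | cons t a ih => simp [increment, ih]

theorem length_increment (c : Bool) (a : List (Tok × Bool)) :
    (increment c a).1.length = a.length := by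
  simpa using congrArg List.length (map_fst_increment c a)

/-- The marks form a binary number with the least significant bit first; an overflow is accounted
for by the final carry. -/
theorem value_increment (c : Bool) (a : List (Tok × Bool)) :
    value (increment c a).1 + 2 ^ a.length * (increment c a).2.toNat = value a + c.toNat := by
  induction a generalizing c with
  | nil => simp [increment, value]
  | cons t a ih =>
    have h := ih (c && t.2)
    simp only [increment, value, List.length_cons, pow_succ]
    rcases t with ⟨t, b⟩
    cases b <;> cases c <;> simp at h ⊢ <;> linarith

theorem value_lt (a : List (Tok × Bool)) : value a < 2 ^ a.length := by
  induction a with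
  | nil => simp [value]
  | cons t a ih =>
    simp only [value, List.length_cons, pow_succ]
    have : t.2.toNat ≤ 1 := Bool.toNat_le t.2
    omega

theorem value_injective {a a' : List (Tok × Bool)} (h : a.map Prod.fst = a'.map Prod.fst)
    (hv : value a = value a') : a = a' := by
  induction a generalizing a' with
  | nil => simpa using h
  | cons t a ih =>
    cases a' with
    | nil => simp at h
    | cons t' a' =>
      obtain ⟨t, b⟩ := t
      obtain ⟨t', b'⟩ := t'
      simp only [List.map_cons, List.cons.injEq] at h
      obtain ⟨rfl, h⟩ := h
      simp only [value] at hv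
      have hb : b = b' := by cases b <;> cases b' <;> simp at hv ⊢ <;> omega
      subst hb
      rw [ih h (by omega)]

theorem value_eq_zero (x : List Tok) : value (plain x) = 0 := by
  induction x with
  | nil => rfl
  | cons t x ih => simpa [plain, value] using ih

/-- Mark all the tokens with `false`. -/
noncomputable def startSearch : Prog :=
  (forAll .word fun t => push .ann' (t, false)).seq <|
    (forAll .ann' fun t => push .ann t).seq <| assign fun v => { v with go := true }

theorem does_startSearch (x : List Tok) :
    startSearch.Does ({}, single .word x) (x.length * 8 + 3)
      ({ go := true }, verifierStacks [] [] (plain x) [] [] []) := by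
  refine ((Does.move (Γ := StkAlphabet) (k := Stk.word) (k' := Stk.ann') (by decide)
    (fun t => (t, false)) _).seq ((Does.move (Γ := StkAlphabet) (k := Stk.ann') (k' := Stk.ann)
      (by decide) id _).seq (Does.assign _ _))).congr (Prod.ext rfl (funext fun k => ?_)) ?_
  · cases k <;> try rfl
    change List.map id (List.map (fun t => (t, false)) x.reverse ++ []).reverse ++ [] = plain x
    simp [plain]
  · change x.length * 4 + 1 + ((List.map (fun t => (t, false)) x.reverse ++ []).length * 4 + 1 + 1)
      ≤ _
    simp
    omega

/-- Add the carry `eq` to a mark. -/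
noncomputable def incrementToken (t : Tok × Bool) : Prog :=
  switch fun v => (push .ann' (t.1, xor t.2 v.eq)).seq <|
    assign fun v => { v with eq := v.eq && t.2 }

/-- Go on to the next selection of rules. -/
noncomputable def incrementAnn : Prog :=
  (assign fun v => { v with eq := true }).seq <| (forAll .ann incrementToken).seq <|
    (forAll .ann' fun t => push .ann t).seq <| assign fun v => { v with go := !v.eq, eq := false }

theorem does_incrementAnn (a : List (Tok × Bool)) :
    incrementAnn.Does ({ go := true }, verifierStacks [] [] a [] [] []) (a.length * 10 + 4)
      ({ go := !(increment true a).2 },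
        verifierStacks [] [] (increment true a).1 [] [] []) := by
  have h := Does.forAll (Γ := StkAlphabet) (τ := Vars) (k := Stk.ann) (T := 3)
    (P := incrementToken)
    (fun (x : Bool × List (Tok × Bool)) l =>
      ({ go := true, eq := x.1 }, update (verifierStacks [] [] l [] [] []) .ann' x.2))
    (fun x t => (x.1 && t.2, (t.1, xor t.2 x.1) :: x.2)) (fun _ _ => True)
    (fun _ _ => rfl) (fun x a l => funext fun k => by cases k <;> rfl) (fun _ _ _ => rfl)
    (fun _ _ _ _ => trivial)
    (fun x t l _ => Does.switch (((Does.push (Γ := StkAlphabet) Stk.ann' _ _).seq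
      (Does.assign _ _)).congr (Prod.ext rfl (funext fun k => by cases k <;> rfl)) le_rfl))
    (true, []) a trivial
  have hf : ∀ (a : List (Tok × Bool)) (x : Bool × List (Tok × Bool)),
      a.foldl (fun x t => (x.1 && t.2, (t.1, xor t.2 x.1) :: x.2)) x =
        ((increment x.1 a).2, (increment x.1 a).1.reverse ++ x.2) := by
    intro a
    induction a with
    | nil => intro x; rfl
    | cons t a ih => intro x; rw [List.foldl_cons, ih]; simp [increment]
  rw [hf] at h
  have hs : update (verifierStacks [] [] a [] [] []) .ann' [] = verifierStacks [] [] a [] [] [] :=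
    update_eq_self Stk.ann' _
  simp only [hs] at h
  have h₁ := Does.assign (Γ := StkAlphabet) (fun v : Vars => { v with eq := true })
    ({ go := true }, verifierStacks [] [] a [] [] [])
  have h₂ := Does.move (Γ := StkAlphabet) (τ := Vars) (k := Stk.ann') (k' := Stk.ann) (by decide)
    id ({ go := true, eq := (increment true a).2 },
      update (verifierStacks [] [] [] [] [] []) .ann' ((increment true a).1.reverse ++ []))
  have h₃ := h₁.seq (h.seq (h₂.seq
    (Does.assign (fun v : Vars => { v with go := !v.eq, eq := false }) _)))
  refine h₃.congr (Prod.ext rfl (funext fun k => ?_)) ?_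
  · cases k <;> try rfl
    change List.map id ((increment true a).1.reverse ++ []).reverse ++ [] = (increment true a).1
    simp
  · change 1 + (a.length * 6 + 1 + (((increment true a).1.reverse ++ []).length * 4 + 1 + 1)) ≤ _
    simp [length_increment]
    omega

/-- Stop if the answer is positive, and go on to the next selection of rules otherwise. -/
noncomputable def advance : Prog := switch fun v =>
  if v.ans then assign fun v => { v with go := false } else incrementAnn

theorem does_advance_true (a : List (Tok × Bool)) :
    advance.Does ({ go := true, ans := true }, verifierStacks [] [] a [] [] [])
      (a.length * 10 + 5) ({ ans := true }, verifierStacks [] [] a [] [] []) := by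
  refine (Does.switch (Γ := StkAlphabet) (τ := Vars) (t := 1) ?_).mono (by omega)
  exact Does.assign (fun v : Vars => { v with go := false }) _

theorem does_advance_false (a : List (Tok × Bool)) :
    advance.Does ({ go := true }, verifierStacks [] [] a [] [] []) (a.length * 10 + 5)
      ({ go := !(increment true a).2 }, verifierStacks [] [] (increment true a).1 [] [] []) :=
  Does.switch (Γ := StkAlphabet) (τ := Vars) (t := a.length * 10 + 4) (does_incrementAnn a)

theorem height_verifierStacks (a : List (Tok × Bool)) (y : List Tok) :
    height (verifierStacks [] [] a [] [] y) = a.length + y.length := by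
  have h : verifierStacks [] [] a [] [] y = update (single .ann a) .out y :=
    funext fun k => by cases k <;> rfl
  have h₁ := height_update (Γ := StkAlphabet) (single Stk.ann a) Stk.out y
  have h₂ := height_single (Γ := StkAlphabet) Stk.ann a
  have h₃ : (single (Γ := StkAlphabet) Stk.ann a .out).length = 0 := rfl
  have h₄ := congrArg height h
  omega

/-- Test one selection of rules. -/
noncomputable def searchBody (M : TM2ComputableAux Tok Bool) :
    Program (Sum.elim StkAlphabet M.tm.Γ) (RegState StkAlphabet Vars × M.tm.σ) :=
  (Program.liftLeft reduce M.tm.Γ M.tm.σ).seq <|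
    (transfer Stk.out Tok.fin M.tm.k₀ M.inputAlphabet.invFun).seq <|
      (call StkAlphabet M.tm fun o v => { v with ans := o.elim false M.outputAlphabet }).seq <|
        Program.liftLeft advance M.tm.Γ M.tm.σ

/-- Search for a selection of rules. -/
noncomputable def search (M : TM2ComputableAux Tok Bool) :
    Program (Sum.elim StkAlphabet M.tm.Γ) (RegState StkAlphabet Vars × M.tm.σ) :=
  (Program.liftLeft startSearch M.tm.Γ M.tm.σ).seq <|
    (Program.loop (fun v => v.1.2.go) (searchBody M)).seq <|
      Program.liftLeft finish M.tm.Γ M.tm.σ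

/-- The space for a search, if the satisfiability of formulas of length `n` can be decided in space
`p n`. -/
noncomputable def searchSpace (M : TM2ComputableAux Tok Bool) (p : Polynomial ℕ) (n : ℕ) : ℕ :=
  (n + (Program.liftLeft reduce M.tm.Γ M.tm.σ).pushBound * reduceTime n) +
  (n + reductionBound n + (transfer (Γ := StkAlphabet) (τ := Vars) (σ' := M.tm.σ)
    Stk.out Tok.fin M.tm.k₀
    M.inputAlphabet.invFun).pushBound * (reductionBound n * 2 + 1)) +
  (n + p.eval (reductionBound n) + 1) +
  (n + (Program.liftLeft advance M.tm.Γ M.tm.σ).pushBound * (n * 10 + 5)) +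
  (n + (Program.liftLeft startSearch M.tm.Γ M.tm.σ).pushBound * (n * 8 + 3)) +
  (n + (Program.liftLeft finish M.tm.Γ M.tm.σ).pushBound * (n * 4 + 4))

theorem polyBounded_searchSpace (M : TM2ComputableAux Tok Bool) (p : Polynomial ℕ) :
    PolyBounded (searchSpace M p) :=
  have hY := polyBounded_reductionBound
  have h : ∀ c d : ℕ, PolyBounded fun n => n * c + d := fun c d =>
    .add (.mul .id (.const c)) (.const d)
  .add (.add (.add (.add (.add (.add .id (.mul (.const _) polyBounded_reduceTime))
    (.add (.add .id hY) (.mul (.const _) (.add (.mul hY (.const 2)) (.const 1)))))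
    (.add (.add .id (.eval_comp p hY)) (.const 1)))
    (.add .id (.mul (.const _) (h 10 5))))
    (.add .id (.mul (.const _) (h 8 3))))
    (.add .id (.mul (.const _) (h 4 4)))

attribute [local instance] FinTM2.kFin

/-- A program on the left part of the memory, when the right part is empty. -/
theorem runs_liftLeft_space {tm : FinTM2} {P : Prog} {s s' : Mem StkAlphabet Vars} {t m : ℕ}
    (h : P.Does s t s')
    (hm : height s.2 + (Program.liftLeft P tm.Γ tm.σ).pushBound * t ≤ m) :
    (Program.liftLeft P tm.Γ tm.σ).Runs
      (((none, s.1), tm.initialState), Program.join s.2 fun _ => []) t m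
      (((none, s'.1), tm.initialState), Program.join s'.2 fun _ => []) := by
  have h₁ := (Program.Runs.liftLeft (Γ' := tm.Γ) (σ' := tm.σ) h
    (tm.initialState, fun _ => [])).bound_space
  refine h₁.mono le_rfl (Nat.cast_le.2 (le_trans ?_ hm))
  have h₀ : height (fun _ => [] : ∀ k, List (tm.Γ k)) = 0 := by simp [height]
  rw [Program.height_join, h₀, Nat.add_zero]

/-! ### Exhaustive search in polynomial space. -/

section Search

variable {M : TM2ComputableAux Tok Bool} {p : Polynomial ℕ} {f : List Tok → Bool}

/-- The time is only asserted to exist, because the given machine comes with no time bound. The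
space of each stage is a summand of `searchSpace`, so the sum bounds them all. -/
theorem runs_searchBody
    (hM : ∀ y, ∃ t, (machineProgram M.tm).Runs (M.tm.initialState,
        single M.tm.k₀ (y.map M.inputAlphabet.invFun)) t (p.eval y.length : ℕ)
      (M.tm.initialState, single M.tm.k₁ [M.outputAlphabet.invFun (f y)]))
    (a : List (Tok × Bool)) :
    ∃ t, (searchBody M).Runs
      (((none, { go := true }), M.tm.initialState),
        Program.join (verifierStacks [] [] a [] [] []) fun _ => []) t
      (searchSpace M p a.length : ℕ)
      (((none, { go := !f (reduction a) && !(increment true a).2, ans := f (reduction a) }),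
        M.tm.initialState), Program.join (verifierStacks [] []
          (if f (reduction a) then a else (increment true a).1) [] [] []) fun _ => []) := by
  obtain ⟨t, ht⟩ := hM (reduction a)
  have hy := length_reduction_le a
  have h₁ := does_reduce { go := true } (verifierStacks [] [] a [] [] []) a rfl rfl rfl
  rw [scan_mem_verifierStacks, scan_mem_verifierStacks] at h₁
  have h₂ := (runs_transfer (Γ := StkAlphabet) (Γ' := M.tm.Γ) Stk.out Tok.fin M.tm.k₀
    M.inputAlphabet.invFun ({ go := true } : Vars) M.tm.initialState
    (verifierStacks [] [] a [] [] (reduction a).reverse) (fun _ => [])).bound_space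
  have e₂ : update (verifierStacks [] [] a [] [] (reduction a).reverse) .out [] =
      verifierStacks [] [] a [] [] [] :=
    funext fun k => by cases k <;> rfl
  have s₂ : verifierStacks [] [] a [] [] (reduction a).reverse .out = (reduction a).reverse := rfl
  have h₀ : height (fun _ => [] : ∀ k, List (M.tm.Γ k)) = 0 := by simp [height]
  rw [e₂, s₂, List.reverse_reverse, List.append_nil, Program.height_join, height_verifierStacks,
    h₀, List.length_reverse, Nat.add_zero] at h₂
  have h₃ := runs_call ht (fun o v => { v with ans := o.elim false M.outputAlphabet })
    ({ go := true } : Vars) (verifierStacks [] [] a [] [] [])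
  have hb : (some (M.outputAlphabet.invFun (f (reduction a)))).elim false M.outputAlphabet =
      f (reduction a) := M.outputAlphabet.apply_symm_apply _
  simp only [hb] at h₃
  rw [height_verifierStacks] at h₃
  have h₄ : advance.Does ({ go := true, ans := f (reduction a) }, verifierStacks [] [] a [] [] [])
      (a.length * 10 + 5)
      ({ go := !f (reduction a) && !(increment true a).2, ans := f (reduction a) },
        verifierStacks [] [] (if f (reduction a) then a else (increment true a).1) [] [] []) := by
    cases f (reduction a)
    · exact does_advance_false a
    · exact does_advance_true a
  have hp := p.eval_mono_nat hy
  simp only at hp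
  refine ⟨_, (runs_liftLeft_space h₁ ?_).seq ((h₂.mono le_rfl (Nat.cast_le.2 ?_)).seq
    ((h₃.mono le_rfl ?_).seq (runs_liftLeft_space h₄ ?_)))⟩
  · rw [height_verifierStacks, searchSpace, List.length_nil]
    omega
  · have := Nat.mul_le_mul_left (transfer (Γ := StkAlphabet) (τ := Vars) (σ' := M.tm.σ)
      Stk.out Tok.fin M.tm.k₀ M.inputAlphabet.invFun).pushBound
        (Nat.add_le_add_right (Nat.mul_le_mul_right 2 hy) 1)
    rw [searchSpace]
    omega
  · have hc : ∀ i j : ℕ, (i : ℕ∞) + j + 1 = ((i + j + 1 : ℕ) : ℕ∞) := fun i j => by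
      push_cast
      rfl
    rw [hc, Nat.cast_le, searchSpace, List.length_nil]
    omega
  · rw [height_verifierStacks, searchSpace, List.length_nil]
    omega

/-- By induction on the number of markings still to be tried, `2 ^ a.length - value a`. Space does
not accumulate over the rounds, since each one leaves behind only a marking of the same length. -/
theorem runs_searchLoop
    (hM : ∀ y, ∃ t, (machineProgram M.tm).Runs (M.tm.initialState,
        single M.tm.k₀ (y.map M.inputAlphabet.invFun)) t (p.eval y.length : ℕ)
      (M.tm.initialState, single M.tm.k₁ [M.outputAlphabet.invFun (f y)]))
    (a : List (Tok × Bool)) :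
    ∃ t b a', a'.length = a.length ∧
      (b = true ↔ ∃ a'', a''.map Prod.fst = a.map Prod.fst ∧ value a ≤ value a'' ∧
        f (reduction a'') = true) ∧
      (Program.loop (fun v => v.1.2.go) (searchBody M)).Runs
        (((none, { go := true }), M.tm.initialState),
          Program.join (verifierStacks [] [] a [] [] []) fun _ => []) t
        (searchSpace M p a.length : ℕ)
        (((none, { ans := b }), M.tm.initialState),
          Program.join (verifierStacks [] [] a' [] [] []) fun _ => []) := by
  induction hd : 2 ^ a.length - value a generalizing a with
  | zero => have := value_lt a; omega
  | succ d ih =>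
    obtain ⟨t, ht⟩ := runs_searchBody hM a
    have hlen := length_increment true a
    have hval := value_increment true a
    have hh : ∀ a' : List (Tok × Bool), a'.length = a.length →
        (height (Program.join (verifierStacks [] [] a' [] [] [])
          (fun _ => [] : ∀ k, List (M.tm.Γ k))) : ℕ∞) ≤ (searchSpace M p a.length : ℕ) := by
      intro a' ha'
      have h₀ : height (fun _ => [] : ∀ k, List (M.tm.Γ k)) = 0 := by simp [height]
      rw [Program.height_join, h₀, height_verifierStacks, ha', Nat.cast_le, searchSpace,
        List.length_nil]
      omega
    cases hf : f (reduction a) with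
    | true =>
      simp only [hf] at ht
      exact ⟨_, true, a, rfl, iff_of_true rfl ⟨a, rfl, le_rfl, hf⟩,
        .loop_true rfl ht (.loop_false rfl (hh a rfl))⟩
    | false =>
      simp only [hf] at ht
      cases hc : (increment true a).2 with
      | true =>
        simp only [hc] at ht
        refine ⟨_, false, _, hlen, iff_of_false (by simp) ?_,
          .loop_true rfl ht (.loop_false rfl (hh _ hlen))⟩
        -- An overflow means that `a` had the largest possible value, so a marking that is not
        -- smaller is `a` itself, which has just been refuted.
        rintro ⟨a', ha', hv, hf'⟩
        have hl : a'.length = a.length := by simpa using congrArg List.length ha'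
        have := value_lt a'
        rw [hc, Bool.toNat_true] at hval
        rw [hl] at this
        obtain rfl := value_injective ha' (by omega)
        rw [hf] at hf'
        cases hf'
      | false =>
        simp only [hc] at ht
        rw [hc] at hval
        simp only [Bool.toNat_true, Bool.toNat_false, Nat.mul_zero, Nat.add_zero] at hval
        obtain ⟨t', b, a', ha', hb, ht'⟩ := ih (increment true a).1 (by rw [hlen]; omega)
        rw [hlen] at ht' ha'
        refine ⟨_, b, a', ha', hb.trans ?_, .loop_true rfl ht ht'⟩
        rw [map_fst_increment, hval]
        -- Passing from `value a` to its successor loses only the marking `a`, which was tested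
        -- without success.
        refine exists_congr fun a' => and_congr_right fun ha' => and_congr_left fun hf' => ?_
        refine ⟨fun h => by omega, fun h => ?_⟩
        rcases h.lt_or_eq with h | h
        · exact h
        · rw [value_injective ha' h.symm, hf] at hf'
          cases hf'

theorem runs_search
    (hM : ∀ y, ∃ t, (machineProgram M.tm).Runs (M.tm.initialState,
        single M.tm.k₀ (y.map M.inputAlphabet.invFun)) t (p.eval y.length : ℕ)
      (M.tm.initialState, single M.tm.k₁ [M.outputAlphabet.invFun (f y)]))
    (x : List Tok) {b : Bool}
    (hb : b = true ↔ ∃ a, a.map Prod.fst = x ∧ f (reduction a) = true) :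
    ∃ t, (search M).Runs (((none, {}), M.tm.initialState),
        Program.join (single .word x) fun _ => []) t (searchSpace M p x.length : ℕ)
      (((none, {}), M.tm.initialState), Program.join (single .res [b]) fun _ => []) := by
  obtain ⟨t, b', a, ha, hb', ht⟩ := runs_searchLoop hM (plain x)
  have hl : (plain x).length = x.length := by simp [plain]
  rw [hl] at ha ht
  obtain rfl : b = b' := by
    rw [Bool.eq_iff_iff, hb, hb']
    -- The search starts at the value zero, so it covers all markings of `x`.
    simp only [value_eq_zero, Nat.zero_le, true_and, map_fst_plain]
  refine ⟨_, (runs_liftLeft_space (does_startSearch x) ?_).seq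
    (ht.seq (runs_liftLeft_space (does_finish { ans := b } a) ?_))⟩
  · rw [height_single, searchSpace]
    omega
  · rw [height_verifierStacks, searchSpace, ha, List.length_nil]
    omega

end Search

theorem nonemptinessProblem_mem_PSPACE {L : FirstOrder.Language.{u, v}} {D : Type w}
    [L.Structure D] (c : SymbolCoding L) (h : satProblem c D ∈ Complexity.PSPACE Tok) :
    nonemptinessProblem c D ∈ Complexity.PSPACE Tok := by
  classical
  obtain ⟨M, p, hp⟩ := h
  have hM := fun y => machineProgram_runs_of_outputs (M.outputsFun y) (hp y)
  obtain ⟨q, hq⟩ := polyBounded_searchSpace M.toTM2ComputableAux p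
  have h := fun x : List Tok => runs_search (M := M.toTM2ComputableAux) hM x
    -- The answer of the search is identified with membership by `mem_nonemptinessProblem_iff`,
    -- where the given machine decides `satProblem` on every word, including words that encode no
    -- formula.
    (b := @decide (x ∈ nonemptinessProblem c D) (Classical.propDecidable _)) (by
      rw [decide_eq_true_iff, mem_nonemptinessProblem_iff]
      simp only [decide_eq_true_iff])
  choose t ht using h
  have hx : ∀ x : List Tok, x.map (Equiv.refl Tok).invFun = x := List.map_id
  refine ⟨⟨⟨jointMachine M.tm (search M.toTM2ComputableAux) .word .res, Equiv.refl Tok,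
    Equiv.refl Bool⟩, fun x => Nonempty.some ?_⟩, q, fun x cfg hc => ?_⟩
  · obtain ⟨h⟩ := jointMachine_outputsInTime (ht x)
    exact (congrArg (fun l => Nonempty (TM2Outputs (jointMachine M.tm
      (search M.toTM2ComputableAux) .word .res) l _)) (hx x)).mpr ⟨h.toTM2Outputs⟩
  · have h := jointMachine_cfgSpace_le (ht x) ((congrArg (fun l => StateTransition.Reaches _
      (initList (jointMachine M.tm (search M.toTM2ComputableAux) .word .res) l) cfg) (hx x)).mp hc)
    exact (Nat.cast_le.1 h).trans (hq x.length)

end ParametricGrammar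

theorem mainTheorem5 {L : FirstOrder.Language.{u, v}} (D : Type w) [Nonempty D] [L.Structure D]
    (c : ParametricGrammar.SymbolCoding L) :
    (ParametricGrammar.satProblem c D ∈ Complexity.NP ParametricGrammar.Tok →
      ParametricGrammar.nonemptinessProblem c D ∈ Complexity.NP ParametricGrammar.Tok) ∧
    (ParametricGrammar.satProblem c D ∈ Complexity.PSPACE ParametricGrammar.Tok →
      ParametricGrammar.nonemptinessProblem c D ∈ Complexity.PSPACE ParametricGrammar.Tok) := by
  exact ⟨ParametricGrammar.nonemptinessProblem_mem_NP c,
    ParametricGrammar.nonemptinessProblem_mem_PSPACE c⟩
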